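/- **Setting.** Let $V=\{1,\dots,N\}$ with $N\ge 1$, let $\omega_{\{x,y\}}\ge 0$ be symmetric conductances with $\omega_{\{x,x\}}=0$ such that the graph on $V$ with edges $\{x,y\}$, $\omega_{\{x,y\}}\neq 0$, is connected, let $\alpha_x\in\{1,2,\dots\}$ for $x\in V$, and let $\omega_L,\omega_R\ge 0$, $\alpha_L,\alpha_R>0$. Fix $\sigma\in\{-1,0,1\}$. Put $\Theta=[0,1]$ if $\sigma=-1$ and $\Theta=[0,\infty)$ if $\sigma\in\{0,1\}$, and let $\theta_L,\theta_R\in\Theta$. Let $\mathcal X=\prod_{x\in V}\{0,\dots,\alpha_x\}$ if $\sigma=-1$ and $\mathcal X=\mathbb N_0^V$ otherwise. The process $(\eta_t)_{t\ge0}$ is the continuous-time Markov chain on $\mathcal X$ with generator $$\mathcal L f(\eta)=\mathcal L^{\rm bulk}f(\eta)+\sum_{(j,x)\in\{(L,1),(R,N)\}}\omega_j\big[\eta(x)\alpha_j(1+\sigma\theta_j)(f(\eta-\delta_x)-f(\eta))+\alpha_j\theta_j(\alpha_x+\sigma\eta(x))(f(\eta+\delta_x)-f(\eta))\big],$$ $$\mathcal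 L^{\rm bulk}f(\eta)=\sum_{\{x,y\}}\omega_{\{x,y\}}\big[\eta(x)(\alpha_y+\sigma\eta(y))(f(\eta-\delta_x+\delta_y)-f(\eta))+\eta(y)(\alpha_x+\sigma\eta(x))(f(\eta-\delta_y+\delta_x)-f(\eta))\big].$$ The absorbing dual $(\xi_t)_{t\ge0}$ is the Markov chain on $\widehat{\mathcal X}=\mathcal X\times\mathbb N_0^{\{L,R\}}$ with generator $$\widehat{\mathcal L}f(\xi)=\mathcal L^{\rm bulk}f(\xi)+\omega_L\alpha_L\,\xi(1)(f(\xi-\delta_1+\delta_L)-f(\xi))+\omega_R\alpha_R\,\xi(N)(f(\xi-\delta_N+\delta_R)-f(\xi)),$$ where $\mathcal L^{\rm bulk}$ acts on the coordinates in $V$; $\widehat{\mathbb E}_\xi$ is expectation for $\xi_0=\xi$, and $|\xi|=\xi(L)+\xi(R)+\sum_{x\in V}\xi(x)$. For $\theta\in\Theta$ let $\mu_\theta=\bigotimes_{x\in V}\nu_{x,\theta}$ with $\nu_{x,\theta}$ equal to $\mathrm{Binomial}(\alpha_x,\theta)$, $\mathrm{Poisson}(\alpha_x\theta)$, $\text{Negative-Binomial}(\alpha_x,\frac{\theta}{1+\theta})$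 for $\sigma=-1,0,1$ respectively, and let $$D^{or}_\theta(\xi,\eta)=(\theta_L-\theta)^{\xi(L)}\Big(\prod_{x\in V}d_{x,\theta}(\xi(x),\eta(x))\Big)(\theta_R-\theta)^{\xi(R)},$$ $$d_{x,\theta}(k,n)=(-\theta)^k\times\begin{cases}{}_2F_1(-k,-n;-\alpha_x;\tfrac1\theta)&\sigma=-1\\ {}_2F_0(-k,-n;-;-\tfrac1{\theta\alpha_x})&\sigma=0\\ {}_2F_1(-k,-n;\alpha_x;-\tfrac1\theta)&\sigma=1,\end{cases}$$ where $0^0=1$ and, for $\theta=0$, $d_{x,0}(k,n)$ is the limit as $\theta\to0$, namely $d_{x,0}(k,n)=\frac{1}{w_x(k)}\frac{n!}{(n-k)!}\mathbf 1_{\{k\le n\}}$ with $w_x(k)=\frac{\alpha_x!}{(\alpha_x-k)!}$, $\alpha_x^k$, $\frac{\Gamma(\alpha_x+k)}{\Gamma(\alpha_x)}$ for $\sigma=-1,0,1$. **Proposition.** Let $b\in\mathbb R$ be such that $\theta:=\theta_R+b(\theta_L-\theta_R)\in\Theta$. (1) For all $t\ge0$ and all $\xi\in\widehat{\mathcal X}$,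 the function $D^{or}_\theta(\xi,\cdot)$ is integrable with respect to the law of $\eta_t$ when $\eta_0\sim\mu_\theta$, and $$\mathbb E_{\mu_\theta}\big[D^{or}_\theta(\xi,\eta_t)\big]=(\theta_L-\theta_R)^{|\xi|}\,\phi_{t,b}(\xi),\qquad \phi_{t,b}(\xi)=(-b)^{|\xi|}\,\widehat{\mathbb E}_\xi\Big[\big(\tfrac{b-1}{b}\big)^{\xi_t(L)}\mathbf 1_{\{\xi_t(L)+\xi_t(R)=|\xi|\}}\Big].$$ (2) Assume $\max(\omega_L,\omega_R)>0$. Then for every $\xi\in\widehat{\mathcal X}$ the laws of $\xi_t$ under $\xi_0=\xi$ converge, as $t\to\infty$, pointwise to a probability law on $\widehat{\mathcal X}$, the law of $\xi_\infty$; the process $(\eta_t)$ has a unique stationary probability measure $\mu_{\theta_L,\theta_R}$; and for all $\xi\in\widehat{\mathcal X}$ the function $D^{or}_\theta(\xi,\cdot)$ is $\mu_{\theta_L,\theta_R}$-integrable with $$\mathbb E_{\mu_{\theta_L,\theta_R}}\big[D^{or}_\theta(\xi,\eta)\big]=(\theta_L-\theta_R)^{|\xi|}\,\phi_b(\xi),\qquad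 \phi_b(\xi)=(-b)^{|\xi|}\,\widehat{\mathbb E}_\xi\Big[\big(\tfrac{b-1}{b}\big)^{\xi_\infty(L)}\Big].$$ For $b=0$ the expression $(-b)^{|\xi|}(\frac{b-1}{b})^{l}$, $0\le l\le|\xi|$, is read as its limit $\mathbf 1_{\{l=|\xi|\}}$, so that $\phi_{t,0}(\xi)=\widehat{\mathbb P}_\xi(\xi_t(L)=|\xi|)$ and $\phi_0(\xi)=\widehat{\mathbb P}_\xi(\xi_\infty(L)=|\xi|)$. The functions $\phi_{t,b}$ and $\phi_b$ do not depend on $\theta_L$ or $\theta_R$, but only on $b$, $\sigma$ and the parameters $N,(\omega_{\{x,y\}}),(\alpha_x),\omega_L,\omega_R,\alpha_L,\alpha_R$ (and on $t$). -/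

import Mathlib

open scoped ENNReal

noncomputable section

namespace BoundaryDriven

/-! ## Continuous-time Markov chains on a countable state space -/

/-- Matrix entries `q x y = (L 1_{y}) x` of an operator `L` acting on functions on `S`.  For the
generator of a jump process these are the jump rates for `y ≠ x`, and `-q x x` is the total rate of
leaving `x`. -/
def rateMatrix {S : Type*} [DecidableEq S] (L : (S → ℝ) → S → ℝ) (x y : S) : ℝ :=
  L (Pi.single y 1) x

/-- `jumpApprox q n t x y`: probability that the jump chain with rates `q`, started from `x`, is at
`y` at time `t` and has made fewer than `n` jumps up to that time (decomposition according to the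
time `s` and the target `z` of the first jump). -/
def jumpApprox {S : Type*} [DecidableEq S] (q : S → S → ℝ) : ℕ → ℝ → S → S → ℝ≥0∞
  | 0, _, _, _ => 0
  | n + 1, t, x, y =>
      (if x = y then ENNReal.ofReal (Real.exp (q x x * t)) else 0) +
        ∫⁻ s in Set.Icc (0 : ℝ) t, ENNReal.ofReal (Real.exp (q x x * s)) *
          ∑' z, (if z = x then 0 else ENNReal.ofReal (q x z)) * jumpApprox q n (t - s) z y

/-- Transition probabilities `p_t(x, y)` of the continuous-time Markov chain with generator `L`
(the minimal transition function of the rate matrix). -/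
def transitionProb {S : Type*} [DecidableEq S] (L : (S → ℝ) → S → ℝ) (t : ℝ) (x y : S) : ℝ≥0∞ :=
  ⨆ n : ℕ, jumpApprox (rateMatrix L) n t x y

/-- Law at time `t` of the chain with generator `L` whose initial law has mass function `μ`. -/
def lawAt {S : Type*} [DecidableEq S] (L : (S → ℝ) → S → ℝ) (μ : S → ℝ≥0∞) (t : ℝ) (y : S) :
    ℝ≥0∞ :=
  ∑' x, μ x * transitionProb L t x y

/-- The probability mass function `μ` is stationary for the chain with generator `L`. -/
def IsStationary {S : Type*} [DecidableEq S] (L : (S → ℝ) → S → ℝ) (μ : PMF S) : Prop :=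
  ∀ t : ℝ, 0 ≤ t → ∀ y : S, lawAt L μ t y = μ y

/-- The function `f` is integrable with respect to the mass function `μ`, with expectation `v`
(unconditional, equivalently absolute, convergence of the series). -/
def HasExpectation {S : Type*} (μ : S → ℝ≥0∞) (f : S → ℝ) (v : ℝ) : Prop :=
  HasSum (fun x => (μ x).toReal * f x) v

/-! ## The underlying geometry and the configuration spaces -/

/-- Parameters of the bulk `V = {1, …, N}` (here `Fin N`) and of its contacts with the reservoirs;
the scale parameters `θ_L`, `θ_R` are not part of them. -/
structure Geometry (N : ℕ) where
  hN : 0 < N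
  /-- conductances -/
  ω : Fin N → Fin N → ℝ
  ω_nonneg : ∀ x y, 0 ≤ ω x y
  ω_symm : ∀ x y, ω x y = ω y x
  ω_diag : ∀ x, ω x x = 0
  connected : (SimpleGraph.fromRel fun x y => ω x y ≠ 0).Connected
  /-- site parameters -/
  α : Fin N → ℕ
  α_pos : ∀ x, 0 < α x
  ωL : ℝ
  ωR : ℝ
  αL : ℝ
  αR : ℝ
  ωL_nonneg : 0 ≤ ωL
  ωR_nonneg : 0 ≤ ωR
  αL_pos : 0 < αL
  αR_pos : 0 < αR

namespace Geometry

variable {N : ℕ} (G : Geometry N)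

/-- The site attached to the left reservoir. -/
def first : Fin N := ⟨0, G.hN⟩

/-- The site attached to the right reservoir. -/
def last : Fin N := ⟨N - 1, Nat.sub_lt G.hN one_pos⟩

end Geometry

/-- The range of the scale parameters: `[0,1]` for exclusion, `[0,∞)` otherwise. -/
def scaleRange (σ : SignType) : Set ℝ := if σ = -1 then Set.Icc 0 1 else Set.Ici 0

/-- The configuration space: `∏ {0, …, α x}` for exclusion (`σ = -1`), and all of `ℕ^V` for
independent walkers (`σ = 0`) and inclusion (`σ = 1`). -/
abbrev Config {N : ℕ} (G : Geometry N) (σ : SignType) : Type :=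
  {η : Fin N → ℕ // σ = -1 → ∀ x, η x ≤ G.α x}

/-- Configurations of the dual: a bulk configuration together with `(ξ(L), ξ(R))`. -/
abbrev DualConfig {N : ℕ} (G : Geometry N) (σ : SignType) : Type := Config G σ × (ℕ × ℕ)

variable {N : ℕ} {G : Geometry N} {σ : SignType}

namespace Config

/-- Replace `η` by `η'` if the latter is admissible (transitions to inadmissible configurations
always carry the rate `0`, so that the default value is immaterial). -/
def replace (η : Config G σ) (η' : Fin N → ℕ) : Config G σ :=
  if h : σ = -1 → ∀ x, η' x ≤ G.α x then ⟨η', h⟩ else η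

/-- `η^{x,y} = η - δ_x + δ_y`. -/
def hop (η : Config G σ) (x y : Fin N) : Config G σ :=
  η.replace (η.1 - Pi.single x 1 + Pi.single y 1)

/-- `η^{x,-} = η - δ_x`. -/
def remove (η : Config G σ) (x : Fin N) : Config G σ := η.replace (η.1 - Pi.single x 1)

/-- `η^{x,+} = η + δ_x`. -/
def add (η : Config G σ) (x : Fin N) : Config G σ := η.replace (η.1 + Pi.single x 1)

end Config

/-- The total number of particles `|ξ|`. -/
def DualConfig.total (ξ : DualConfig G σ) : ℕ := ξ.2.1 + ξ.2.2 + ∑ x, ξ.1.1 x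

/-! ## Generators -/

/-- Single-bond generator. -/
def bondGenerator (x y : Fin N) (f : Config G σ → ℝ) (η : Config G σ) : ℝ :=
  (η.1 x : ℝ) * ((G.α y : ℝ) + (σ : ℝ) * η.1 y) * (f (η.hop x y) - f η) +
    (η.1 y : ℝ) * ((G.α x : ℝ) + (σ : ℝ) * η.1 x) * (f (η.hop y x) - f η)

/-- Bulk generator; the sum runs over unordered pairs of sites. -/
def bulkGenerator (f : Config G σ → ℝ) (η : Config G σ) : ℝ :=
  ∑ x, ∑ y ∈ Finset.Ioi x, G.ω x y * bondGenerator x y f η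

/-- Generator of the exchanges of the site `x` with a reservoir with parameters `a` and `θ`. -/
def reservoirGenerator (x : Fin N) (a θ : ℝ) (f : Config G σ → ℝ) (η : Config G σ) : ℝ :=
  (η.1 x : ℝ) * (a + (σ : ℝ) * a * θ) * (f (η.remove x) - f η) +
    a * θ * ((G.α x : ℝ) + (σ : ℝ) * η.1 x) * (f (η.add x) - f η)

/-- Generator of the boundary driven particle system. -/
def generator (G : Geometry N) (σ : SignType) (θL θR : ℝ) (f : Config G σ → ℝ)
    (η : Config G σ) : ℝ :=
  bulkGenerator f η + (G.ωL * reservoirGenerator G.first G.αL θL f η +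
    G.ωR * reservoirGenerator G.last G.αR θR f η)

/-- Generator of the dual particle system with absorbing sites `L` and `R`. -/
def dualGenerator (G : Geometry N) (σ : SignType) (f : DualConfig G σ → ℝ)
    (ξ : DualConfig G σ) : ℝ :=
  bulkGenerator (fun ζ => f (ζ, ξ.2)) ξ.1 +
    (G.ωL * G.αL * ξ.1.1 G.first *
        (f (ξ.1.remove G.first, (ξ.2.1 + 1, ξ.2.2)) - f ξ) +
      G.ωR * G.αR * ξ.1.1 G.last *
        (f (ξ.1.remove G.last, (ξ.2.1, ξ.2.2 + 1)) - f ξ))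

/-! ## The product measures -/

/-- The single-site marginals: Binomial(`a`, `θ`), Poisson(`a θ`), and
Negative-Binomial(`a`, `θ / (1 + θ)`) for `σ = -1, 0, 1`. -/
def marginal (σ : SignType) (a : ℕ) (θ : ℝ) (n : ℕ) : ℝ :=
  match σ with
  | .neg => (a.choose n : ℝ) * θ ^ n * (1 - θ) ^ (a - n)
  | .zero => Real.exp (-(a * θ)) * (a * θ) ^ n / (n.factorial : ℝ)
  | .pos => ((a + n - 1).choose n : ℝ) * (θ / (1 + θ)) ^ n * (1 / (1 + θ)) ^ a

/-- The mass function of the product measure `μ_θ`. -/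
def productMeasure (G : Geometry N) (σ : SignType) (θ : ℝ) (η : Config G σ) : ℝ≥0∞ :=
  ENNReal.ofReal (∏ x, marginal σ (G.α x) θ (η.1 x))

/-! ## Duality functions -/

/-- `n! / (n-l)! 1_{l ≤ n}`. -/
def falling (n l : ℕ) : ℝ := (n.descFactorial l : ℝ)

/-- The ratio `Γ(v + l) / Γ(v) = v (v + 1) ⋯ (v + l - 1)`. -/
def gammaRatio (v : ℝ) (l : ℕ) : ℝ := ∏ i ∈ Finset.range l, (v + i)

/-- The terminating hypergeometric sum `₂F₀(-k, -n; -; u)`. -/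
def hyp20 (k n : ℕ) (u : ℝ) : ℝ :=
  ∑ l ∈ Finset.range (k + 1), (k.choose l : ℝ) * falling n l * u ^ l

/-- The terminating hypergeometric sum `₂F₁(-k, -n; v; u)`. -/
def hyp21 (k n : ℕ) (v u : ℝ) : ℝ :=
  ∑ l ∈ Finset.range (k + 1), (k.choose l : ℝ) * (1 / gammaRatio v l * falling n l) * u ^ l

/-- The weights `w_x(k)` at a site with parameter `a`. -/
def siteWeight (σ : SignType) (a k : ℕ) : ℝ :=
  match σ with
  | .neg => falling a k
  | .zero => (a : ℝ) ^ k
  | .pos => gammaRatio a k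

/-- The classical single-site duality function. -/
def dClassical (σ : SignType) (a k n : ℕ) : ℝ := falling n k * (1 / siteWeight σ a k)

/-- The orthogonal single-site duality function at a site with parameter `a`.  At `θ = 0`, where
`1 / θ` is meaningless, it is its limit, the classical duality function. -/
def dOrthogonal (σ : SignType) (a : ℕ) (θ : ℝ) (k n : ℕ) : ℝ :=
  if θ = 0 then dClassical σ a k n
  else (-θ) ^ k *
    match σ with
    | .neg => hyp21 k n (-(a : ℝ)) (1 / θ)
    | .zero => hyp20 k n (-(1 / (θ * a)))
    | .pos => hyp21 k n (a : ℝ) (-(1 / θ))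

/-- The orthogonal duality function `D^or_θ(ξ, η)`. -/
def orthogonalDuality (θL θR θ : ℝ) (ξ : DualConfig G σ) (η : Config G σ) : ℝ :=
  (θL - θ) ^ ξ.2.1 * (∏ x, dOrthogonal σ (G.α x) θ (ξ.1.1 x) (η.1 x)) * (θR - θ) ^ ξ.2.2

/-! ## The universal factors, which involve neither `θ_L` nor `θ_R` -/

/-- The law of `ξ_∞` for the dual started from `ξ`, as the limit of the laws of `ξ_t`. -/
def dualLimit (G : Geometry N) (σ : SignType) (ξ ξ' : DualConfig G σ) : ℝ≥0∞ :=
  Filter.atTop.limUnder fun t : ℝ => transitionProb (dualGenerator G σ) t ξ ξ'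

/-- `φ_{t,b}(ξ) = (-b)^|ξ| E_ξ[((b-1)/b)^{ξ_t(L)} 1{ξ_t(L) + ξ_t(R) = |ξ|}]`.  For `b = 0` the
product `(-b)^|ξ| ((b-1)/b)^l` with `0 ≤ l ≤ |ξ|`, which equals `(1-b)^l (-b)^(|ξ|-l)` for `b ≠ 0`,
is read as `1{l = |ξ|}`. -/
def phiTime (G : Geometry N) (σ : SignType) (t b : ℝ) (ξ : DualConfig G σ) : ℝ :=
  if b = 0 then
    ∑' ξ' : DualConfig G σ, (transitionProb (dualGenerator G σ) t ξ ξ').toReal *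
      (if ξ'.2.1 = ξ.total then 1 else 0)
  else
    (-b) ^ ξ.total * ∑' ξ' : DualConfig G σ, (transitionProb (dualGenerator G σ) t ξ ξ').toReal *
      (((b - 1) / b) ^ ξ'.2.1 * (if ξ'.2.1 + ξ'.2.2 = ξ.total then 1 else 0))

/-- `φ_b(ξ) = (-b)^|ξ| E_ξ[((b-1)/b)^{ξ_∞(L)}]`, with the same reading for `b = 0`. -/
def phiInfinity (G : Geometry N) (σ : SignType) (b : ℝ) (ξ : DualConfig G σ) : ℝ :=
  if b = 0 then
    ∑' ξ' : DualConfig G σ, (dualLimit G σ ξ ξ').toReal * (if ξ'.2.1 = ξ.total then 1 else 0)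
  else
    (-b) ^ ξ.total * ∑' ξ' : DualConfig G σ,
      (dualLimit G σ ξ ξ').toReal * ((b - 1) / b) ^ ξ'.2.1

end BoundaryDriven

end

open scoped ENNReal
open MeasureTheory Filter Topology

set_option linter.unusedSectionVars false

noncomputable section

namespace BoundaryDriven


/-! ## Jump generators -/

section JumpGenerators

variable {S : Type*}

/-- `A` is a finite nonnegative combination of the increments `f ↦ f z - f x`. -/
def IsJumpAt (x : S) (A : (S → ℝ) → ℝ) : Prop :=
  ∃ c : S →₀ NNReal, ∀ f, A f = c.sum fun z r => (r : ℝ) * (f z - f x)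

/-- `L` is the generator of a jump process with finitely many possible jumps from each state. -/
def IsJumpGenerator (L : (S → ℝ) → S → ℝ) : Prop :=
  ∀ x, IsJumpAt x fun f => L f x

theorem IsJumpAt.zero (x : S) : IsJumpAt x fun _ => 0 := ⟨0, fun f => by simp⟩

theorem IsJumpAt.add {x : S} {A B : (S → ℝ) → ℝ} (hA : IsJumpAt x A) (hB : IsJumpAt x B) :
    IsJumpAt x fun f => A f + B f := by
  classical
  obtain ⟨c, hc⟩ := hA
  obtain ⟨d, hd⟩ := hB
  refine ⟨c + d, fun f => ?_⟩
  dsimp only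
  rw [Finsupp.sum_add_index', hc, hd]
  · simp
  · intro a b₁ b₂; push_cast; ring

theorem IsJumpAt.single (x z : S) {r : ℝ} (hr : 0 ≤ r) :
    IsJumpAt x fun f => r * (f z - f x) := by
  classical
  refine ⟨Finsupp.single z r.toNNReal, fun f => ?_⟩
  rw [Finsupp.sum_single_index] <;> simp [hr]

theorem IsJumpAt.const_mul {x : S} {A : (S → ℝ) → ℝ} (hA : IsJumpAt x A) {r : ℝ} (hr : 0 ≤ r) :
    IsJumpAt x fun f => r * A f := by
  classical
  obtain ⟨c, hc⟩ := hA
  refine ⟨c.mapRange (fun a => r.toNNReal * a) (by simp), fun f => ?_⟩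
  dsimp only
  rw [Finsupp.sum_mapRange_index (by simp), hc, Finsupp.sum, Finsupp.sum, Finset.mul_sum]
  refine Finset.sum_congr rfl fun z _ => ?_
  push_cast
  rw [Real.coe_toNNReal r hr, mul_assoc]

theorem IsJumpAt.sum {ι : Type*} {x : S} {A : ι → (S → ℝ) → ℝ} (s : Finset ι)
    (hA : ∀ i ∈ s, IsJumpAt x (A i)) : IsJumpAt x fun f => ∑ i ∈ s, A i f := by
  classical
  induction s using Finset.induction_on with
  | empty => simpa using IsJumpAt.zero x
  | insert a s ha ih =>
    simp only [Finset.sum_insert ha]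
    exact (hA a (by simp)).add (ih fun i hi => hA i (by simp [hi]))

theorem IsJumpAt.comp {T : Type*} {x : S} {A : (S → ℝ) → ℝ} (hA : IsJumpAt x A) (e : S → T) :
    IsJumpAt (e x) fun f => A fun z => f (e z) := by
  classical
  obtain ⟨c, hc⟩ := hA
  refine ⟨c.mapDomain e, fun f => ?_⟩
  dsimp only
  rw [Finsupp.sum_mapDomain_index, hc] <;> simp [add_mul]

variable [DecidableEq S] {L : (S → ℝ) → S → ℝ}

theorem IsJumpGenerator.normal_form (hL : IsJumpGenerator L) (x : S) :
    ∃ F : Finset S, x ∉ F ∧ (∀ z, z ≠ x → 0 ≤ rateMatrix L x z) ∧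
      (∀ z, z ∉ F → z ≠ x → rateMatrix L x z = 0) ∧
      (rateMatrix L x x = -∑ z ∈ F, rateMatrix L x z) ∧
      (∀ f, L f x = rateMatrix L x x * f x + ∑ z ∈ F, rateMatrix L x z * f z) := by
  obtain ⟨c, hc⟩ := hL x
  have hL' : ∀ f, L f x = ∑ z ∈ c.support.erase x, (c z : ℝ) * (f z - f x) := by
    intro f
    have := hc f
    dsimp only at this
    rw [this, Finsupp.sum, Finset.sum_erase]
    simp
  have hr : ∀ z, z ≠ x → rateMatrix L x z = c z := by
    intro z hz
    rw [rateMatrix, hL']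
    by_cases hzc : z ∈ c.support.erase x
    · rw [Finset.sum_eq_single_of_mem z hzc]
      · simp [hz.symm]
      · intro b _ hb; simp [hb, hz.symm]
    · rw [Finset.sum_eq_zero]
      · have : c z = 0 := by
          by_contra h
          exact hzc (by simp [hz, h])
        simp [this]
      · intro b hb
        have : b ≠ z := fun h => hzc (h ▸ hb)
        simp [this, hz.symm]
  have hF : ∀ z ∈ c.support.erase x, rateMatrix L x z = c z := fun z hz =>
    hr z (Finset.ne_of_mem_erase hz)
  have hxx : rateMatrix L x x = -∑ z ∈ c.support.erase x, rateMatrix L x z := by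
    rw [Finset.sum_congr rfl hF, rateMatrix, hL', ← Finset.sum_neg_distrib]
    refine Finset.sum_congr rfl fun z hz => ?_
    simp [Finset.ne_of_mem_erase hz]
  refine ⟨c.support.erase x, by simp, fun z hz => ?_, fun z hz hzx => ?_, hxx, fun f => ?_⟩
  · rw [hr z hz]; positivity
  · rw [hr z hzx]
    have : c z = 0 := by
      by_contra h
      exact hz (by simp [hzx, h])
    simp [this]
  · rw [hxx, hL' f, Finset.sum_congr rfl hF, neg_mul, Finset.sum_mul, ← Finset.sum_neg_distrib,
      ← Finset.sum_add_distrib]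
    refine Finset.sum_congr rfl fun z hz => ?_
    rw [hF z hz]
    ring

theorem IsJumpGenerator.rate_self_nonpos (hL : IsJumpGenerator L) (x : S) :
    rateMatrix L x x ≤ 0 := by
  obtain ⟨F, hx, h0, -, h, -⟩ := hL.normal_form x
  rw [h, neg_nonpos]
  exact Finset.sum_nonneg fun z hz => h0 z fun h => hx (h ▸ hz)

/-- The value of `L f` at a state is a fixed finite linear combination of the values of `f`. -/
theorem IsJumpGenerator.linear_form (hL : IsJumpGenerator L) (x : S) :
    ∃ (F : Finset S) (a : S → ℝ), ∀ f, L f x = ∑ z ∈ F, a z * f z := by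
  obtain ⟨F, hx, -, -, -, h⟩ := hL.normal_form x
  exact ⟨insert x F, rateMatrix L x, fun f => by rw [Finset.sum_insert hx, h]⟩

theorem IsJumpGenerator.map_sum (hL : IsJumpGenerator L) {ι : Type*} (s : Finset ι) (a : ι → ℝ)
    (f : ι → S → ℝ) (x : S) :
    L (fun z => ∑ i ∈ s, a i * f i z) x = ∑ i ∈ s, a i * L (f i) x := by
  obtain ⟨F, c, h⟩ := hL.linear_form x
  simp_rw [h, Finset.mul_sum]
  rw [Finset.sum_comm]
  exact Finset.sum_congr rfl fun _ _ => Finset.sum_congr rfl fun _ _ => by ring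

theorem IsJumpGenerator.map_sub (hL : IsJumpGenerator L) (f g : S → ℝ) (x : S) :
    L (fun z => f z - g z) x = L f x - L g x := by
  obtain ⟨F, c, h⟩ := hL.linear_form x
  simp_rw [h, mul_sub]
  exact Finset.sum_sub_distrib _ _

theorem IsJumpGenerator.map_const_mul (hL : IsJumpGenerator L) (a : ℝ) (f : S → ℝ) (x : S) :
    L (fun z => a * f z) x = a * L f x := by
  obtain ⟨F, c, h⟩ := hL.linear_form x
  simp_rw [h, Finset.mul_sum]
  exact Finset.sum_congr rfl fun _ _ => by ring

theorem IsJumpGenerator.map_const (hL : IsJumpGenerator L) (a : ℝ) (x : S) :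
    L (fun _ => a) x = 0 := by
  obtain ⟨c, h⟩ := hL x
  simp [h]

theorem IsJumpGenerator.nonpos_of_le (hL : IsJumpGenerator L) {f : S → ℝ} {x : S}
    (h : ∀ z, f z ≤ f x) : L f x ≤ 0 := by
  obtain ⟨c, hc⟩ := hL x
  refine (hc f).trans_le ?_
  exact Finset.sum_nonpos fun z _ => mul_nonpos_of_nonneg_of_nonpos (by positivity)
    (sub_nonpos.2 (h z))

end JumpGenerators

/-! ## Expectations under the minimal transition function -/

section Minimal

variable {S : Type*} [DecidableEq S]

/-- The jump rates, with the diagonal replaced by `0`. -/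
def jumpRate (q : S → S → ℝ) (x z : S) : ℝ≥0∞ := if z = x then 0 else ENNReal.ofReal (q x z)

theorem setLIntegral_Icc_sub_left (t : ℝ) (g : ℝ → ℝ≥0∞) :
    ∫⁻ s in Set.Icc 0 t, g (t - s) = ∫⁻ s in Set.Icc 0 t, g s := by
  rw [← lintegral_indicator measurableSet_Icc, ← lintegral_indicator measurableSet_Icc,
    ← lintegral_sub_left_eq_self _ t]
  refine lintegral_congr fun s => ?_
  by_cases hs : s ∈ Set.Icc 0 t
  · have : t - s ∈ Set.Icc 0 t := ⟨by linarith [hs.2], by linarith [hs.1]⟩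
    simp [hs, this]
  · have : t - s ∉ Set.Icc 0 t := fun h => hs ⟨by linarith [h.2], by linarith [h.1]⟩
    simp [hs, this]

theorem jumpApprox_succ (q : S → S → ℝ) (n : ℕ) (t : ℝ) (x y : S) :
    jumpApprox q (n + 1) t x y = ENNReal.ofReal (Real.exp (q x x * t)) *
      ((if x = y then 1 else 0) + ∫⁻ s in Set.Icc 0 t, ENNReal.ofReal (Real.exp (-(q x x * s))) *
        ∑' z, jumpRate q x z * jumpApprox q n s z y) := by
  rw [jumpApprox, mul_add, ← lintegral_const_mul' _ _ ENNReal.ofReal_ne_top,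
    ← setLIntegral_Icc_sub_left t]
  congr 1
  · split_ifs <;> simp
  · refine lintegral_congr fun s => ?_
    rw [← mul_assoc, ← ENNReal.ofReal_mul (Real.exp_nonneg _), ← Real.exp_add]
    simp only [sub_sub_cancel, jumpRate]
    congr 3
    ring_nf

theorem measurable_setLIntegral_Icc (g : ℝ → ℝ≥0∞) :
    Measurable fun t : ℝ => ∫⁻ s in Set.Icc 0 t, g s :=
  Monotone.measurable fun _ _ h => lintegral_mono_set (Set.Icc_subset_Icc_right h)

theorem measurable_jumpApprox (q : S → S → ℝ) (n : ℕ) (x y : S) :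
    Measurable fun t => jumpApprox q n t x y := by
  cases n with
  | zero => simp [jumpApprox]
  | succ n =>
    simp_rw [jumpApprox_succ]
    refine Measurable.mul (by fun_prop) (Measurable.add measurable_const ?_)
    exact measurable_setLIntegral_Icc _

theorem jumpApprox_mono (q : S → S → ℝ) (t : ℝ) (x y : S) :
    Monotone fun n => jumpApprox q n t x y := by
  refine monotone_nat_of_le_succ fun n => ?_
  induction n generalizing t x with
  | zero => simp [jumpApprox]
  | succ n ih =>
    rw [jumpApprox_succ, jumpApprox_succ]
    gcongr
    exact ih _ _

/-- The expectation of `f` at time `t` on the event that there have been fewer than `n` jumps. -/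
def expectApprox (q : S → S → ℝ) (f : S → ℝ≥0∞) (n : ℕ) (t : ℝ) (x : S) : ℝ≥0∞ :=
  ∑' y, jumpApprox q n t x y * f y

variable [Countable S]

theorem measurable_tsum_jumpApprox (q : S → S → ℝ) (f : S → ℝ≥0∞) (n : ℕ) (x : S) :
    Measurable fun t => expectApprox q f n t x :=
  Measurable.tsum fun y => (measurable_jumpApprox q n x y).mul_const _

theorem expectApprox_succ (q : S → S → ℝ) (f : S → ℝ≥0∞) (n : ℕ) (t : ℝ) (x : S) :
    expectApprox q f (n + 1) t x = ENNReal.ofReal (Real.exp (q x x * t)) *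
      (f x + ∫⁻ s in Set.Icc 0 t, ENNReal.ofReal (Real.exp (-(q x x * s))) *
        ∑' z, jumpRate q x z * expectApprox q f n s z) := by
  have hm : ∀ y, Measurable fun s => ENNReal.ofReal (Real.exp (-(q x x * s))) *
      ∑' z, jumpRate q x z * jumpApprox q n s z y := fun y =>
    Measurable.mul (by fun_prop)
      (Measurable.tsum fun z => (measurable_jumpApprox q n z y).const_mul _)
  simp_rw [expectApprox, jumpApprox_succ, mul_assoc]
  rw [ENNReal.tsum_mul_left]
  simp_rw [add_mul]
  rw [ENNReal.tsum_add]
  congr 2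
  · rw [tsum_eq_single x]
    · simp
    · intro y hy; simp [hy.symm]
  · simp_rw [← fun y => lintegral_mul_const (μ := volume.restrict (Set.Icc 0 t)) (f y) (hm y)]
    rw [← lintegral_tsum fun y => ((hm y).mul_const _).aemeasurable]
    refine lintegral_congr fun s => ?_
    simp_rw [mul_assoc]
    rw [ENNReal.tsum_mul_left]
    congr 1
    simp_rw [← ENNReal.tsum_mul_right, ← ENNReal.tsum_mul_left]
    rw [ENNReal.tsum_comm]
    simp_rw [mul_assoc]

theorem expectApprox_mono (q : S → S → ℝ) (f : S → ℝ≥0∞) (t : ℝ) (x : S) :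
    Monotone fun n => expectApprox q f n t x := fun _ _ h =>
  ENNReal.tsum_le_tsum fun y => by gcongr; exact jumpApprox_mono q t x y h

theorem ENNReal_tsum_iSup {ι : Type*} [Countable ι] {g : ℕ → ι → ℝ≥0∞}
    (hg : ∀ i, Monotone fun n => g n i) :
    ∑' i, ⨆ n, g n i = ⨆ n, ∑' i, g n i := by
  let _ : MeasurableSpace ι := ⊤
  simp_rw [← lintegral_count]
  exact lintegral_iSup (fun n => measurable_from_top) fun _ _ h i => hg i h

/-- The expectation of a nonnegative function at time `t`. -/
def expect (L : (S → ℝ) → S → ℝ) (f : S → ℝ≥0∞) (t : ℝ) (x : S) : ℝ≥0∞ :=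
  ∑' y, transitionProb L t x y * f y

theorem expect_eq_iSup (L : (S → ℝ) → S → ℝ) (f : S → ℝ≥0∞) (t : ℝ) (x : S) :
    expect L f t x = ⨆ n, expectApprox (rateMatrix L) f n t x := by
  simp_rw [expect, transitionProb, ENNReal.iSup_mul]
  exact ENNReal_tsum_iSup fun y n m h => by
    dsimp only; gcongr; exact jumpApprox_mono _ _ _ _ h

theorem measurable_expect (L : (S → ℝ) → S → ℝ) (f : S → ℝ≥0∞) (x : S) :
    Measurable fun t => expect L f t x := by
  simp_rw [expect_eq_iSup]
  exact Measurable.iSup fun n => measurable_tsum_jumpApprox _ _ _ _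

/-- The integral form of the backward equation. -/
theorem expect_eq (L : (S → ℝ) → S → ℝ) (f : S → ℝ≥0∞) (t : ℝ) (x : S) :
    expect L f t x = ENNReal.ofReal (Real.exp (rateMatrix L x x * t)) *
      (f x + ∫⁻ s in Set.Icc 0 t, ENNReal.ofReal (Real.exp (-(rateMatrix L x x * s))) *
        ∑' z, jumpRate (rateMatrix L) x z * expect L f s z) := by
  have h0 : expect L f t x = ⨆ n, expectApprox (rateMatrix L) f (n + 1) t x := by
    rw [expect_eq_iSup]
    exact ((expectApprox_mono _ f t x).iSup_nat_add 1).symm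
  rw [h0]
  simp_rw [expectApprox_succ, ← ENNReal.mul_iSup, ← ENNReal.add_iSup]
  rw [← lintegral_iSup]
  · congr 3
    ext s
    rw [← ENNReal.mul_iSup, ← ENNReal_tsum_iSup]
    · simp_rw [← ENNReal.mul_iSup, ← expect_eq_iSup]
    · intro z n m h
      dsimp only; gcongr; exact expectApprox_mono _ _ _ _ h
  · intro n
    exact Measurable.mul (by fun_prop)
      (Measurable.tsum fun z => (measurable_tsum_jumpApprox _ f n z).const_mul _)
  · intro n m h s
    dsimp only
    gcongr
    exact expectApprox_mono _ _ _ _ h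

variable {L : (S → ℝ) → S → ℝ}

theorem transitionProb_zero (L : (S → ℝ) → S → ℝ) (x y : S) :
    transitionProb L 0 x y = if x = y then 1 else 0 := by
  have h := expect_eq L (Pi.single y 1) 0 x
  have h1 : ∀ t, expect L (Pi.single y 1) t x = transitionProb L t x y := fun t => by
    rw [expect, tsum_eq_single y]
    · simp
    · intro z hz; simp [hz]
  rw [h1] at h
  rw [h]
  simp [Pi.single_apply]

/-- Transition probabilities are positive along sequences of possible jumps. -/
theorem transitionProb_pos_of_reflTransGen {x y : S}
    (h : Relation.ReflTransGen (fun x z => x ≠ z ∧ 0 < rateMatrix L x z) x y) :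
    ∀ t, 0 < t → 0 < transitionProb L t x y := by
  have h1 : ∀ t x, expect L (Pi.single y 1) t x = transitionProb L t x y := fun t x => by
    rw [expect, tsum_eq_single y]
    · simp
    · intro z hz; simp [hz]
  induction h using Relation.ReflTransGen.head_induction_on with
  | refl =>
    intro t _
    rw [← h1, expect_eq]
    exact ENNReal.mul_pos (ENNReal.ofReal_pos.2 (Real.exp_pos _)).ne' (by simp)
  | @head x z hxz _ ih =>
    intro t ht
    rw [← h1, expect_eq]
    refine ENNReal.mul_pos (ENNReal.ofReal_pos.2 (Real.exp_pos _)).ne' ?_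
    suffices h : 0 < ∫⁻ s in Set.Icc 0 t, ENNReal.ofReal (Real.exp (-(rateMatrix L x x * s))) *
        ∑' z, jumpRate (rateMatrix L) x z * expect L (Pi.single y 1) s z by
      exact (h.trans_le (le_add_of_nonneg_left zero_le)).ne'
    rw [setLIntegral_pos_iff]
    · have : Set.Ioc 0 t ⊆ (Function.support fun s : ℝ =>
          ENNReal.ofReal (Real.exp (-(rateMatrix L x x * s))) *
        ∑' z, jumpRate (rateMatrix L) x z * expect L (Pi.single y 1) s z) ∩ Set.Icc 0 t := by
        refine fun s hs => ⟨?_, hs.1.le, hs.2⟩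
        refine (ENNReal.mul_pos (ENNReal.ofReal_pos.2 (Real.exp_pos _)).ne' ?_).ne'
        refine (lt_of_lt_of_le ?_ (ENNReal.le_tsum z)).ne'
        refine ENNReal.mul_pos ?_ ?_
        · simp [jumpRate, hxz.1.symm, hxz.2]
        · rw [h1]; exact (ih s hs.1).ne'
      refine lt_of_lt_of_le ?_ (measure_mono this)
      simp [ht]
    · exact Measurable.mul (by fun_prop)
        (Measurable.tsum fun z => (measurable_expect _ _ z).const_mul _)

end Minimal


/-! ## The backward equation and the maximum principle -/

section Backward

variable {S : Type*}

/-- `v` solves the backward equation `∂ₜ v = L v`. -/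
structure BackwardSolution (L : (S → ℝ) → S → ℝ) (v : ℝ → S → ℝ) : Prop where
  cont : ∀ x, ContinuousOn (fun t => v t x) (Set.Ici 0)
  deriv : ∀ x t, 0 < t → HasDerivAt (fun t => v t x) (L (v t) x) t

/-- `ψ` is a growth rate which the process with generator `L` propagates, and which is negligible
with respect to a Lyapunov function. -/
structure IsControl (L : (S → ℝ) → S → ℝ) (ψ : S → ℝ) : Prop where
  nonneg : ∀ x, 0 ≤ ψ x
  growth : ∃ c, 0 ≤ c ∧ ∀ x, L ψ x ≤ c * ψ x
  proper : ∃ W : S → ℝ, (∀ x, 0 ≤ W x) ∧ (∃ c, 0 < c ∧ ∀ x, L W x ≤ c * W x) ∧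
    ∀ ε, 0 < ε → {x | ε * W x ≤ ψ x}.Finite

/-- `v` is dominated by a multiple of `ψ`, uniformly on compact time intervals. -/
def LocallyDominated (ψ : S → ℝ) (v : ℝ → S → ℝ) : Prop :=
  ∀ T : ℝ, ∃ C, 0 < C ∧ ∀ t ∈ Set.Icc 0 T, ∀ x, |v t x| ≤ C * ψ x

/-- `f` is dominated by a multiple of `ψ`. -/
def Dominated (ψ f : S → ℝ) : Prop := ∃ C, 0 < C ∧ ∀ x, |f x| ≤ C * ψ x

variable {L : (S → ℝ) → S → ℝ} {ψ : S → ℝ}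

theorem LocallyDominated.sub (v w : ℝ → S → ℝ) (hv : LocallyDominated ψ v)
    (hw : LocallyDominated ψ w) : LocallyDominated ψ fun t x => v t x - w t x := by
  intro T
  obtain ⟨C, hC, h⟩ := hv T
  obtain ⟨D, hD, h'⟩ := hw T
  refine ⟨C + D, by positivity, fun t ht x => ?_⟩
  have := abs_sub (v t x) (w t x)
  nlinarith [h t ht x, h' t ht x]

theorem BackwardSolution.sub (hL : IsJumpGenerator L) {v w : ℝ → S → ℝ}
    (hv : BackwardSolution L v) (hw : BackwardSolution L w) :
    BackwardSolution L fun t x => v t x - w t x where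
  cont x := (hv.cont x).sub (hw.cont x)
  deriv x t ht := by
    classical
    rw [hL.map_sub]
    exact (hv.deriv x t ht).sub (hw.deriv x t ht)

theorem BackwardSolution.const {f : S → ℝ} (hf : ∀ x, L f x = 0) :
    BackwardSolution L fun _ => f where
  cont x := continuousOn_const
  deriv x t ht := by rw [hf]; exact hasDerivAt_const _ _

theorem BackwardSolution.shift {v : ℝ → S → ℝ} (hv : BackwardSolution L v) {s : ℝ} (hs : 0 ≤ s) :
    BackwardSolution L fun t => v (t + s) where
  cont x := (hv.cont x).comp (by fun_prop) fun t ht => add_nonneg ht hs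
  deriv x t ht := (hv.deriv x (t + s) (by linarith)).comp_add_const t s

/-- The generator maps solutions of the backward equation to solutions. -/
theorem BackwardSolution.map (hL : IsJumpGenerator L) {v : ℝ → S → ℝ}
    (hv : BackwardSolution L v) : BackwardSolution L fun t => L (v t) := by
  classical
  refine ⟨fun x => ?_, fun x t ht => ?_⟩ <;> obtain ⟨F, a, h⟩ := hL.linear_form x <;> simp_rw [h]
  · exact continuousOn_finsetSum _ fun z _ => (hv.cont z).const_mul _
  · exact HasDerivAt.fun_sum fun z _ => (hv.deriv z t ht).const_mul _

/-- The maximum principle. -/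
theorem BackwardSolution.nonpos (hL : IsJumpGenerator L) (hψ : IsControl L ψ)
    {w : ℝ → S → ℝ} (hw : BackwardSolution L w) (hdom : LocallyDominated ψ w)
    (h0 : ∀ x, w 0 x ≤ 0) {t : ℝ} (ht : 0 ≤ t) (x : S) : w t x ≤ 0 := by
  classical
  obtain ⟨W, hW0, ⟨c, hc, hLW⟩, hfin⟩ := hψ.proper
  obtain ⟨C, hC, hCw⟩ := hdom t
  have key : ∀ ε : ℝ, 0 < ε → ∀ s ∈ Set.Icc 0 t, ∀ y, Real.exp (-c * s) * w s y ≤ ε * W y := by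
    intro ε hε s₁ hs₁ y₁
    by_contra! hlt
    set z : ℝ → S → ℝ := fun s y => Real.exp (-c * s) * w s y - ε * W y with hz
    have hz₁ : 0 < z s₁ y₁ := by simp only [hz]; linarith
    have hF := hfin (ε / C) (by positivity)
    have hout : ∀ s ∈ Set.Icc 0 t, ∀ y, y ∉ hF.toFinset → z s y ≤ 0 := by
      intro s hs y hy
      simp only [Set.Finite.mem_toFinset, Set.mem_ofPred_eq, not_le] at hy
      have h1 : C * ψ y ≤ ε * W y := by
        rw [div_mul_eq_mul_div, lt_div_iff₀ hC] at hy
        linarith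
      have h2 : Real.exp (-c * s) ≤ 1 := Real.exp_le_one_iff.2 (by nlinarith [hs.1])
      have h3 : Real.exp (-c * s) * w s y ≤ Real.exp (-c * s) * |w s y| := by
        gcongr; exact le_abs_self _
      have h4 : Real.exp (-c * s) * |w s y| ≤ 1 * |w s y| := by gcongr
      have := hCw s hs y
      simp only [hz]; linarith
    have hcont : ∀ y, ContinuousOn (fun s => z s y) (Set.Icc 0 t) := fun y =>
      (((by fun_prop : Continuous fun s : ℝ => Real.exp (-c * s)).continuousOn.mul
        ((hw.cont y).mono Set.Icc_subset_Ici_self)).sub continuousOn_const)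
    have hmax : ∀ y, ∃ s ∈ Set.Icc 0 t, ∀ r ∈ Set.Icc 0 t, z r y ≤ z s y := fun y =>
      isCompact_Icc.exists_isMaxOn ⟨0, by simp [ht]⟩ (hcont y)
    choose τ hτ hτmax using hmax
    have hy₁ : y₁ ∈ hF.toFinset := by
      by_contra h
      exact absurd (hout s₁ hs₁ y₁ h) (not_le.2 hz₁)
    obtain ⟨y₀, hy₀, hy₀max⟩ := hF.toFinset.exists_max_image (fun y => z (τ y) y) ⟨y₁, hy₁⟩
    have hpos : 0 < z (τ y₀) y₀ :=
      hz₁.trans_le ((hτmax y₁ s₁ hs₁).trans (hy₀max y₁ hy₁))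
    have hall : ∀ s ∈ Set.Icc 0 t, ∀ y, z s y ≤ z (τ y₀) y₀ := by
      intro s hs y
      by_cases hy : y ∈ hF.toFinset
      · exact (hτmax y s hs).trans (hy₀max y hy)
      · exact (hout s hs y hy).trans hpos.le
    set s₀ := τ y₀ with hs₀
    have hs₀mem : s₀ ∈ Set.Icc 0 t := hτ y₀
    have hs₀pos : 0 < s₀ := by
      refine lt_of_le_of_ne hs₀mem.1 fun h => ?_
      rw [← h] at hpos
      simp only [hz, mul_zero, Real.exp_zero, one_mul] at hpos
      have := mul_nonneg hε.le (hW0 y₀)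
      linarith [h0 y₀]
    have hd : HasDerivAt (fun s => z s y₀) (Real.exp (-c * s₀) * -c * w s₀ y₀ +
        Real.exp (-c * s₀) * L (w s₀) y₀) s₀ := by
      have h1 : HasDerivAt (fun s : ℝ => Real.exp (-c * s)) (Real.exp (-c * s₀) * -c) s₀ := by
        have : HasDerivAt (fun s : ℝ => -c * s) (-c) s₀ := by
          simpa using (hasDerivAt_id s₀).const_mul (-c)
        exact this.exp
      exact (h1.mul (hw.deriv y₀ s₀ hs₀pos)).sub_const _
    have hd0 : 0 ≤ Real.exp (-c * s₀) * -c * w s₀ y₀ + Real.exp (-c * s₀) * L (w s₀) y₀ := by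
      by_contra! hneg
      have hev := hd.hasDerivWithinAt (s := Set.Iio s₀)
      rw [hasDerivWithinAt_iff_tendsto_slope' (by simp)] at hev
      have hmem : ∀ᶠ s in 𝓝[<] s₀, s ∈ Set.Ioo 0 s₀ := Ioo_mem_nhdsLT hs₀pos
      have hge : 0 ≤ Real.exp (-c * s₀) * -c * w s₀ y₀ + Real.exp (-c * s₀) * L (w s₀) y₀ := by
        refine ge_of_tendsto hev (hmem.mono fun s hs => ?_)
        rw [slope_def_field]
        refine div_nonneg_of_nonpos ?_ (by linarith [hs.2])
        have := hall s ⟨hs.1.le, hs.2.le.trans hs₀mem.2⟩ y₀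
        linarith
      linarith
    have hLz : L (z s₀) y₀ ≤ 0 := hL.nonpos_of_le fun y => hall s₀ hs₀mem y
    have hLz' : L (z s₀) y₀ = Real.exp (-c * s₀) * L (w s₀) y₀ - ε * L W y₀ := by
      rw [← hL.map_const_mul, ← hL.map_const_mul, ← hL.map_sub]
    rw [hLz'] at hLz
    have h1 : ε * L W y₀ ≤ ε * (c * W y₀) := by gcongr; exact hLW y₀
    have h2 : 0 < c * (Real.exp (-c * s₀) * w s₀ y₀ - ε * W y₀) := mul_pos hc hpos
    nlinarith
  have hlim : Tendsto (fun ε : ℝ => ε * W x) (𝓝[>] 0) (𝓝 0) := by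
    have : Tendsto (fun ε : ℝ => ε * W x) (𝓝 0) (𝓝 (0 * W x)) := by
      exact (continuous_id.mul continuous_const).tendsto 0
    rw [zero_mul] at this
    exact this.mono_left nhdsWithin_le_nhds
  have hle : Real.exp (-c * t) * w t x ≤ 0 :=
    ge_of_tendsto hlim (eventually_mem_nhdsWithin.mono fun ε hε => key ε hε t ⟨ht, le_rfl⟩ x)
  exact nonpos_of_mul_nonpos_right hle (Real.exp_pos _)

/-- Dominated solutions of the backward equation are determined by their initial values. -/
theorem BackwardSolution.unique (hL : IsJumpGenerator L) (hψ : IsControl L ψ)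
    {v w : ℝ → S → ℝ} (hv : BackwardSolution L v) (hw : BackwardSolution L w)
    (hdv : LocallyDominated ψ v) (hdw : LocallyDominated ψ w) (h0 : ∀ x, v 0 x = w 0 x)
    {t : ℝ} (ht : 0 ≤ t) (x : S) : v t x = w t x := by
  have h1 := (hv.sub hL hw).nonpos hL hψ (hdv.sub _ _ hdw) (fun x => by simp [h0]) ht x
  have h2 := (hw.sub hL hv).nonpos hL hψ (hdw.sub _ _ hdv) (fun x => by simp [h0]) ht x
  linarith

end Backward


/-! ## The semigroup -/

section Semigroup

variable {S : Type*} [DecidableEq S] [Countable S] {L : (S → ℝ) → S → ℝ} {ψ : S → ℝ}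

theorem tsum_jumpRate_mul {x : S} {F : Finset S} (hx : x ∉ F)
    (h0 : ∀ z, z ∉ F → z ≠ x → rateMatrix L x z = 0) (g : S → ℝ≥0∞) :
    ∑' z, jumpRate (rateMatrix L) x z * g z = ∑ z ∈ F, ENNReal.ofReal (rateMatrix L x z) * g z := by
  rw [tsum_eq_sum (s := F)]
  · refine Finset.sum_congr rfl fun z hz => ?_
    rw [jumpRate, if_neg (show z ≠ x from fun h => hx (h ▸ hz))]
  · intro z hz
    rw [jumpRate]
    split_ifs with h
    · simp
    · simp [h0 z hz h]

theorem integral_deriv_exp (a t : ℝ) (b : ℝ) :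
    ∫ s in (0 : ℝ)..t, a * Real.exp (a * s) * b = (Real.exp (a * t) - 1) * b := by
  have h : ∀ s ∈ Set.uIcc 0 t, HasDerivAt (fun s => Real.exp (a * s) * b)
      (a * Real.exp (a * s) * b) s := by
    intro s _
    have h1 : HasDerivAt (fun s : ℝ => a * s) a s := by
      simpa using (hasDerivAt_id s).const_mul a
    have := h1.exp.mul_const b
    rwa [mul_comm (Real.exp _) a] at this
  rw [intervalIntegral.integral_eq_sub_of_hasDerivAt h
    (by apply Continuous.intervalIntegrable; fun_prop)]
  simp; ring

theorem expect_le_of_growth (hL : IsJumpGenerator L) (hψ0 : ∀ x, 0 ≤ ψ x) {c : ℝ} (hc : 0 ≤ c)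
    (hψ : ∀ x, L ψ x ≤ c * ψ x) {f : S → ℝ≥0∞} (hf : ∀ x, f x ≤ ENNReal.ofReal (ψ x))
    {t : ℝ} (ht : 0 ≤ t) (x : S) :
    expect L f t x ≤ ENNReal.ofReal (Real.exp (c * t) * ψ x) := by
  rw [expect_eq_iSup]
  refine iSup_le fun n => ?_
  induction n generalizing t x with
  | zero => simp [expectApprox, jumpApprox]
  | succ n ih =>
    obtain ⟨F, hx, hr0, hr1, hxx, hLf⟩ := hL.normal_form x
    have hq := hL.rate_self_nonpos x
    set q := rateMatrix L x x
    have hsum : ∑ z ∈ F, rateMatrix L x z * ψ z ≤ (c - q) * ψ x := by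
      have := hψ x
      rw [hLf] at this
      linarith
    have hnn : ∀ z ∈ F, 0 ≤ rateMatrix L x z := fun z hz => hr0 z fun h => hx (h ▸ hz)
    have hbound : ∀ s ∈ Set.Icc 0 t, ENNReal.ofReal (Real.exp (-(q * s))) *
        ∑' z, jumpRate (rateMatrix L) x z * expectApprox (rateMatrix L) f n s z ≤
        ENNReal.ofReal ((c - q) * Real.exp ((c - q) * s) * ψ x) := by
      intro s hs
      rw [tsum_jumpRate_mul hx hr1]
      have h1 : ∑ z ∈ F, ENNReal.ofReal (rateMatrix L x z) * expectApprox (rateMatrix L) f n s z ≤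
          ∑ z ∈ F, ENNReal.ofReal (rateMatrix L x z) * ENNReal.ofReal (Real.exp (c * s) * ψ z) := by
        gcongr with z hz
        exact ih hs.1 z
      have h2 : ∑ z ∈ F, ENNReal.ofReal (rateMatrix L x z) *
          ENNReal.ofReal (Real.exp (c * s) * ψ z) =
          ENNReal.ofReal (∑ z ∈ F, rateMatrix L x z * (Real.exp (c * s) * ψ z)) := by
        rw [ENNReal.ofReal_sum_of_nonneg]
        · exact Finset.sum_congr rfl fun z hz => (ENNReal.ofReal_mul (hnn z hz)).symm
        · exact fun z hz => mul_nonneg (hnn z hz) (mul_nonneg (Real.exp_nonneg _) (hψ0 z))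
      rw [h2] at h1
      calc _ ≤ ENNReal.ofReal (Real.exp (-(q * s))) *
            ENNReal.ofReal (∑ z ∈ F, rateMatrix L x z * (Real.exp (c * s) * ψ z)) := by gcongr
        _ = ENNReal.ofReal (Real.exp (-(q * s)) *
            ∑ z ∈ F, rateMatrix L x z * (Real.exp (c * s) * ψ z)) :=
          (ENNReal.ofReal_mul (Real.exp_nonneg _)).symm
        _ ≤ _ := by
          apply ENNReal.ofReal_le_ofReal
          have h3 : ∑ z ∈ F, rateMatrix L x z * (Real.exp (c * s) * ψ z) =
              Real.exp (c * s) * ∑ z ∈ F, rateMatrix L x z * ψ z := by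
            rw [Finset.mul_sum]; exact Finset.sum_congr rfl fun _ _ => by ring
          have h4 : Real.exp ((c - q) * s) = Real.exp (-(q * s)) * Real.exp (c * s) := by
            rw [← Real.exp_add]; ring_nf
          rw [h3, h4]
          have : 0 ≤ Real.exp (-(q * s)) * Real.exp (c * s) := by positivity
          nlinarith [mul_le_mul_of_nonneg_left hsum this]
    have hint : ∫⁻ s in Set.Icc 0 t, ENNReal.ofReal (Real.exp (-(q * s))) *
        ∑' z, jumpRate (rateMatrix L) x z * expectApprox (rateMatrix L) f n s z ≤
        ENNReal.ofReal ((Real.exp ((c - q) * t) - 1) * ψ x) := by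
      refine (setLIntegral_mono' measurableSet_Icc hbound).trans ?_
      rw [← integral_deriv_exp, intervalIntegral.integral_of_le ht, ← integral_Icc_eq_integral_Ioc,
        ofReal_integral_eq_lintegral_ofReal]
      · exact (Continuous.integrableOn_Icc (by fun_prop))
      · exact Eventually.of_forall fun s =>
          mul_nonneg (mul_nonneg (by linarith) (Real.exp_nonneg _)) (hψ0 x)
    rw [expectApprox_succ]
    calc _ ≤ ENNReal.ofReal (Real.exp (q * t)) *
          (ENNReal.ofReal (ψ x) + ENNReal.ofReal ((Real.exp ((c - q) * t) - 1) * ψ x)) := by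
          gcongr
          exact hf x
      _ = ENNReal.ofReal (Real.exp (c * t) * ψ x) := by
          have h1 : 0 ≤ Real.exp ((c - q) * t) - 1 := by
            rw [sub_nonneg]; exact Real.one_le_exp (mul_nonneg (by linarith) ht)
          rw [← ENNReal.ofReal_add (hψ0 x) (mul_nonneg h1 (hψ0 x)),
            ← ENNReal.ofReal_mul (Real.exp_nonneg _)]
          congr 1
          have h4 : Real.exp (c * t) = Real.exp (q * t) * Real.exp ((c - q) * t) := by
            rw [← Real.exp_add]; ring_nf
          rw [h4]; ring

/-- The semigroup of the minimal transition function, acting on real functions. -/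
def semigroup (L : (S → ℝ) → S → ℝ) (t : ℝ) (f : S → ℝ) (x : S) : ℝ :=
  ∑' y, (transitionProb L t x y).toReal * f y

theorem semigroup_eq_toReal_expect {f : S → ℝ} (hf : ∀ x, 0 ≤ f x) {t : ℝ} {x : S}
    (h : expect L (fun y => ENNReal.ofReal (f y)) t x ≠ ⊤) :
    semigroup L t f x = (expect L (fun y => ENNReal.ofReal (f y)) t x).toReal := by
  rw [expect, ENNReal.tsum_toReal_eq, semigroup]
  · simp [hf]
  · exact fun y => ENNReal.ne_top_of_tsum_ne_top h y

theorem IsControl.const_mul (hL : IsJumpGenerator L) (hψ : IsControl L ψ) {C : ℝ} (hC : 0 < C) :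
    ∃ c, 0 ≤ c ∧ (∀ x, 0 ≤ C * ψ x) ∧ ∀ x, L (fun z => C * ψ z) x ≤ c * (C * ψ x) := by
  obtain ⟨c, hc, h⟩ := hψ.growth
  refine ⟨c, hc, fun x => mul_nonneg hC.le (hψ.nonneg x), fun x => ?_⟩
  rw [hL.map_const_mul]
  nlinarith [h x]

theorem expect_bound (hL : IsJumpGenerator L) (hψ : IsControl L ψ) {f : S → ℝ} {C : ℝ} (hC : 0 < C)
    (hf : ∀ x, |f x| ≤ C * ψ x) :
    ∃ c, 0 ≤ c ∧ ∀ t, 0 ≤ t → ∀ x, expect L (fun y => ENNReal.ofReal |f y|) t x ≤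
      ENNReal.ofReal (Real.exp (c * t) * (C * ψ x)) := by
  obtain ⟨c, hc, h0, h⟩ := hψ.const_mul hL hC
  exact ⟨c, hc, fun t ht x => expect_le_of_growth hL h0 hc h
    (fun y => ENNReal.ofReal_le_ofReal (hf y)) ht x⟩

theorem summable_semigroup (hL : IsJumpGenerator L) (hψ : IsControl L ψ) {f : S → ℝ}
    (hf : Dominated ψ f) {t : ℝ} (ht : 0 ≤ t) (x : S) :
    Summable fun y => (transitionProb L t x y).toReal * f y := by
  obtain ⟨C, hC, h⟩ := hf
  obtain ⟨c, -, hb⟩ := expect_bound hL hψ hC h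
  have hne : expect L (fun y => ENNReal.ofReal |f y|) t x ≠ ⊤ :=
    ne_top_of_le_ne_top ENNReal.ofReal_ne_top (hb t ht x)
  have := ENNReal.summable_toReal hne
  refine Summable.of_norm_bounded this fun y => ?_
  simp

theorem abs_semigroup_le (hL : IsJumpGenerator L) (hψ : IsControl L ψ) {f : S → ℝ} {C : ℝ}
    (hC : 0 < C) (hf : ∀ x, |f x| ≤ C * ψ x) : ∃ c, 0 ≤ c ∧ ∀ t, 0 ≤ t → ∀ x,
      |semigroup L t f x| ≤ Real.exp (c * t) * (C * ψ x) := by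
  obtain ⟨c, hc, hb⟩ := expect_bound hL hψ hC hf
  refine ⟨c, hc, fun t ht x => ?_⟩
  have hne : expect L (fun y => ENNReal.ofReal |f y|) t x ≠ ⊤ :=
    ne_top_of_le_ne_top ENNReal.ofReal_ne_top (hb t ht x)
  have habs : Dominated ψ fun y => |f y| := ⟨C, hC, fun x => by simpa using hf x⟩
  calc |semigroup L t f x| ≤ semigroup L t (fun y => |f y|) x := by
        rw [semigroup, semigroup, ← Real.norm_eq_abs]
        have h2 : ∀ y, ‖(transitionProb L t x y).toReal * f y‖ =
          (transitionProb L t x y).toReal * |f y| := fun y => by simp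
        have h1 := summable_semigroup hL hψ habs ht x
        simp_rw [← h2] at h1 ⊢
        exact norm_tsum_le_tsum_norm h1
    _ = _ := semigroup_eq_toReal_expect (fun y => abs_nonneg _) hne
    _ ≤ _ := ENNReal.toReal_le_of_le_ofReal
        (mul_nonneg (Real.exp_nonneg _) (mul_nonneg hC.le (hψ.nonneg x))) (hb t ht x)

theorem semigroup_locallyDominated (hL : IsJumpGenerator L) (hψ : IsControl L ψ) {f : S → ℝ}
    (hf : Dominated ψ f) : LocallyDominated ψ fun t => semigroup L t f := by
  intro T
  obtain ⟨C, hC, h⟩ := hf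
  obtain ⟨c, hc, hb⟩ := abs_semigroup_le hL hψ hC h
  refine ⟨Real.exp (c * T) * C, by positivity, fun t ht x => (hb t ht.1 x).trans ?_⟩
  rw [mul_assoc]
  have := mul_nonneg hC.le (hψ.nonneg x)
  gcongr
  exact ht.2

theorem semigroup_zero (L : (S → ℝ) → S → ℝ) (f : S → ℝ) (x : S) : semigroup L 0 f x = f x := by
  rw [semigroup, tsum_eq_single x]
  · simp [transitionProb_zero]
  · intro y hy; simp [transitionProb_zero, hy.symm]

theorem backwardSolution_semigroup_of_nonneg (hL : IsJumpGenerator L) (hψ : IsControl L ψ)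
    {f : S → ℝ} (hf0 : ∀ x, 0 ≤ f x) (hf : Dominated ψ f) :
    BackwardSolution L fun t => semigroup L t f := by
  obtain ⟨C, hC, h⟩ := hf
  obtain ⟨c, hc, hb⟩ := expect_bound hL hψ hC h
  simp_rw [fun y => abs_of_nonneg (hf0 y)] at hb
  have hfin : ∀ t, 0 ≤ t → ∀ x, expect L (fun y => ENNReal.ofReal (f y)) t x ≠ ⊤ :=
    fun t ht x => ne_top_of_le_ne_top ENNReal.ofReal_ne_top (hb t ht x)
  set V : ℝ → S → ℝ := fun t x => (expect L (fun y => ENNReal.ofReal (f y)) t x).toReal with hV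
  have hVeq : ∀ t, 0 ≤ t → semigroup L t f = V t := fun t ht => by
    ext x; exact semigroup_eq_toReal_expect hf0 (hfin t ht x)
  have hVof : ∀ t, 0 ≤ t → ∀ x,
      expect L (fun y => ENNReal.ofReal (f y)) t x = ENNReal.ofReal (V t x) := fun t ht x =>
    (ENNReal.ofReal_toReal (hfin t ht x)).symm
  have hVint : ∀ x t, IntegrableOn (fun s => V s x) (Set.Icc 0 t) := by
    intro x t
    refine Measure.integrableOn_of_bounded (M := Real.exp (c * t) * (C * ψ x)) (by simp)
      ((measurable_expect L _ x).ennreal_toReal.aestronglyMeasurable) ?_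
    refine (ae_restrict_iff' measurableSet_Icc).2 (Eventually.of_forall fun s hs => ?_)
    have h1 := mul_nonneg hC.le (hψ.nonneg x)
    rw [Real.norm_of_nonneg ENNReal.toReal_nonneg]
    refine (ENNReal.toReal_le_of_le_ofReal (by positivity) (hb s hs.1 x)).trans ?_
    gcongr
    exact hs.2
  have key : ∀ x, ∃ g : ℝ → ℝ, (∀ t, IntegrableOn g (Set.Icc 0 t)) ∧
      (∀ t, 0 ≤ t → V t x = Real.exp (rateMatrix L x x * t) * (f x + ∫ s in (0 : ℝ)..t, g s)) ∧
      ∃ F : Finset S, (∀ t, g t = Real.exp (-(rateMatrix L x x * t)) *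
        ∑ z ∈ F, rateMatrix L x z * V t z) ∧
      ∀ φ : S → ℝ, L φ x = rateMatrix L x x * φ x + ∑ z ∈ F, rateMatrix L x z * φ z := by
    intro x
    obtain ⟨F, hx, hr0, hr1, hxx, hLf⟩ := hL.normal_form x
    have hnn : ∀ z ∈ F, 0 ≤ rateMatrix L x z := fun z hz => hr0 z fun h => hx (h ▸ hz)
    set g : ℝ → ℝ := fun t => Real.exp (-(rateMatrix L x x * t)) *
        ∑ z ∈ F, rateMatrix L x z * V t z with hg
    have hgint : ∀ t, IntegrableOn g (Set.Icc 0 t) := fun t => by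
      refine IntegrableOn.continuousOn_mul (by fun_prop) ?_ isCompact_Icc
      exact integrable_finsetSum _ fun z _ => (hVint z t).const_mul _
    have hg0 : ∀ s, 0 ≤ g s := fun s => mul_nonneg (Real.exp_nonneg _)
      (Finset.sum_nonneg fun z hz => mul_nonneg (hnn z hz) ENNReal.toReal_nonneg)
    refine ⟨g, hgint, fun t ht => ?_, F, fun t => rfl, hLf⟩
    have h1 : ∫⁻ s in Set.Icc 0 t, ENNReal.ofReal (Real.exp (-(rateMatrix L x x * s))) *
        ∑' z, jumpRate (rateMatrix L) x z * expect L (fun y => ENNReal.ofReal (f y)) s z =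
        ENNReal.ofReal (∫ s in (0 : ℝ)..t, g s) := by
      rw [intervalIntegral.integral_of_le ht, ← integral_Icc_eq_integral_Ioc,
        ofReal_integral_eq_lintegral_ofReal (hgint t) (Eventually.of_forall hg0)]
      refine setLIntegral_congr_fun measurableSet_Icc fun s hs => ?_
      rw [tsum_jumpRate_mul hx hr1, hg, ENNReal.ofReal_mul (Real.exp_nonneg _),
        ENNReal.ofReal_sum_of_nonneg fun z hz => mul_nonneg (hnn z hz) ENNReal.toReal_nonneg]
      congr 1
      refine Finset.sum_congr rfl fun z hz => ?_
      rw [ENNReal.ofReal_mul (hnn z hz), ← hVof s hs.1]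
    simp only [hV]
    rw [expect_eq, h1, ENNReal.toReal_mul, ENNReal.toReal_add (by simp) (by simp),
      ENNReal.toReal_ofReal (Real.exp_nonneg _), ENNReal.toReal_ofReal (hf0 x),
      ENNReal.toReal_ofReal (intervalIntegral.integral_nonneg ht fun s _ => hg0 s)]
  have hcont : ∀ x, ContinuousOn (fun t => V t x) (Set.Ici 0) := by
    intro x
    obtain ⟨g, hgint, hVg, -⟩ := key x
    intro t ht
    have h1 : ContinuousOn (fun t => Real.exp (rateMatrix L x x * t) *
        (f x + ∫ s in (0 : ℝ)..t, g s)) (Set.Icc 0 (t + 1)) := by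
      refine ContinuousOn.mul (by fun_prop) (continuousOn_const.add ?_)
      have ht1 : (0 : ℝ) ≤ t + 1 := by have : (0 : ℝ) ≤ t := ht; linarith
      have := intervalIntegral.continuousOn_primitive_interval (μ := volume) (f := g)
        (a := 0) (b := t + 1) (by rw [Set.uIcc_of_le ht1]; exact hgint _)
      rwa [Set.uIcc_of_le ht1] at this
    have h2 : ContinuousOn (fun t => V t x) (Set.Icc 0 (t + 1)) :=
      h1.congr fun s hs => hVg s hs.1
    refine (h2 t ⟨ht, by linarith⟩).mono_of_mem_nhdsWithin ?_
    have : Set.Icc 0 (t + 1) = Set.Ici 0 ∩ Set.Iic (t + 1) := rfl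
    rw [this]
    exact inter_mem_nhdsWithin _ (Iic_mem_nhds (by linarith))
  refine ⟨fun x => (hcont x).congr fun t ht => by simp [hVeq t ht], fun x t ht => ?_⟩
  obtain ⟨g, hgint, hVg, F, hgF, hLf⟩ := key x
  have hgcont : ContinuousOn g (Set.Ici 0) := by
    have : g = fun t => Real.exp (-(rateMatrix L x x * t)) *
        ∑ z ∈ F, rateMatrix L x z * V t z := funext hgF
    rw [this]
    exact ContinuousOn.mul (by fun_prop)
      (continuousOn_finsetSum _ fun z _ => (hcont z).const_mul _)
  have hgat : ContinuousAt g t := hgcont.continuousAt (Ici_mem_nhds ht)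
  have hprim : HasDerivAt (fun t => ∫ s in (0 : ℝ)..t, g s) (g t) t := by
    refine intervalIntegral.integral_hasDerivAt_right ?_ ?_ hgat
    · rw [intervalIntegrable_iff_integrableOn_Icc_of_le ht.le]; exact hgint t
    · exact (hgcont.mono Set.Ioi_subset_Ici_self).stronglyMeasurableAtFilter isOpen_Ioi t ht
  have hexp : HasDerivAt (fun t : ℝ => Real.exp (rateMatrix L x x * t))
      (Real.exp (rateMatrix L x x * t) * rateMatrix L x x) t := by
    have h1 : HasDerivAt (fun s : ℝ => rateMatrix L x x * s) (rateMatrix L x x) t := by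
      simpa using (hasDerivAt_id t).const_mul (rateMatrix L x x)
    exact h1.exp
  have hmain := hexp.mul (hprim.const_add (f x))
  have hev : (fun t => semigroup L t f x) =ᶠ[𝓝 t] fun t =>
      Real.exp (rateMatrix L x x * t) * (f x + ∫ s in (0 : ℝ)..t, g s) := by
    filter_upwards [Ici_mem_nhds ht] with s hs
    rw [hVeq s hs, hVg s hs]
  refine (hmain.congr_of_eventuallyEq hev).congr_deriv ?_
  rw [hVeq t ht.le, hLf, hVg t ht.le, hgF]
  have : Real.exp (rateMatrix L x x * t) * Real.exp (-(rateMatrix L x x * t)) = 1 := by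
    rw [← Real.exp_add]; simp
  linear_combination (∑ z ∈ F, rateMatrix L x z * V t z) * this

theorem Dominated.posPart {f : S → ℝ} (hf : Dominated ψ f) :
    Dominated ψ (fun x => max (f x) 0) ∧ Dominated ψ (fun x => max (-f x) 0) := by
  obtain ⟨C, hC, h⟩ := hf
  refine ⟨⟨C, hC, fun x => le_trans ?_ (h x)⟩, ⟨C, hC, fun x => le_trans ?_ (h x)⟩⟩ <;>
    rw [abs_of_nonneg (le_max_right _ _)]
  · exact max_le (le_abs_self _) (abs_nonneg _)
  · exact max_le (neg_le_abs _) (abs_nonneg _)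

/-- The semigroup solves the backward equation. -/
theorem backwardSolution_semigroup (hL : IsJumpGenerator L) (hψ : IsControl L ψ)
    {f : S → ℝ} (hf : Dominated ψ f) : BackwardSolution L fun t => semigroup L t f := by
  have h1 := backwardSolution_semigroup_of_nonneg hL hψ (fun x => le_max_right _ _) hf.posPart.1
  have h2 := backwardSolution_semigroup_of_nonneg hL hψ (fun x => le_max_right _ _) hf.posPart.2
  have h3 := h1.sub hL h2
  have heq : ∀ t, 0 ≤ t → semigroup L t f = fun x => semigroup L t (fun x => max (f x) 0) x -
      semigroup L t (fun x => max (-f x) 0) x := by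
    intro t ht
    ext x
    rw [semigroup, semigroup, semigroup, ← Summable.tsum_sub
      (summable_semigroup hL hψ hf.posPart.1 ht x) (summable_semigroup hL hψ hf.posPart.2 ht x)]
    refine tsum_congr fun y => ?_
    rw [← mul_sub]
    congr 1
    rcases le_total (f y) 0 with h | h <;> simp [h]
  refine ⟨fun x => (h3.cont x).congr fun t ht => by rw [heq t ht], fun x t ht => ?_⟩
  rw [heq t ht.le]
  refine (h3.deriv x t ht).congr_of_eventuallyEq ?_
  filter_upwards [Ici_mem_nhds ht] with s hs
  rw [heq s hs]

theorem semigroup_unique (hL : IsJumpGenerator L) (hψ : IsControl L ψ) {v : ℝ → S → ℝ}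
    (hv : BackwardSolution L v) (hdv : LocallyDominated ψ v) {t : ℝ} (ht : 0 ≤ t) (x : S) :
    semigroup L t (v 0) x = v t x := by
  have h0 : Dominated ψ (v 0) := by
    obtain ⟨C, hC, h⟩ := hdv 0
    exact ⟨C, hC, h 0 (by simp)⟩
  exact (backwardSolution_semigroup hL hψ h0).unique hL hψ hv
    (semigroup_locallyDominated hL hψ h0) hdv (fun x => semigroup_zero L _ x) ht x

theorem semigroup_of_harmonic (hL : IsJumpGenerator L) (hψ : IsControl L ψ) {f : S → ℝ}
    (hf : Dominated ψ f) (hLf : ∀ x, L f x = 0) {t : ℝ} (ht : 0 ≤ t) (x : S) :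
    semigroup L t f x = f x :=
  semigroup_unique hL hψ (v := fun _ => f) (BackwardSolution.const hLf) (fun _ => by
    obtain ⟨C, hC, h⟩ := hf
    exact ⟨C, hC, fun _ _ => h⟩) ht x

/-- The generator commutes with the semigroup. -/
theorem generator_semigroup (hL : IsJumpGenerator L) (hψ : IsControl L ψ) {f : S → ℝ}
    (hf : Dominated ψ f) (hdom : LocallyDominated ψ fun t => L (semigroup L t f))
    {t : ℝ} (ht : 0 ≤ t) (x : S) : semigroup L t (L f) x = L (semigroup L t f) x := by
  have h := semigroup_unique hL hψ ((backwardSolution_semigroup hL hψ hf).map hL) hdom ht x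
  have h0 : semigroup L 0 f = f := funext fun x => semigroup_zero L f x
  rwa [h0] at h

theorem semigroup_add (hL : IsJumpGenerator L) (hψ : IsControl L ψ) {f : S → ℝ}
    (hf : Dominated ψ f) {s t : ℝ} (hs : 0 ≤ s) (ht : 0 ≤ t) (x : S) :
    semigroup L (t + s) f x = semigroup L t (semigroup L s f) x := by
  have h := semigroup_unique hL hψ ((backwardSolution_semigroup hL hψ hf).shift hs)
    (fun T => ?_) ht x
  · rw [zero_add] at h; exact h.symm
  · obtain ⟨C, hC, h⟩ := semigroup_locallyDominated hL hψ hf (T + s)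
    exact ⟨C, hC, fun t ht x => h (t + s) ⟨by linarith [ht.1], by linarith [ht.2]⟩ x⟩

end Semigroup


/-! ## Stationary laws of kernels -/

section Kernels

variable {S : Type*}

theorem eq_of_le_of_tsum_eq {f g : S → ℝ≥0∞} (hle : ∀ x, f x ≤ g x) (hg : ∑' x, g x ≠ ⊤)
    (h : ∑' x, f x = ∑' x, g x) : f = g := by
  have h1 : ∑' x, (g x - f x) = 0 := by
    have h2 : ∑' x, g x = ∑' x, f x + ∑' x, (g x - f x) := by
      rw [← ENNReal.tsum_add]
      exact tsum_congr fun x => (add_tsub_cancel_of_le (hle x)).symm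
    rw [h] at h2
    exact (ENNReal.add_right_inj hg).1 (by rw [add_zero]; exact h2.symm)
  ext x
  exact le_antisymm (hle x) (tsub_eq_zero_iff_le.1 (ENNReal.tsum_eq_zero.1 h1 x))

theorem tsum_kernel {K : S → S → ℝ≥0∞} (hK : ∀ x, ∑' y, K x y = 1) (m : S → ℝ≥0∞) :
    ∑' y, ∑' x, m x * K x y = ∑' x, m x := by
  rw [ENNReal.tsum_comm]
  simp_rw [ENNReal.tsum_mul_left, hK, mul_one]

theorem invariant_sub {K : S → S → ℝ≥0∞} (hK : ∀ x, ∑' y, K x y = 1) {m₁ m₂ : S → ℝ≥0∞}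
    (h₁ : ∑' x, m₁ x = 1) (hm₁ : ∀ y, ∑' x, m₁ x * K x y = m₁ y)
    (hm₂ : ∀ y, ∑' x, m₂ x * K x y = m₂ y) :
    ∀ y, ∑' x, (m₁ x - m₂ x) * K x y = m₁ y - m₂ y := by
  have hle : ∀ y, m₁ y - m₂ y ≤ ∑' x, (m₁ x - m₂ x) * K x y := by
    intro y
    rw [tsub_le_iff_left, ← hm₁ y]
    nth_rewrite 1 [← hm₂ y]
    rw [← ENNReal.tsum_add]
    refine ENNReal.tsum_le_tsum fun x => ?_
    rw [← add_mul]
    gcongr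
    exact le_add_tsub
  have hfin : ∑' x, (m₁ x - m₂ x) ≠ ⊤ :=
    ne_top_of_le_ne_top (h₁ ▸ ENNReal.one_ne_top) (ENNReal.tsum_le_tsum fun x => tsub_le_self)
  have := eq_of_le_of_tsum_eq hle (by rwa [tsum_kernel hK]) (tsum_kernel hK _).symm
  exact fun y => (congrFun this y).symm

/-- A kernel with a state that is reached from everywhere has at most one invariant law. -/
theorem invariant_unique {K : S → S → ℝ≥0∞} (hK : ∀ x, ∑' y, K x y = 1) {o : S}
    (ho : ∀ x, 0 < K x o) {m₁ m₂ : S → ℝ≥0∞}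
    (h₁ : ∑' x, m₁ x = 1) (h₂ : ∑' x, m₂ x = 1)
    (hm₁ : ∀ y, ∑' x, m₁ x * K x y = m₁ y) (hm₂ : ∀ y, ∑' x, m₂ x * K x y = m₂ y) : m₁ = m₂ := by
  have key : ∀ {a b : S → ℝ≥0∞}, (∀ y, ∑' x, (a x - b x) * K x y = a y - b y) →
      a o ≤ b o → ∀ x, a x ≤ b x := by
    intro a b h ho' x
    have h0 := h o
    rw [tsub_eq_zero_of_le ho', ENNReal.tsum_eq_zero] at h0
    have := h0 x
    rw [mul_eq_zero, or_iff_left (ho x).ne'] at this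
    exact tsub_eq_zero_iff_le.1 this
  rcases le_total (m₁ o) (m₂ o) with h | h
  · exact eq_of_le_of_tsum_eq (key (invariant_sub hK h₁ hm₁ hm₂) h) (by simp [h₂]) (by rw [h₁, h₂])
  · exact (eq_of_le_of_tsum_eq (key (invariant_sub hK h₂ hm₂ hm₁) h) (by simp [h₁])
      (by rw [h₁, h₂])).symm

/-- Existence of invariant laws for tight chains (Krylov-Bogoliubov). -/
theorem exists_invariant {K : S → S → ℝ≥0∞} (hK : ∀ x, ∑' y, K x y = 1) {P : ℕ → S → ℝ≥0∞}
    (hP : ∀ k, ∑' x, P k x = 1) (hPK : ∀ k y, ∑' x, P k x * K x y = P (k + 1) y)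
    {h : S → ℝ} (hfin : ∀ M : ℝ, {x | h x ≤ M}.Finite) {B : ℝ}
    (hB : ∀ k, ∑' x, P k x * ENNReal.ofReal (h x) ≤ ENNReal.ofReal B) :
    ∃ m : S → ℝ≥0∞, ∑' x, m x = 1 ∧ (∀ y, ∑' x, m x * K x y = m y) ∧
      ∀ (g : S → ℝ) (C : ℝ≥0∞), (∀ k, ∑' x, P k x * ENNReal.ofReal (g x) ≤ C) →
        ∑' x, m x * ENNReal.ofReal (g x) ≤ C := by
  classical
  have hPle : ∀ k x, P k x ≤ 1 := fun k x => hP k ▸ ENNReal.le_tsum x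
  set a : ℕ → S → ℝ≥0∞ := fun n x => ((n : ℝ≥0∞) + 1)⁻¹ * ∑ k ∈ Finset.range (n + 1), P k x
  have hn0 : ∀ n : ℕ, (n : ℝ≥0∞) + 1 ≠ 0 := fun n => by simp
  have hnt : ∀ n : ℕ, (n : ℝ≥0∞) + 1 ≠ ⊤ := fun n => by simp
  have haverage : ∀ (n : ℕ) (g : S → ℝ≥0∞), ∑' x, a n x * g x =
      ((n : ℝ≥0∞) + 1)⁻¹ * ∑ k ∈ Finset.range (n + 1), ∑' x, P k x * g x := by
    intro n g
    simp only [a, mul_assoc, Finset.sum_mul]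
    rw [ENNReal.tsum_mul_left, Summable.tsum_finsetSum fun _ _ => ENNReal.summable]
  have hale : ∀ (n : ℕ) (g : S → ℝ≥0∞) (C : ℝ≥0∞), (∀ k, ∑' x, P k x * g x ≤ C) →
      ∑' x, a n x * g x ≤ C := by
    intro n g C hC
    rw [haverage]
    calc _ ≤ ((n : ℝ≥0∞) + 1)⁻¹ * ∑ k ∈ Finset.range (n + 1), C := by gcongr with k; exact hC k
      _ = C := by
        rw [Finset.sum_const, Finset.card_range, nsmul_eq_mul]
        push_cast
        rw [← mul_assoc, ENNReal.inv_mul_cancel (hn0 n) (hnt n), one_mul]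
  have ha1 : ∀ n, ∑' x, a n x = 1 := by
    intro n
    have := haverage n fun _ => 1
    simp only [mul_one, hP] at this
    rw [this, Finset.sum_const, Finset.card_range, nsmul_eq_mul, mul_one]
    push_cast
    exact ENNReal.inv_mul_cancel (hn0 n) (hnt n)
  have haK : ∀ n y, ∑' x, a n x * K x y ≤ a n y + ((n : ℝ≥0∞) + 1)⁻¹ := by
    intro n y
    rw [haverage]
    simp_rw [hPK, a]
    rw [← mul_add_one]
    gcongr
    calc ∑ k ∈ Finset.range (n + 1), P (k + 1) y ≤ ∑ k ∈ Finset.range (n + 2), P k y := by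
          rw [Finset.sum_range_succ' _ (n + 1)]; exact le_self_add
      _ ≤ _ := by rw [Finset.sum_range_succ]; gcongr; exact hPle _ _
  obtain ⟨m, hm⟩ : ∃ m : S → ℝ≥0∞, Tendsto a (hyperfilter ℕ) (𝓝 m) :=
    ⟨_, ((hyperfilter ℕ).map a).le_nhds_lim⟩
  have hmx : ∀ x, Tendsto (fun n => a n x) (hyperfilter ℕ) (𝓝 (m x)) := tendsto_pi_nhds.1 hm
  have hlim0 : Tendsto (fun n : ℕ => ((n : ℝ≥0∞) + 1)⁻¹) (hyperfilter ℕ) (𝓝 0) := by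
    have := (ENNReal.tendsto_inv_nat_nhds_zero.comp (tendsto_add_atTop_nat 1))
    refine (this.mono_left (Nat.hyperfilter_le_atTop)).congr fun n => ?_
    simp
  have hmg : ∀ (g : S → ℝ≥0∞) (C : ℝ≥0∞), (∀ x, g x ≠ ⊤) → (∀ k, ∑' x, P k x * g x ≤ C) →
      ∑' x, m x * g x ≤ C := by
    intro g C hg hC
    rw [ENNReal.tsum_eq_iSup_sum]
    refine iSup_le fun F => ?_
    refine le_of_tendsto (tendsto_finsetSum F fun x _ =>
      ENNReal.Tendsto.mul_const (hmx x) (Or.inr (hg x))) (Eventually.of_forall fun n => ?_)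
    exact (ENNReal.sum_le_tsum F).trans (hale n g C hC)
  have hm1 : ∑' x, m x ≤ 1 := by
    have := hmg (fun _ => 1) 1 (by simp) (by simp [hP])
    simpa using this
  have hm1' : ∑' x, m x = 1 := by
    refine le_antisymm hm1 ?_
    have hM : ∀ M : ℕ, 1 ≤ ∑' x, m x + ENNReal.ofReal B * ((M : ℝ≥0∞) + 1)⁻¹ := by
      intro M
      set F := (hfin (M + 1)).toFinset
      have h1 : Tendsto (fun n => ∑ x ∈ F, a n x + ENNReal.ofReal B * ((M : ℝ≥0∞) + 1)⁻¹)
          (hyperfilter ℕ) (𝓝 (∑ x ∈ F, m x + ENNReal.ofReal B * ((M : ℝ≥0∞) + 1)⁻¹)) :=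
        (tendsto_finsetSum F fun x _ => hmx x).add_const _
      refine (ge_of_tendsto h1 (Eventually.of_forall fun n => ?_)).trans ?_
      · refine (ha1 n).symm.le.trans ?_
        have h2 : ∀ x, a n x ≤ (if x ∈ F then a n x else 0) +
            a n x * ENNReal.ofReal (h x) * ((M : ℝ≥0∞) + 1)⁻¹ := by
          intro x
          split_ifs with hx
          · exact le_self_add
          · rw [zero_add, mul_assoc]
            have h3 : (M : ℝ≥0∞) + 1 ≤ ENNReal.ofReal (h x) := by
              simp only [F, Set.Finite.mem_toFinset, Set.mem_ofPred_eq, not_le] at hx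
              have : (M : ℝ≥0∞) + 1 = ENNReal.ofReal (M + 1) := by
                rw [ENNReal.ofReal_add (by positivity) zero_le_one]; simp
              rw [this]
              exact ENNReal.ofReal_le_ofReal hx.le
            calc a n x = a n x * (((M : ℝ≥0∞) + 1) * ((M : ℝ≥0∞) + 1)⁻¹) := by
                  rw [ENNReal.mul_inv_cancel (hn0 M) (hnt M), mul_one]
              _ ≤ _ := by gcongr
        refine (ENNReal.tsum_le_tsum h2).trans ?_
        rw [ENNReal.tsum_add, ENNReal.tsum_mul_right]
        gcongr
        · rw [tsum_eq_sum (s := F) fun x hx => by simp [hx]]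
          exact (Finset.sum_congr rfl fun x hx => by simp [hx]).le
        · exact hale n _ _ hB
      · gcongr
        exact ENNReal.sum_le_tsum F
    have h2 : Tendsto (fun M : ℕ => ∑' x, m x + ENNReal.ofReal B * ((M : ℝ≥0∞) + 1)⁻¹)
        (hyperfilter ℕ) (𝓝 (∑' x, m x + ENNReal.ofReal B * 0)) :=
      (ENNReal.Tendsto.const_mul hlim0 (Or.inr ENNReal.ofReal_ne_top)).const_add _
    rw [mul_zero, add_zero] at h2
    exact ge_of_tendsto h2 (Eventually.of_forall hM)
  refine ⟨m, hm1', ?_, fun g C hC => hmg _ C (by simp) hC⟩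
  have hKle : ∀ x y, K x y ≠ ⊤ := fun x y =>
    ne_top_of_le_ne_top ENNReal.one_ne_top (hK x ▸ ENNReal.le_tsum y)
  have hle : ∀ y, ∑' x, m x * K x y ≤ m y := by
    intro y
    rw [ENNReal.tsum_eq_iSup_sum]
    refine iSup_le fun F => ?_
    have h1 : Tendsto (fun n => a n y + ((n : ℝ≥0∞) + 1)⁻¹) (hyperfilter ℕ) (𝓝 (m y + 0)) :=
      (hmx y).add hlim0
    rw [add_zero] at h1
    refine le_of_tendsto_of_tendsto' (tendsto_finsetSum F fun x _ =>
      ENNReal.Tendsto.mul_const (hmx x) (Or.inr (hKle x y))) h1 fun n => ?_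
    exact (ENNReal.sum_le_tsum F).trans (haK n y)
  exact congrFun (eq_of_le_of_tsum_eq hle (by simp [hm1']) (tsum_kernel hK m))

end Kernels

/-! ## The Markov property -/

section Markov

variable {S : Type*} [DecidableEq S] [Countable S] {L : (S → ℝ) → S → ℝ} {ψ : S → ℝ}

theorem dominated_one_of_abs_le {f : S → ℝ} {C : ℝ} (h : ∀ x, |f x| ≤ C) :
    Dominated (fun _ => 1) f :=
  ⟨max C 1, by positivity, fun x => by rw [mul_one]; exact (h x).trans (le_max_left _ _)⟩

theorem semigroup_single (t : ℝ) (x y : S) :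
    semigroup L t (Pi.single y 1) x = (transitionProb L t x y).toReal := by
  rw [semigroup, tsum_eq_single y]
  · simp
  · intro z hz; simp [hz]

variable (hL : IsJumpGenerator L) (hone : IsControl L fun _ => 1)
include hL hone

theorem tsum_transitionProb {t : ℝ} (ht : 0 ≤ t) (x : S) : ∑' y, transitionProb L t x y = 1 := by
  have h1 : Dominated (fun _ => 1) fun _ : S => (1 : ℝ) := ⟨1, one_pos, by simp⟩
  have h2 := semigroup_of_harmonic hL hone h1 (fun x => hL.map_const 1 x) ht x
  have h3 := semigroup_eq_toReal_expect (L := L) (f := fun _ => 1) (t := t) (x := x) (by simp) ?_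
  · rw [h2, expect] at h3
    simp only [ENNReal.ofReal_one, mul_one] at h3
    exact ((ENNReal.toReal_eq_one_iff _).1 h3.symm)
  · obtain ⟨c, -, hb⟩ := expect_bound hL hone one_pos (f := fun _ => 1) (by simp)
    exact ne_top_of_le_ne_top ENNReal.ofReal_ne_top (by simpa using hb t ht x)

theorem transitionProb_le_one {t : ℝ} (ht : 0 ≤ t) (x y : S) : transitionProb L t x y ≤ 1 :=
  tsum_transitionProb hL hone ht x ▸ ENNReal.le_tsum y

theorem transitionProb_ne_top {t : ℝ} (ht : 0 ≤ t) (x y : S) : transitionProb L t x y ≠ ⊤ :=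
  ne_top_of_le_ne_top ENNReal.one_ne_top (transitionProb_le_one hL hone ht x y)

/-- The Chapman-Kolmogorov equations. -/
theorem transitionProb_add {s t : ℝ} (hs : 0 ≤ s) (ht : 0 ≤ t) (x y : S) :
    transitionProb L (t + s) x y = ∑' z, transitionProb L t x z * transitionProb L s z y := by
  have hd : Dominated (fun _ => 1) (Pi.single y 1 : S → ℝ) :=
    dominated_one_of_abs_le (C := 1) fun x => by
      rw [Pi.single_apply]; split_ifs <;> simp
  have h := semigroup_add hL hone hd hs ht x
  rw [semigroup_single] at h
  have h2 : semigroup L s (Pi.single y 1) = fun z => (transitionProb L s z y).toReal :=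
    funext fun z => semigroup_single s z y
  rw [h2, semigroup] at h
  simp_rw [← ENNReal.toReal_mul] at h
  have hne : ∀ z, transitionProb L t x z * transitionProb L s z y ≠ ⊤ := fun z =>
    ENNReal.mul_ne_top (transitionProb_ne_top hL hone ht x z) (transitionProb_ne_top hL hone hs z y)
  rw [← ENNReal.tsum_toReal_eq hne] at h
  refine (ENNReal.toReal_eq_toReal_iff' (transitionProb_ne_top hL hone (by positivity) x y) ?_).1 h
  refine ne_top_of_le_ne_top ENNReal.one_ne_top ?_
  calc _ ≤ ∑' z, transitionProb L t x z * 1 := by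
        gcongr with z; exact transitionProb_le_one hL hone hs z y
    _ = 1 := by simp [tsum_transitionProb hL hone ht x]

theorem lawAt_lawAt (μ : S → ℝ≥0∞) {s t : ℝ} (hs : 0 ≤ s) (ht : 0 ≤ t) (y : S) :
    lawAt L (lawAt L μ t) s y = lawAt L μ (t + s) y := by
  simp_rw [lawAt, transitionProb_add hL hone hs ht, ← ENNReal.tsum_mul_right,
    ← ENNReal.tsum_mul_left]
  rw [ENNReal.tsum_comm]
  simp_rw [mul_assoc]

theorem tsum_lawAt (μ : S → ℝ≥0∞) {t : ℝ} (ht : 0 ≤ t) : ∑' y, lawAt L μ t y = ∑' x, μ x :=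
  tsum_kernel (fun x => tsum_transitionProb hL hone ht x) μ

/-- Expectations at time `t`, for an initial law which integrates the dominating function. -/
theorem hasExpectation_lawAt (hψ : IsControl L ψ) {f : S → ℝ} (hf : Dominated ψ f)
    {μ : S → ℝ≥0∞} (hμ : ∑' x, μ x ≠ ⊤) (hμψ : Summable fun x => (μ x).toReal * ψ x)
    {t : ℝ} (ht : 0 ≤ t) :
    HasExpectation (lawAt L μ t) f (∑' x, (μ x).toReal * semigroup L t f x) := by
  set F : S × S → ℝ := fun p => (μ p.1).toReal * ((transitionProb L t p.1 p.2).toReal * f p.2)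
  have hfabs : Dominated ψ fun x => |f x| := by
    obtain ⟨C, hC, h⟩ := hf; exact ⟨C, hC, by simpa using h⟩
  have hF : Summable F := by
    rw [← summable_norm_iff]
    rw [summable_prod_of_nonneg fun p => norm_nonneg _]
    have hn : ∀ x y, ‖F (x, y)‖ = (μ x).toReal * ((transitionProb L t x y).toReal * |f y|) := by
      intro x y; simp [F]
    simp_rw [hn]
    refine ⟨fun x => (summable_semigroup hL hψ hfabs ht x).mul_left _, ?_⟩
    simp_rw [tsum_mul_left]
    obtain ⟨C, hC, h⟩ := hfabs
    obtain ⟨c, hc, hb⟩ := abs_semigroup_le hL hψ hC h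
    refine Summable.of_norm_bounded (hμψ.mul_left (Real.exp (c * t) * C)) fun x => ?_
    rw [norm_mul, Real.norm_eq_abs, Real.norm_eq_abs, ENNReal.abs_toReal]
    have := hb t ht x
    calc _ ≤ (μ x).toReal * (Real.exp (c * t) * (C * ψ x)) := by gcongr; exact this
      _ = _ := by ring
  have hsum : ∑' p, F p = ∑' x, (μ x).toReal * semigroup L t f x := by
    rw [hF.tsum_prod]
    simp_rw [F, tsum_mul_left]
    rfl
  have h1 := hF.hasSum
  rw [hsum] at h1
  have h2 := ((Equiv.prodComm S S).hasSum_iff.2 h1)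
  refine h2.prod_fiberwise fun y => ?_
  have hmt : ∀ x, μ x ≠ ⊤ := fun x => ENNReal.ne_top_of_tsum_ne_top hμ x
  have hne : ∀ x, μ x * transitionProb L t x y ≠ ⊤ := fun x =>
    ENNReal.mul_ne_top (hmt x) (transitionProb_ne_top hL hone ht x y)
  have hlaw : lawAt L μ t y ≠ ⊤ :=
    ENNReal.ne_top_of_tsum_ne_top ((tsum_lawAt hL hone μ ht).symm ▸ hμ) y
  have h3 : HasSum (fun x => (μ x * transitionProb L t x y).toReal) (lawAt L μ t y).toReal := by
    rw [lawAt, ENNReal.tsum_toReal_eq hne]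
    exact (ENNReal.summable_toReal hlaw).hasSum
  refine (h3.mul_right (f y)).congr_fun fun x => ?_
  simp [F, mul_assoc]

/-- Existence and uniqueness of the stationary law. -/
theorem exists_unique_stationary {o : S} (ho : ∀ x, 0 < transitionProb L 1 x o) (x₀ : S)
    {h : S → ℝ} (hfin : ∀ M : ℝ, {x | h x ≤ M}.Finite) {B : ℝ}
    (hB : ∀ k : ℕ, expect L (fun x => ENNReal.ofReal (h x)) k x₀ ≤ ENNReal.ofReal B) :
    ∃ μ : PMF S, IsStationary L μ ∧ (∀ μ' : PMF S, IsStationary L μ' → μ' = μ) ∧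
      ∀ (g : S → ℝ) (C : ℝ≥0∞), (∀ k : ℕ, expect L (fun x => ENNReal.ofReal (g x)) k x₀ ≤ C) →
        ∑' x, μ x * ENNReal.ofReal (g x) ≤ C := by
  have hK := fun x => tsum_transitionProb hL hone zero_le_one x
  obtain ⟨m, hm1, hmK, hmg⟩ := exists_invariant hK (P := fun k x => transitionProb L k x₀ x)
    (fun k => tsum_transitionProb hL hone (Nat.cast_nonneg k) x₀)
    (fun k y => by
      rw [Nat.cast_succ, transitionProb_add hL hone zero_le_one (Nat.cast_nonneg k)]) hfin hB
  have huniq : ∀ m' : S → ℝ≥0∞, ∑' x, m' x = 1 → (∀ y, lawAt L m' 1 y = m' y) → m' = m :=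
    fun m' h1 h2 => invariant_unique hK ho h1 hm1 h2 hmK
  refine ⟨⟨m, hm1 ▸ ENNReal.summable.hasSum⟩, fun t ht y => ?_, fun μ' hμ' => ?_, hmg⟩
  · refine congrFun (huniq (lawAt L m t) (by rw [tsum_lawAt hL hone m ht, hm1]) fun y => ?_) y
    rw [lawAt_lawAt hL hone m zero_le_one ht, add_comm, ← lawAt_lawAt hL hone m ht zero_le_one]
    congr 1
    exact funext hmK
  · ext x
    exact congrFun (huniq μ' μ'.tsum_coe (hμ' 1 zero_le_one)) x

end Markov


/-! ## Elementary properties of the particle systems -/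

section Particles

variable {N : ℕ} {G : Geometry N} {σ : SignType}

theorem site_rate_nonneg (η : Config G σ) (y : Fin N) : 0 ≤ (G.α y : ℝ) + (σ : ℝ) * η.1 y := by
  have h := η.2
  rcases σ with _ | _ | _
  · simp only [SignType.zero_eq_zero, SignType.coe_zero]; positivity
  · have h1 : (η.1 y : ℝ) ≤ G.α y := by exact_mod_cast h rfl y
    simp only [SignType.neg_eq_neg_one, SignType.coe_neg_one]; linarith
  · simp only [SignType.pos_eq_one, SignType.coe_one]; positivity

theorem lt_of_site_rate_ne_zero (hσ : σ = -1) (η : Config G σ) {y : Fin N}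
    (h : (G.α y : ℝ) + (σ : ℝ) * η.1 y ≠ 0) : η.1 y < G.α y := by
  refine lt_of_le_of_ne (η.2 hσ y) fun h' => h ?_
  subst hσ
  simp [h']

theorem Config.remove_coe (η : Config G σ) (x : Fin N) : (η.remove x).1 = η.1 - Pi.single x 1 := by
  rw [Config.remove, Config.replace, dif_pos]
  intro hσ z
  exact (Nat.sub_le _ _).trans (η.2 hσ z)

theorem Config.add_coe (η : Config G σ) {x : Fin N} (h : (G.α x : ℝ) + (σ : ℝ) * η.1 x ≠ 0) :
    (η.add x).1 = η.1 + Pi.single x 1 := by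
  rw [Config.add, Config.replace, dif_pos]
  intro hσ z
  have h1 := lt_of_site_rate_ne_zero hσ η h
  have h2 := η.2 hσ z
  rw [Pi.add_apply, Pi.single_apply]
  split_ifs with hz
  · subst hz; omega
  · omega

theorem Config.hop_coe (η : Config G σ) {x y : Fin N}
    (h : (η.1 x : ℝ) * ((G.α y : ℝ) + (σ : ℝ) * η.1 y) ≠ 0) :
    (η.hop x y).1 = η.1 - Pi.single x 1 + Pi.single y 1 := by
  rw [Config.hop, Config.replace, dif_pos]
  intro hσ z
  have h1 := lt_of_site_rate_ne_zero hσ η (right_ne_zero_of_mul h)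
  have h2 := η.2 hσ z
  simp only [Pi.add_apply, Pi.sub_apply, Pi.single_apply]
  split_ifs <;> subst_vars <;> omega

theorem bulkGenerator_eq_sum (f : Config G σ → ℝ) (η : Config G σ) :
    bulkGenerator f η = ∑ x, ∑ y, G.ω x y * (((η.1 x : ℝ) * ((G.α y : ℝ) + (σ : ℝ) * η.1 y)) *
      (f (η.hop x y) - f η)) := by
  have h := Finset.sum_sum_Ioi_add_eq_sum_sum_off_diag fun y x =>
    G.ω x y * (((η.1 x : ℝ) * ((G.α y : ℝ) + (σ : ℝ) * η.1 y)) * (f (η.hop x y) - f η))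
  rw [bulkGenerator]
  calc _ = _ := by
        refine Finset.sum_congr rfl fun x _ => Finset.sum_congr rfl fun y _ => ?_
        rw [bondGenerator, mul_add]
        nth_rewrite 2 [G.ω_symm x y]
        rfl
    _ = _ := h
    _ = _ := by
        refine Finset.sum_congr rfl fun x _ => ?_
        rw [← Finset.sum_add_sum_compl {x}]
        simp [G.ω_diag]

theorem isJumpAt_bulkGenerator (η : Config G σ) :
    IsJumpAt η fun f => bulkGenerator f η := by
  simp_rw [bulkGenerator_eq_sum]
  exact IsJumpAt.sum _ fun x _ => IsJumpAt.sum _ fun y _ =>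
    (IsJumpAt.single _ _ (mul_nonneg (Nat.cast_nonneg _) (site_rate_nonneg η y))).const_mul
      (G.ω_nonneg x y)

theorem scaleRange_nonneg {θ : ℝ} (h : θ ∈ scaleRange σ) : 0 ≤ θ := by
  rw [scaleRange] at h
  split_ifs at h
  · exact h.1
  · exact h

theorem one_add_mul_nonneg {θ : ℝ} (h : θ ∈ scaleRange σ) : 0 ≤ 1 + (σ : ℝ) * θ := by
  have h0 := scaleRange_nonneg h
  rcases σ with _ | _ | _
  · simp
  · have h1 : θ ≤ 1 := by
      rw [scaleRange, if_pos (by rfl)] at h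
      exact h.2
    simp only [SignType.neg_eq_neg_one, SignType.coe_neg_one]; linarith
  · simp only [SignType.pos_eq_one, SignType.coe_one]; linarith

theorem remove_rate_nonneg {a θ : ℝ} (ha : 0 < a) (h : θ ∈ scaleRange σ) (η : Config G σ)
    (x : Fin N) : 0 ≤ (η.1 x : ℝ) * (a + (σ : ℝ) * a * θ) := by
  have : a + (σ : ℝ) * a * θ = a * (1 + (σ : ℝ) * θ) := by ring
  rw [this]
  exact mul_nonneg (Nat.cast_nonneg _) (mul_nonneg ha.le (one_add_mul_nonneg h))

theorem add_rate_nonneg {a θ : ℝ} (ha : 0 < a) (h : θ ∈ scaleRange σ) (η : Config G σ)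
    (x : Fin N) : 0 ≤ a * θ * ((G.α x : ℝ) + (σ : ℝ) * η.1 x) :=
  mul_nonneg (mul_nonneg ha.le (scaleRange_nonneg h)) (site_rate_nonneg η x)

theorem isJumpAt_reservoirGenerator {a θ : ℝ} (ha : 0 < a) (h : θ ∈ scaleRange σ) (x : Fin N)
    (η : Config G σ) : IsJumpAt η fun f => reservoirGenerator x a θ f η :=
  (IsJumpAt.single _ _ (remove_rate_nonneg ha h η x)).add
    (IsJumpAt.single _ _ (add_rate_nonneg ha h η x))

theorem isJumpGenerator_generator {θL θR : ℝ} (hL : θL ∈ scaleRange σ) (hR : θR ∈ scaleRange σ) :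
    IsJumpGenerator (generator G σ θL θR) := fun η =>
  (isJumpAt_bulkGenerator η).add
    (((isJumpAt_reservoirGenerator G.αL_pos hL G.first η).const_mul G.ωL_nonneg).add
      ((isJumpAt_reservoirGenerator G.αR_pos hR G.last η).const_mul G.ωR_nonneg))

theorem isJumpGenerator_dualGenerator : IsJumpGenerator (dualGenerator G σ) := fun ξ =>
  ((isJumpAt_bulkGenerator ξ.1).comp fun ζ => (ζ, ξ.2)).add
    ((IsJumpAt.single _ _ (mul_nonneg (mul_nonneg G.ωL_nonneg G.αL_pos.le) (Nat.cast_nonneg _))).add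
      (IsJumpAt.single _ _ (mul_nonneg (mul_nonneg G.ωR_nonneg G.αR_pos.le) (Nat.cast_nonneg _))))

/-! ### Particle numbers -/

/-- The number of particles of a configuration. -/
def Config.size (η : Config G σ) : ℕ := ∑ x, η.1 x

theorem sum_sub_single_add {η : Fin N → ℕ} {x : Fin N} (hx : η x ≠ 0) :
    ∑ z, (η - Pi.single x 1 : Fin N → ℕ) z + 1 = ∑ z, η z := by
  have h : (η - Pi.single x 1) + Pi.single x 1 = η := by
    ext z
    simp only [Pi.add_apply, Pi.sub_apply, Pi.single_apply]
    split_ifs with hz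
    · subst hz; omega
    · omega
  nth_rewrite 2 [← h]
  simp [Finset.sum_add_distrib]

theorem Config.size_remove (η : Config G σ) {x : Fin N} (hx : η.1 x ≠ 0) :
    (η.remove x).size + 1 = η.size := by
  rw [Config.size, Config.remove_coe]
  exact sum_sub_single_add hx

theorem Config.size_remove_le (η : Config G σ) (x : Fin N) : (η.remove x).size ≤ η.size := by
  rw [Config.size, Config.remove_coe]
  exact Finset.sum_le_sum fun z _ => Nat.sub_le _ _

theorem Config.size_add (η : Config G σ) {x : Fin N} (h : (G.α x : ℝ) + (σ : ℝ) * η.1 x ≠ 0) :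
    (η.add x).size = η.size + 1 := by
  rw [Config.size, Config.add_coe η h]
  simp [Finset.sum_add_distrib, Config.size]

theorem Config.size_hop (η : Config G σ) {x y : Fin N}
    (h : (η.1 x : ℝ) * ((G.α y : ℝ) + (σ : ℝ) * η.1 y) ≠ 0) : (η.hop x y).size = η.size := by
  have hx : η.1 x ≠ 0 := by exact_mod_cast left_ne_zero_of_mul h
  rw [Config.size, Config.hop_coe η h, Config.size, ← sum_sub_single_add hx]
  simp only [Pi.add_apply, Finset.sum_add_distrib]
  simp

theorem bulkGenerator_size (g : ℕ → ℝ) (η : Config G σ) :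
    bulkGenerator (fun ζ => g ζ.size) η = 0 := by
  rw [bulkGenerator_eq_sum]
  refine Finset.sum_eq_zero fun x _ => Finset.sum_eq_zero fun y _ => ?_
  by_cases h : (η.1 x : ℝ) * ((G.α y : ℝ) + (σ : ℝ) * η.1 y) = 0
  · simp [h]
  · simp [Config.size_hop η h]

theorem DualConfig.total_eq (ξ : DualConfig G σ) : ξ.total = ξ.2.1 + ξ.2.2 + ξ.1.size := rfl

theorem dualGenerator_total (g : ℕ → ℝ) (ξ : DualConfig G σ) :
    dualGenerator G σ (fun ζ => g ζ.total) ξ = 0 := by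
  have h1 : bulkGenerator (fun ζ : Config G σ => g (DualConfig.total (ζ, ξ.2))) ξ.1 = 0 :=
    bulkGenerator_size (fun n => g (ξ.2.1 + ξ.2.2 + n)) ξ.1
  have h2 : ∀ (c : ℝ) (x : Fin N), c * ξ.1.1 x *
      (g (DualConfig.total (G := G) (σ := σ) (ξ.1.remove x, (ξ.2.1 + 1, ξ.2.2))) -
        g ξ.total) = 0 := by
    intro c x
    by_cases hx : ξ.1.1 x = 0
    · simp [hx]
    · have := Config.size_remove ξ.1 hx
      rw [DualConfig.total_eq, DualConfig.total_eq, ← this]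
      dsimp only
      rw [show ξ.2.1 + 1 + ξ.2.2 + (ξ.1.remove x).size = ξ.2.1 + ξ.2.2 + ((ξ.1.remove x).size + 1) by
        ring, sub_self, mul_zero]
  have h3 : ∀ (c : ℝ) (x : Fin N), c * ξ.1.1 x *
      (g (DualConfig.total (G := G) (σ := σ) (ξ.1.remove x, (ξ.2.1, ξ.2.2 + 1))) -
        g ξ.total) = 0 := by
    intro c x
    have h : DualConfig.total (G := G) (σ := σ) (ξ.1.remove x, (ξ.2.1, ξ.2.2 + 1)) =
        DualConfig.total (G := G) (σ := σ) (ξ.1.remove x, (ξ.2.1 + 1, ξ.2.2)) := by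
      simp only [DualConfig.total_eq]
      ring
    rw [h, h2]
  rw [dualGenerator, h1, h2, h3]
  simp

theorem finite_size_le (n : ℕ) : {η : Config G σ | η.size ≤ n}.Finite := by
  have h : (Set.Icc (0 : Fin N → ℕ) (fun _ => n)).Finite := Set.finite_Icc _ _
  refine (h.preimage (Subtype.val_injective.injOn)).subset fun η hη => ⟨zero_le, fun x => ?_⟩
  exact (Finset.single_le_sum (fun _ _ => zero_le) (Finset.mem_univ x)).trans hη

theorem finite_total_le (n : ℕ) : {ξ : DualConfig G σ | DualConfig.total ξ ≤ n}.Finite := by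
  refine ((finite_size_le n).prod ((Set.finite_Iic n).prod (Set.finite_Iic n))).subset fun ξ hξ => ?_
  have h : DualConfig.total ξ ≤ n := hξ
  rw [DualConfig.total_eq] at h
  exact ⟨show ξ.1.size ≤ n by omega, show ξ.2.1 ≤ n by omega, show ξ.2.2 ≤ n by omega⟩

/-! ### Growth control -/

theorem add_one_pow_sub_pow_le {h : ℝ} (hh : 1 ≤ h) (k : ℕ) :
    h * ((h + 1) ^ k - h ^ k) ≤ 3 ^ k * h ^ k := by
  induction k with
  | zero => simp
  | succ k ih =>
    have hp : 0 < h ^ k := by positivity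
    have h3 : (1 : ℝ) ≤ 3 ^ k := one_le_pow₀ (by norm_num)
    have e : h * ((h + 1) ^ (k + 1) - h ^ (k + 1)) =
        (h + 1) * (h * ((h + 1) ^ k - h ^ k)) + h * h ^ k := by ring
    rw [e]
    have h1 : (h + 1) * (h * ((h + 1) ^ k - h ^ k)) ≤ (h + 1) * (3 ^ k * h ^ k) := by gcongr
    have h2 : (h + 1) * (3 ^ k * h ^ k) ≤ (h + h) * (3 ^ k * h ^ k) := by gcongr
    have h4 : h * h ^ k ≤ 3 ^ k * (h * h ^ k) := le_mul_of_one_le_left (by positivity) h3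
    calc _ ≤ (h + h) * (3 ^ k * h ^ k) + 3 ^ k * (h * h ^ k) := by linarith
      _ = _ := by ring

/-- The growth rate `1 + |η|`. -/
def Config.height (η : Config G σ) : ℝ := 1 + η.size

theorem Config.one_le_height (η : Config G σ) : 1 ≤ η.height := by
  rw [Config.height]; have : (0 : ℝ) ≤ η.size := Nat.cast_nonneg _; linarith

theorem Config.apply_le_size (η : Config G σ) (x : Fin N) : η.1 x ≤ η.size :=
  Finset.single_le_sum (fun _ _ => zero_le) (Finset.mem_univ x)

theorem site_rate_le (η : Config G σ) (x : Fin N) :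
    (G.α x : ℝ) + (σ : ℝ) * η.1 x ≤ G.α x * η.height := by
  have h1 : (η.1 x : ℝ) ≤ η.size := by exact_mod_cast η.apply_le_size x
  have h2 : (1 : ℝ) ≤ G.α x := by exact_mod_cast G.α_pos x
  have h3 : (σ : ℝ) * η.1 x ≤ η.1 x := by
    have : (0 : ℝ) ≤ η.1 x := Nat.cast_nonneg _
    rcases σ with _ | _ | _
    · simp
    · simp only [SignType.neg_eq_neg_one, SignType.coe_neg_one]; linarith
    · simp
  rw [Config.height]
  nlinarith

theorem reservoirGenerator_height_le {a θ : ℝ} (ha : 0 < a) (h : θ ∈ scaleRange σ) (x : Fin N)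
    (k : ℕ) (η : Config G σ) : reservoirGenerator x a θ (fun ζ => ζ.height ^ k) η ≤
      a * θ * G.α x * 3 ^ k * η.height ^ k := by
  have h1 := η.one_le_height
  have hrem : (η.1 x : ℝ) * (a + (σ : ℝ) * a * θ) *
      ((η.remove x).height ^ k - η.height ^ k) ≤ 0 := by
    refine mul_nonpos_of_nonneg_of_nonpos (remove_rate_nonneg ha h η x) ?_
    rw [sub_nonpos]
    refine pow_le_pow_left₀ (zero_le_one.trans (Config.one_le_height _)) ?_ k
    have : ((η.remove x).size : ℝ) ≤ η.size := by exact_mod_cast η.size_remove_le x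
    rw [Config.height, Config.height]; linarith
  have hadd : a * θ * ((G.α x : ℝ) + (σ : ℝ) * η.1 x) * ((η.add x).height ^ k - η.height ^ k) ≤
      a * θ * G.α x * 3 ^ k * η.height ^ k := by
    have hθ := scaleRange_nonneg h
    by_cases h0 : (G.α x : ℝ) + (σ : ℝ) * η.1 x = 0
    · rw [h0]
      have := zero_le_one.trans h1
      simp only [mul_zero, zero_mul]
      positivity
    · have hs : (η.add x).height = η.height + 1 := by
        rw [Config.height, Config.height, Config.size_add η h0]; push_cast; ring
      rw [hs]
      have hd : 0 ≤ (η.height + 1) ^ k - η.height ^ k := by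
        rw [sub_nonneg]
        exact pow_le_pow_left₀ (by linarith) (by linarith) k
      calc _ ≤ a * θ * (G.α x * η.height) * ((η.height + 1) ^ k - η.height ^ k) := by
            gcongr
            exact site_rate_le η x
        _ = a * θ * G.α x * (η.height * ((η.height + 1) ^ k - η.height ^ k)) := by ring
        _ ≤ a * θ * G.α x * (3 ^ k * η.height ^ k) := by
            exact mul_le_mul_of_nonneg_left (add_one_pow_sub_pow_le h1 k)
              (mul_nonneg (mul_nonneg ha.le hθ) (Nat.cast_nonneg _))
        _ = _ := by ring
  rw [reservoirGenerator]
  linarith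

theorem generator_height_le {θL θR : ℝ} (hL : θL ∈ scaleRange σ) (hR : θR ∈ scaleRange σ) (k : ℕ) :
    ∃ c, 0 < c ∧ ∀ η : Config G σ,
      generator G σ θL θR (fun ζ => ζ.height ^ k) η ≤ c * η.height ^ k := by
  have h1 := scaleRange_nonneg hL
  have h2 := scaleRange_nonneg hR
  have h3 := G.αL_pos
  have h4 := G.αR_pos
  have h5 := G.ωL_nonneg
  have h6 := G.ωR_nonneg
  refine ⟨1 + G.ωL * (G.αL * θL * G.α G.first * 3 ^ k) + G.ωR * (G.αR * θR * G.α G.last * 3 ^ k),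
    by positivity, fun η => ?_⟩
  have hb : bulkGenerator (fun ζ : Config G σ => ζ.height ^ k) η = 0 :=
    bulkGenerator_size (fun n => (1 + (n : ℝ)) ^ k) η
  rw [generator, hb]
  have hl := mul_le_mul_of_nonneg_left
    (reservoirGenerator_height_le G.αL_pos hL G.first k η) h5
  have hr := mul_le_mul_of_nonneg_left
    (reservoirGenerator_height_le G.αR_pos hR G.last k η) h6
  have : 0 ≤ η.height ^ k := pow_nonneg (zero_le_one.trans η.one_le_height) k
  linarith

theorem finite_height_le (M : ℝ) : {η : Config G σ | η.height ≤ M}.Finite := by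
  refine (finite_size_le ⌊M⌋₊).subset fun η hη => ?_
  have h : 1 + (η.size : ℝ) ≤ M := hη
  exact Nat.le_floor (by linarith)

theorem isControl_height {θL θR : ℝ} (hL : θL ∈ scaleRange σ) (hR : θR ∈ scaleRange σ) (k : ℕ) :
    IsControl (generator G σ θL θR) fun η : Config G σ => η.height ^ k where
  nonneg η := pow_nonneg (zero_le_one.trans η.one_le_height) k
  growth := by
    obtain ⟨c, hc, h⟩ := generator_height_le (G := G) hL hR k
    exact ⟨c, hc.le, h⟩
  proper := by
    refine ⟨fun η => η.height ^ (k + 1), fun η => pow_nonneg (zero_le_one.trans η.one_le_height) _,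
      generator_height_le hL hR (k + 1), fun ε hε => (finite_height_le (1 / ε)).subset fun η hη => ?_⟩
    have h1 : ε * η.height ^ (k + 1) ≤ η.height ^ k := hη
    have hp : 0 < η.height ^ k := pow_pos (zero_lt_one.trans_le η.one_le_height) k
    rw [Set.mem_ofPred_eq, le_div_iff₀ hε]
    rw [pow_succ] at h1
    have : η.height ^ k * (η.height * ε) ≤ η.height ^ k * 1 := by linarith
    exact le_of_mul_le_mul_left this hp

theorem isControl_generator_one {θL θR : ℝ} (hL : θL ∈ scaleRange σ) (hR : θR ∈ scaleRange σ) :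
    IsControl (generator G σ θL θR) fun _ => 1 := by
  simpa using isControl_height (G := G) hL hR 0

theorem isControl_total {g : ℕ → ℝ} (hg : ∀ n, 0 ≤ g n) :
    IsControl (dualGenerator G σ) fun ξ => g ξ.total where
  nonneg ξ := hg _
  growth := ⟨0, le_rfl, fun ξ => by rw [dualGenerator_total]; simp⟩
  proper := by
    refine ⟨fun ξ => (1 + ξ.total) * (g ξ.total + 1), fun ξ => ?_, ⟨1, one_pos, fun ξ => ?_⟩,
      fun ε hε => (finite_total_le ⌊1 / ε⌋₊).subset fun ξ hξ => ?_⟩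
    · have := hg ξ.total; positivity
    · rw [dualGenerator_total fun n => (1 + (n : ℝ)) * (g n + 1)]
      have := hg ξ.total; positivity
    · have h1 : ε * ((1 + ξ.total) * (g ξ.total + 1)) ≤ g ξ.total := hξ
      have h2 : 0 < g ξ.total + 1 := by have := hg ξ.total; positivity
      refine Nat.le_floor ?_
      rw [le_div_iff₀ hε]
      have : (g ξ.total + 1) * (ξ.total * ε) ≤ (g ξ.total + 1) * 1 := by nlinarith
      exact le_of_mul_le_mul_left this h2

theorem isControl_dualGenerator_one : IsControl (dualGenerator G σ) fun _ => 1 :=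
  isControl_total (g := fun _ => 1) fun _ => zero_le_one

/-- The dual configurations with `n` particles. -/
def sector (G : Geometry N) (σ : SignType) (n : ℕ) : Finset (DualConfig G σ) :=
  ((finite_total_le (G := G) (σ := σ) n).subset (t := {ξ | DualConfig.total ξ = n})
    fun ξ (h : DualConfig.total ξ = n) => show DualConfig.total ξ ≤ n from h.le).toFinset

theorem mem_sector {n : ℕ} {ξ : DualConfig G σ} : ξ ∈ sector G σ n ↔ ξ.total = n := by
  simp [sector]

/-- For the dual process every function is dominated by a control. -/
theorem exists_isControl_dual (f : DualConfig G σ → ℝ) :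
    ∃ ψ, IsControl (dualGenerator G σ) ψ ∧ ∀ ξ ξ' : DualConfig G σ, ξ.total = ξ'.total →
      |f ξ| ≤ ψ ξ' := by
  refine ⟨_, isControl_total (g := fun n => ∑ ξ ∈ sector G σ n, |f ξ|) fun n =>
    Finset.sum_nonneg fun _ _ => abs_nonneg _, fun ξ ξ' h => ?_⟩
  exact Finset.single_le_sum (f := fun ξ => |f ξ|) (fun _ _ => abs_nonneg _) (mem_sector.2 h)

end Particles


/-! ## Single-site duality functions -/

section SiteFunctions

/-- The binomial transform of a sequence. -/
def binomialShift (θ : ℝ) (c : ℕ → ℝ) (k : ℕ) : ℝ :=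
  ∑ l ∈ Finset.range (k + 1), (k.choose l : ℝ) * (-θ) ^ (k - l) * c l

theorem binomialShift_congr {θ : ℝ} {c d : ℕ → ℝ} {k : ℕ} (h : ∀ l ≤ k, c l = d l) :
    binomialShift θ c k = binomialShift θ d k :=
  Finset.sum_congr rfl fun l hl => by rw [h l (Nat.lt_succ_iff.1 (Finset.mem_range.1 hl))]

theorem binomialShift_add (θ : ℝ) (c d : ℕ → ℝ) (k : ℕ) :
    binomialShift θ (fun l => c l + d l) k = binomialShift θ c k + binomialShift θ d k := by
  simp_rw [binomialShift, mul_add, Finset.sum_add_distrib]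

theorem binomialShift_const_mul (θ a : ℝ) (c : ℕ → ℝ) (k : ℕ) :
    binomialShift θ (fun l => a * c l) k = a * binomialShift θ c k := by
  simp_rw [binomialShift, Finset.mul_sum]
  exact Finset.sum_congr rfl fun _ _ => by ring

theorem binomialShift_zero (θ : ℝ) (c : ℕ → ℝ) : binomialShift θ c 0 = c 0 := by
  simp [binomialShift]

theorem binomialShift_succ (θ : ℝ) (c : ℕ → ℝ) (k : ℕ) :
    binomialShift θ c (k + 1) =
      binomialShift θ (fun l => c (l + 1)) k - θ * binomialShift θ c k := by
  have h1 : θ * binomialShift θ c k =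
      -(∑ l ∈ Finset.range (k + 1), (k.choose l : ℝ) * (-θ) ^ (k + 1 - l) * c l) := by
    rw [binomialShift, Finset.mul_sum, ← Finset.sum_neg_distrib]
    refine Finset.sum_congr rfl fun l hl => ?_
    rw [Nat.succ_sub (Nat.lt_succ_iff.1 (Finset.mem_range.1 hl)), pow_succ]
    ring
  have h2 : ∑ l ∈ Finset.range (k + 1), (k.choose l : ℝ) * (-θ) ^ (k + 1 - l) * c l =
      ∑ l ∈ Finset.range (k + 1), (k.choose (l + 1) : ℝ) * (-θ) ^ (k - l) * c (l + 1) +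
        (-θ) ^ (k + 1) * c 0 := by
    have h3 : ∑ l ∈ Finset.range (k + 1 + 1), (k.choose l : ℝ) * (-θ) ^ (k + 1 - l) * c l =
        ∑ l ∈ Finset.range (k + 1), (k.choose l : ℝ) * (-θ) ^ (k + 1 - l) * c l := by
      rw [Finset.sum_range_succ, Nat.choose_succ_self]; simp
    rw [← h3, Finset.sum_range_succ']
    simp
  rw [h1, h2, binomialShift, binomialShift, Finset.sum_range_succ']
  simp_rw [Nat.choose_succ_succ, Nat.add_sub_add_right]
  push_cast
  simp_rw [add_mul, Finset.sum_add_distrib]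
  simp
  ring

theorem binomialShift_lower (θ : ℝ) (c : ℕ → ℝ) (k : ℕ) :
    binomialShift θ (fun l => l * c (l - 1)) k = k * binomialShift θ c (k - 1) := by
  induction k generalizing c with
  | zero => simp [binomialShift_zero]
  | succ k ih =>
    rw [binomialShift_succ, ih]
    have h1 : binomialShift θ (fun l => ((l + 1 : ℕ) : ℝ) * c (l + 1 - 1)) k =
        k * binomialShift θ (fun l => c (l + 1)) (k - 1) + binomialShift θ c k := by
      rw [← ih, ← binomialShift_add]
      refine binomialShift_congr fun l _ => ?_
      rcases l with _ | l
      · simp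
      · simp only [Nat.add_sub_cancel]; push_cast; ring
    rw [h1]
    rcases k with _ | k
    · simp
    · have := binomialShift_succ θ c k
      simp only [Nat.add_sub_cancel]
      push_cast
      linear_combination (-(k : ℝ) - 1) * this

theorem binomialShift_number (θ : ℝ) (c : ℕ → ℝ) (k : ℕ) :
    binomialShift θ (fun l => l * c l) k =
      k * binomialShift θ c k + θ * (k * binomialShift θ c (k - 1)) := by
  have h := binomialShift_lower θ (fun l => c (l + 1)) k
  have h1 : binomialShift θ (fun l => l * c l) k =
      binomialShift θ (fun l => l * c (l - 1 + 1)) k := by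
    refine binomialShift_congr fun l _ => ?_
    rcases l with _ | l <;> simp
  rw [h1, h]
  rcases k with _ | k
  · simp
  · have := binomialShift_succ θ c k
    simp only [Nat.add_sub_cancel]
    linear_combination (-((k + 1 : ℕ) : ℝ)) * this

theorem binomialShift_raise (θ a s : ℝ) (c : ℕ → ℝ) (k : ℕ) :
    binomialShift θ (fun l => (a + s * l) * c (l + 1)) k =
      (a + s * k) * binomialShift θ c (k + 1) + θ * ((a + 2 * s * k) * binomialShift θ c k) +
        s * θ ^ 2 * (k * binomialShift θ c (k - 1)) := by
  have h1 : binomialShift θ (fun l => (a + s * l) * c (l + 1)) k =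
      a * binomialShift θ (fun l => c (l + 1)) k +
        s * binomialShift θ (fun l => l * c (l + 1)) k := by
    rw [← binomialShift_const_mul, ← binomialShift_const_mul, ← binomialShift_add]
    exact binomialShift_congr fun l _ => by ring
  have h2 := binomialShift_number θ (fun l => c (l + 1)) k
  have h3 := binomialShift_succ θ c k
  rw [h1, h2]
  rcases k with _ | k
  · simp only [Nat.cast_zero]; linear_combination (-a) * h3
  · have h4 := binomialShift_succ θ c k
    simp only [Nat.add_sub_cancel]
    linear_combination (-a - s * (k + 1 : ℕ)) * h3 - θ * s * (k + 1 : ℕ) * h4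

theorem falling_succ (n l : ℕ) : falling n (l + 1) = ((n : ℝ) - l) * falling n l := by
  rw [falling, falling, Nat.descFactorial_succ]
  rcases le_or_gt l n with h | h
  · push_cast [Nat.cast_sub h]; ring
  · rw [Nat.descFactorial_eq_zero_iff_lt.2 h]; simp

theorem falling_zero (n : ℕ) : falling n 0 = 1 := by simp [falling]

theorem succ_falling (n l : ℕ) :
    falling (n + 1) l = falling n l + l * falling n (l - 1) := by
  induction l with
  | zero => simp [falling_zero]
  | succ l ih =>
    rw [falling_succ, ih, falling_succ]
    rcases l with _ | l
    · simp [falling_zero]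
    · simp only [Nat.add_sub_cancel]
      rw [falling_succ]
      push_cast
      ring

theorem mul_falling_pred (n l : ℕ) : (n : ℝ) * falling (n - 1) l = falling n (l + 1) := by
  rcases n with _ | n
  · simp [falling]
  · rw [falling, falling, Nat.succ_descFactorial_succ]; simp

theorem falling_ne_zero {n l : ℕ} (h : l ≤ n) : falling n l ≠ 0 := by
  rw [falling, Nat.cast_ne_zero]
  exact fun h' => absurd (Nat.descFactorial_eq_zero_iff_lt.1 h') (not_lt.2 h)

theorem gammaRatio_succ (v : ℝ) (l : ℕ) : gammaRatio v (l + 1) = gammaRatio v l * (v + l) :=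
  Finset.prod_range_succ _ _

theorem gammaRatio_pos {v : ℝ} (hv : 0 < v) (l : ℕ) : 0 < gammaRatio v l :=
  Finset.prod_pos fun _ _ => by positivity

theorem gammaRatio_neg (a l : ℕ) : gammaRatio (-(a : ℝ)) l = (-1) ^ l * falling a l := by
  induction l with
  | zero => simp [gammaRatio, falling]
  | succ l ih => rw [gammaRatio_succ, ih, falling_succ]; ring

theorem siteWeight_succ (σ : SignType) (a l : ℕ) :
    siteWeight σ a (l + 1) = siteWeight σ a l * (a + σ * l) := by
  rcases σ with _ | _ | _
  · simp [siteWeight, pow_succ]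
  · simp only [siteWeight, SignType.neg_eq_neg_one, SignType.coe_neg_one]
    rw [falling_succ]; ring
  · simp [siteWeight, gammaRatio_succ]

theorem siteWeight_zero (σ : SignType) (a : ℕ) : siteWeight σ a 0 = 1 := by
  rcases σ with _ | _ | _ <;> simp [siteWeight, falling, gammaRatio]

theorem siteWeight_ne_zero {σ : SignType} {a l : ℕ} (ha : 0 < a) (h : σ = -1 → l ≤ a) :
    siteWeight σ a l ≠ 0 := by
  rcases σ with _ | _ | _
  · simp only [siteWeight]; positivity
  · exact falling_ne_zero (h rfl)
  · exact (gammaRatio_pos (by positivity) l).ne'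

theorem dOrthogonal_eq {σ : SignType} {a : ℕ} (ha : 0 < a) (θ : ℝ) (k n : ℕ) :
    dOrthogonal σ a θ k n = binomialShift θ (fun l => dClassical σ a l n) k := by
  unfold dOrthogonal
  split_ifs with hθ
  · subst hθ
    rw [binomialShift, Finset.sum_range_succ, Finset.sum_eq_zero]
    · simp
    · intro l hl
      have : k - l ≠ 0 := by have := Finset.mem_range.1 hl; omega
      simp [this]
  · have key : ∀ l ∈ Finset.range (k + 1), (-θ) ^ k = (-θ) ^ (k - l) * (-θ) ^ l := fun l hl => by
      rw [← pow_add, Nat.sub_add_cancel (Nat.lt_succ_iff.1 (Finset.mem_range.1 hl))]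
    have hθ' : (-θ) ≠ 0 := neg_ne_zero.2 hθ
    have ha' : (a : ℝ) ≠ 0 := by positivity
    rcases σ with _ | _ | _
    · simp only [hyp20, binomialShift, dClassical, siteWeight, Finset.mul_sum]
      refine Finset.sum_congr rfl fun l hl => ?_
      have : (-θ) ^ l * (-(1 / (θ * a))) ^ l = 1 / (a : ℝ) ^ l := by
        rw [← mul_pow, ← one_div_pow]
        congr 1
        field_simp
      rw [key l hl]
      linear_combination ((-θ) ^ (k - l) * (k.choose l) * falling n l) * this
    · simp only [hyp21, binomialShift, dClassical, siteWeight, Finset.mul_sum]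
      refine Finset.sum_congr rfl fun l hl => ?_
      have h1 : (-θ) ^ l * (1 / θ) ^ l = (-1) ^ l := by
        rw [← mul_pow]
        congr 1
        field_simp
      have h2 : (-1 : ℝ) ^ l * (-1) ^ l = 1 := by rw [← mul_pow]; simp
      have h3 : 1 / gammaRatio (-(a : ℝ)) l = (-1) ^ l * (1 / falling a l) := by
        rw [gammaRatio_neg, one_div, mul_inv, one_div, ← inv_pow, inv_neg, inv_one]
      rw [key l hl, h3]
      linear_combination ((-θ) ^ (k - l) * (k.choose l) * falling n l * (1 / falling a l)) *
        ((-1) ^ l * h1 + h2)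
    · simp only [hyp21, binomialShift, dClassical, siteWeight, Finset.mul_sum]
      refine Finset.sum_congr rfl fun l hl => ?_
      have h1 : (-θ) ^ l * (-(1 / θ)) ^ l = 1 := by
        rw [← mul_pow]
        have : -θ * -(1 / θ) = 1 := by field_simp
        rw [this, one_pow]
      rw [key l hl]
      linear_combination ((-θ) ^ (k - l) * (k.choose l) * falling n l * (1 / gammaRatio a l)) * h1

variable {σ : SignType} {a : ℕ}

theorem mul_dClassical_pred (ha : 0 < a) {l n : ℕ} (hl : σ = -1 → l ≤ a) (hn : σ = -1 → n ≤ a) :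
    n * dClassical σ a l (n - 1) = (a + σ * l) * dClassical σ a (l + 1) n := by
  rw [dClassical, dClassical, ← mul_assoc, mul_falling_pred, siteWeight_succ]
  by_cases h : (a : ℝ) + σ * l = 0
  · rw [h, zero_mul]
    have hσ : σ = -1 := by
      rcases σ with _ | _ | _
      · simp at h; omega
      · rfl
      · simp only [SignType.pos_eq_one, SignType.coe_one] at h
        have : (0 : ℝ) < a := by positivity
        have : (0 : ℝ) ≤ l := by positivity
        linarith
    subst hσ
    have hla : l = a := by
      have : (l : ℝ) = a := by rw [SignType.coe_neg_one] at h; linarith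
      exact_mod_cast this
    rw [falling, Nat.descFactorial_eq_zero_iff_lt.2 (by have := hn rfl; omega)]
    simp
  · have := siteWeight_ne_zero ha hl
    field_simp

theorem mul_dClassical (ha : 0 < a) {l n : ℕ} (hl : σ = -1 → l ≤ a) (hn : σ = -1 → n ≤ a) :
    n * dClassical σ a l n = (a + σ * l) * dClassical σ a (l + 1) n + l * dClassical σ a l n := by
  rw [← mul_dClassical_pred ha hl hn, dClassical, dClassical]
  have h1 := mul_falling_pred n l
  have h2 := falling_succ n l
  linear_combination (-(1 / siteWeight σ a l)) * (h1 + h2)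

theorem mul_dClassical_succ (ha : 0 < a) {l n : ℕ} (hl : σ = -1 → l ≤ a) :
    ((a : ℝ) + σ * n) * dClassical σ a l (n + 1) = σ * (n * dClassical σ a l (n - 1)) +
      (a + 2 * (σ : ℝ) * l) * dClassical σ a l n + l * dClassical σ a (l - 1) n := by
  rw [dClassical, dClassical, dClassical, dClassical]
  have h1 := mul_falling_pred n l
  have h2 := falling_succ n l
  have h3 := succ_falling n l
  have hw := siteWeight_ne_zero ha hl
  rcases l with _ | l
  · simp only [falling_zero, siteWeight_zero]; simp; ring
  · have h4 := falling_succ n l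
    simp only [Nat.add_sub_cancel] at h3 ⊢
    have hw' : 1 / siteWeight σ a l = (a + σ * l) * (1 / siteWeight σ a (l + 1)) := by
      have hs := siteWeight_succ σ a l
      have h0 : siteWeight σ a l ≠ 0 := fun h => hw (by rw [hs, h, zero_mul])
      rw [mul_one_div, div_eq_div_iff h0 hw, hs]; ring
    rw [hw']
    push_cast at *
    set w := 1 / siteWeight σ a (l + 1)
    linear_combination (-(σ : ℝ) * w) * h1 + (-(σ : ℝ) * w) * h2 + ((a + σ * n) * w) * h3 +
      (-(σ : ℝ) * (l + 1) * w) * h4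

/-- Action of the annihilation operator in the variable `n`. -/
theorem mul_dOrthogonal_pred (ha : 0 < a) (θ : ℝ) {k n : ℕ} (hk : σ = -1 → k ≤ a)
    (hn : σ = -1 → n ≤ a) :
    n * dOrthogonal σ a θ k (n - 1) = (a + σ * k) * dOrthogonal σ a θ (k + 1) n +
      θ * ((a + 2 * (σ : ℝ) * k) * dOrthogonal σ a θ k n) +
        σ * θ ^ 2 * (k * dOrthogonal σ a θ (k - 1) n) := by
  simp_rw [dOrthogonal_eq ha]
  rw [← binomialShift_raise, ← binomialShift_const_mul]
  exact binomialShift_congr fun l hl => mul_dClassical_pred ha (fun h => hl.trans (hk h)) hn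

/-- Action of the number operator in the variable `n`. -/
theorem mul_dOrthogonal (ha : 0 < a) (θ : ℝ) {k n : ℕ} (hk : σ = -1 → k ≤ a)
    (hn : σ = -1 → n ≤ a) :
    n * dOrthogonal σ a θ k n = n * dOrthogonal σ a θ k (n - 1) + k * dOrthogonal σ a θ k n +
      θ * (k * dOrthogonal σ a θ (k - 1) n) := by
  simp_rw [dOrthogonal_eq ha]
  rw [add_assoc, ← binomialShift_number, ← binomialShift_const_mul, ← binomialShift_const_mul,
    ← binomialShift_add]
  refine binomialShift_congr fun l hl => ?_
  rw [mul_dClassical ha (fun h => hl.trans (hk h)) hn,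
    mul_dClassical_pred ha (fun h => hl.trans (hk h)) hn]

/-- Action of the creation operator in the variable `n`. -/
theorem mul_dOrthogonal_succ (ha : 0 < a) (θ : ℝ) {k n : ℕ} (hk : σ = -1 → k ≤ a) :
    ((a : ℝ) + σ * n) * dOrthogonal σ a θ k (n + 1) = σ * (n * dOrthogonal σ a θ k (n - 1)) +
      (a + 2 * (σ : ℝ) * k) * dOrthogonal σ a θ k n +
        (1 + 2 * (σ : ℝ) * θ) * (k * dOrthogonal σ a θ (k - 1) n) := by
  simp_rw [dOrthogonal_eq ha]
  have h1 := binomialShift_number θ (fun l => dClassical σ a l n) k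
  have h2 := binomialShift_lower θ (fun l => dClassical σ a l n) k
  have h3 : (a + 2 * (σ : ℝ) * k) * binomialShift θ (fun l => dClassical σ a l n) k +
      (1 + 2 * (σ : ℝ) * θ) * (k * binomialShift θ (fun l => dClassical σ a l n) (k - 1)) =
      a * binomialShift θ (fun l => dClassical σ a l n) k +
        2 * σ * binomialShift θ (fun l => l * dClassical σ a l n) k +
        binomialShift θ (fun l => l * dClassical σ a (l - 1) n) k := by
    rw [h1, h2]; ring
  rw [add_assoc, h3, ← mul_assoc]
  simp_rw [← binomialShift_const_mul, ← binomialShift_add]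
  refine binomialShift_congr fun l hl => ?_
  rw [mul_dClassical_succ ha fun h => hl.trans (hk h)]
  ring

theorem dOrthogonal_zero_left (ha : 0 < a) (θ : ℝ) (n : ℕ) : dOrthogonal σ a θ 0 n = 1 := by
  rw [dOrthogonal_eq ha, binomialShift_zero, dClassical, siteWeight_zero, falling_zero]
  simp

/-- Polynomial growth of the single-site duality functions. -/
theorem abs_dOrthogonal_le (ha : 0 < a) (θ : ℝ) (k : ℕ) :
    ∃ C, 0 < C ∧ ∀ n : ℕ, |dOrthogonal σ a θ k n| ≤ C * (1 + n) ^ k := by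
  refine ⟨1 + ∑ l ∈ Finset.range (k + 1), |(k.choose l : ℝ) * (-θ) ^ (k - l) *
    (1 / siteWeight σ a l)|, by positivity, fun n => ?_⟩
  rw [dOrthogonal_eq ha, binomialShift, add_mul, Finset.sum_mul]
  refine (Finset.abs_sum_le_sum_abs _ _).trans (le_add_of_nonneg_of_le (by positivity) ?_)
  refine Finset.sum_le_sum fun l hl => ?_
  have h1 : |falling n l| ≤ (1 + n) ^ k := by
    rw [falling, Nat.abs_cast]
    calc (n.descFactorial l : ℝ) ≤ (n : ℝ) ^ l := by exact_mod_cast Nat.descFactorial_le_pow n l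
      _ ≤ (1 + n) ^ l := by gcongr; linarith
      _ ≤ (1 + n) ^ k := by
        gcongr
        · have : (0 : ℝ) ≤ n := by positivity
          linarith
        · exact Nat.lt_succ_iff.1 (Finset.mem_range.1 hl)
  rw [dClassical, mul_comm (falling n l), ← mul_assoc, abs_mul]
  gcongr

end SiteFunctions


/-! ## Duality -/

section Duality

variable {N : ℕ} {G : Geometry N} {σ : SignType}

theorem prod_eq_mul_mul_prod {x y : Fin N} (hxy : x ≠ y) (g : Fin N → ℝ) :
    ∏ z, g z = g x * g y * ∏ z ∈ (Finset.univ.erase x).erase y, g z := by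
  rw [mul_assoc, Finset.mul_prod_erase _ _ (by simp [hxy.symm]),
    Finset.mul_prod_erase _ _ (Finset.mem_univ x)]

theorem mul_prod_hop (η : Config G σ) {x y : Fin N} (hxy : x ≠ y) (g : Fin N → ℕ → ℝ) :
    (η.1 x : ℝ) * ((G.α y : ℝ) + (σ : ℝ) * η.1 y) * ∏ z, g z ((η.hop x y).1 z) =
      (η.1 x : ℝ) * ((G.α y : ℝ) + (σ : ℝ) * η.1 y) * (g x (η.1 x - 1) * g y (η.1 y + 1) *
        ∏ z ∈ (Finset.univ.erase x).erase y, g z (η.1 z)) := by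
  by_cases h : (η.1 x : ℝ) * ((G.α y : ℝ) + (σ : ℝ) * η.1 y) = 0
  · rw [h, zero_mul, zero_mul]
  · rw [η.hop_coe h, prod_eq_mul_mul_prod hxy]
    congr 2
    · simp [hxy, hxy.symm]
    · refine Finset.prod_congr rfl fun z hz => ?_
      simp only [Finset.mem_erase] at hz
      simp [hz.1, hz.2.1]

theorem prod_remove (η : Config G σ) (x : Fin N) (g : Fin N → ℕ → ℝ) :
    ∏ z, g z ((η.remove x).1 z) = g x (η.1 x - 1) * ∏ z ∈ Finset.univ.erase x, g z (η.1 z) := by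
  rw [η.remove_coe, ← Finset.mul_prod_erase _ _ (Finset.mem_univ x)]
  congr 1
  · simp
  · refine Finset.prod_congr rfl fun z hz => ?_
    simp [Finset.ne_of_mem_erase hz]

theorem mul_prod_add (η : Config G σ) (x : Fin N) (g : Fin N → ℕ → ℝ) :
    ((G.α x : ℝ) + (σ : ℝ) * η.1 x) * ∏ z, g z ((η.add x).1 z) =
      ((G.α x : ℝ) + (σ : ℝ) * η.1 x) *
        (g x (η.1 x + 1) * ∏ z ∈ Finset.univ.erase x, g z (η.1 z)) := by
  by_cases h : (G.α x : ℝ) + (σ : ℝ) * η.1 x = 0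
  · rw [h, zero_mul, zero_mul]
  · rw [η.add_coe h, ← Finset.mul_prod_erase _ _ (Finset.mem_univ x)]
    congr 2
    · simp
    · refine Finset.prod_congr rfl fun z hz => ?_
      simp [Finset.ne_of_mem_erase hz]

variable (θL θR θ : ℝ)

theorem bond_duality (ξ : DualConfig G σ) (η : Config G σ) {x y : Fin N} (hxy : x ≠ y) :
    bondGenerator x y (orthogonalDuality θL θR θ ξ) η =
      bondGenerator x y (fun ζ => orthogonalDuality θL θR θ (ζ, ξ.2) η) ξ.1 := by
  have hη := fun z => fun h => η.2 h z
  have hξ := fun z => fun h => ξ.1.2 h z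
  have e1 := fun z => mul_dOrthogonal_pred (G.α_pos z) θ (hξ z) (hη z)
  have e2 := fun z => mul_dOrthogonal (G.α_pos z) θ (hξ z) (hη z)
  have e3 := fun z n => mul_dOrthogonal_succ (n := n) (G.α_pos z) θ (hξ z)
  have f1 := mul_prod_hop η hxy fun z n => dOrthogonal σ (G.α z) θ (ξ.1.1 z) n
  have f2 := mul_prod_hop η hxy.symm fun z n => dOrthogonal σ (G.α z) θ (ξ.1.1 z) n
  have f3 := mul_prod_hop ξ.1 hxy fun z k => dOrthogonal σ (G.α z) θ k (η.1 z)
  have f4 := mul_prod_hop ξ.1 hxy.symm fun z k => dOrthogonal σ (G.α z) θ k (η.1 z)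
  have f0 := prod_eq_mul_mul_prod hxy fun z => dOrthogonal σ (G.α z) θ (ξ.1.1 z) (η.1 z)
  rw [Finset.erase_right_comm] at f2 f4
  simp only [bondGenerator, orthogonalDuality]
  rw [f0]
  set R := ∏ z ∈ (Finset.univ.erase x).erase y, dOrthogonal σ (G.α z) θ (ξ.1.1 z) (η.1 z)
  set A := (θL - θ) ^ ξ.2.1
  set B := (θR - θ) ^ ξ.2.2
  have e1x := e1 x
  have e1y := e1 y
  have e2x := e2 x
  have e2y := e2 y
  have e3x := e3 x (η.1 x)
  have e3y := e3 y (η.1 y)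
  set dx := dOrthogonal σ (G.α x) θ (ξ.1.1 x) (η.1 x)
  set dy := dOrthogonal σ (G.α y) θ (ξ.1.1 y) (η.1 y)
  set px := (η.1 x : ℝ) * dOrthogonal σ (G.α x) θ (ξ.1.1 x) (η.1 x - 1)
  set py := (η.1 y : ℝ) * dOrthogonal σ (G.α y) θ (ξ.1.1 y) (η.1 y - 1)
  set ux := dOrthogonal σ (G.α x) θ (ξ.1.1 x + 1) (η.1 x)
  set uy := dOrthogonal σ (G.α y) θ (ξ.1.1 y + 1) (η.1 y)
  set vx := dOrthogonal σ (G.α x) θ (ξ.1.1 x - 1) (η.1 x)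
  set vy := dOrthogonal σ (G.α y) θ (ξ.1.1 y - 1) (η.1 y)
  set rx := ((G.α x : ℝ) + (σ : ℝ) * η.1 x) * dOrthogonal σ (G.α x) θ (ξ.1.1 x) (η.1 x + 1)
  set ry := ((G.α y : ℝ) + (σ : ℝ) * η.1 y) * dOrthogonal σ (G.α y) θ (ξ.1.1 y) (η.1 y + 1)
  have key : px * ry - (η.1 x * dx) * (G.α y * dy + σ * (η.1 y * dy)) +
      (py * rx - (η.1 y * dy) * (G.α x * dx + σ * (η.1 x * dx))) =
      (ξ.1.1 x : ℝ) * (G.α y + σ * ξ.1.1 y) * (vx * uy - dx * dy) +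
      (ξ.1.1 y : ℝ) * (G.α x + σ * ξ.1.1 x) * (vy * ux - dx * dy) := by
    rw [e2x, e2y, e3x, e3y, e1x, e1y]
    ring
  linear_combination (A * B) * f1 + (A * B) * f2 - (A * B) * f3 - (A * B) * f4 + (A * B * R) * key

theorem bulk_duality (ξ : DualConfig G σ) (η : Config G σ) :
    bulkGenerator (orthogonalDuality θL θR θ ξ) η =
      bulkGenerator (fun ζ => orthogonalDuality θL θR θ (ζ, ξ.2) η) ξ.1 := by
  refine Finset.sum_congr rfl fun x _ => Finset.sum_congr rfl fun y hy => ?_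
  rw [bond_duality θL θR θ ξ η (Finset.mem_Ioi.1 hy).ne]

theorem reservoir_duality (ξ : Config G σ) (η : Config G σ) (x : Fin N) (a θj : ℝ) :
    reservoirGenerator x a θj
        (fun ζ => ∏ z, dOrthogonal σ (G.α z) θ (ξ.1 z) (ζ.1 z)) η =
      a * ξ.1 x * ((∏ z, dOrthogonal σ (G.α z) θ ((ξ.remove x).1 z) (η.1 z)) * (θj - θ) -
        ∏ z, dOrthogonal σ (G.α z) θ (ξ.1 z) (η.1 z)) := by
  have hη := fun z => fun h => η.2 h z
  have hξ := fun z => fun h => ξ.2 h z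
  have e2 := mul_dOrthogonal (G.α_pos x) θ (hξ x) (hη x)
  have e3 := mul_dOrthogonal_succ (n := η.1 x) (G.α_pos x) θ (hξ x)
  have f1 := prod_remove η x fun z n => dOrthogonal σ (G.α z) θ (ξ.1 z) n
  have f2 := mul_prod_add η x fun z n => dOrthogonal σ (G.α z) θ (ξ.1 z) n
  have f3 := prod_remove ξ x fun z k => dOrthogonal σ (G.α z) θ k (η.1 z)
  have f0 := Finset.mul_prod_erase Finset.univ
    (fun z => dOrthogonal σ (G.α z) θ (ξ.1 z) (η.1 z)) (Finset.mem_univ x)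
  simp only [reservoirGenerator]
  rw [← f0, f1, f3]
  set R := ∏ z ∈ Finset.univ.erase x, dOrthogonal σ (G.α z) θ (ξ.1 z) (η.1 z)
  linear_combination (a * θj) * f2 + (a * θj * R) * e3 -
    (a * R * (1 + 2 * (σ : ℝ) * θj)) * e2

/-- The orthogonal duality functions intertwine the generators of the process and its dual. -/
theorem generator_duality (ξ : DualConfig G σ) (η : Config G σ) :
    generator G σ θL θR (orthogonalDuality θL θR θ ξ) η =
      dualGenerator G σ (fun ζ => orthogonalDuality θL θR θ ζ η) ξ := by
  have hres : ∀ (x : Fin N) (a θj : ℝ),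
      reservoirGenerator x a θj (orthogonalDuality θL θR θ ξ) η =
        (θL - θ) ^ ξ.2.1 * reservoirGenerator x a θj
        (fun ζ => ∏ z, dOrthogonal σ (G.α z) θ (ξ.1.1 z) (ζ.1 z)) η * (θR - θ) ^ ξ.2.2 := by
    intro x a θj
    simp only [reservoirGenerator, orthogonalDuality]
    ring
  rw [generator, dualGenerator, bulk_duality, hres, hres, reservoir_duality, reservoir_duality]
  simp only [orthogonalDuality, pow_succ]
  ring

variable {θL θR θ}

/-- Polynomial growth of the duality functions. -/
theorem abs_orthogonalDuality_le (ξ : DualConfig G σ) :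
    ∃ C, 0 < C ∧ ∀ η : Config G σ, |orthogonalDuality θL θR θ ξ η| ≤ C * η.height ^ ξ.total := by
  choose C hC h using fun x => abs_dOrthogonal_le (σ := σ) (G.α_pos x) θ (ξ.1.1 x)
  have hP : 0 < ∏ x, C x := Finset.prod_pos fun x _ => hC x
  refine ⟨|(θL - θ) ^ ξ.2.1| * (∏ x, C x) * |(θR - θ) ^ ξ.2.2| + 1, by positivity, fun η => ?_⟩
  have h1 := η.one_le_height
  have h0 := zero_le_one.trans h1
  have h2 : |∏ x, dOrthogonal σ (G.α x) θ (ξ.1.1 x) (η.1 x)| ≤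
      (∏ x, C x) * η.height ^ ξ.total := by
    rw [Finset.abs_prod]
    calc _ ≤ ∏ x, C x * η.height ^ ξ.1.1 x := by
          refine Finset.prod_le_prod (fun _ _ => abs_nonneg _) fun x _ => (h x (η.1 x)).trans ?_
          have := hC x
          gcongr
          rw [Config.height]
          have : (η.1 x : ℝ) ≤ η.size := by exact_mod_cast η.apply_le_size x
          linarith
      _ = (∏ x, C x) * η.height ^ ξ.1.size := by
          rw [Finset.prod_mul_distrib, Finset.prod_pow_eq_pow_sum]; rfl
      _ ≤ _ := by
          gcongr
          rw [DualConfig.total_eq]; omega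
  rw [orthogonalDuality, abs_mul, abs_mul]
  calc _ ≤ |(θL - θ) ^ ξ.2.1| * ((∏ x, C x) * η.height ^ ξ.total) * |(θR - θ) ^ ξ.2.2| := by gcongr
    _ ≤ _ := by
      have : 0 ≤ η.height ^ ξ.total := by positivity
      nlinarith

/-! ### The dual semigroup -/

theorem dual_transitionProb_eq_zero {t : ℝ} (ht : 0 ≤ t) {ξ ξ' : DualConfig G σ}
    (h : ξ'.total ≠ ξ.total) : transitionProb (dualGenerator G σ) t ξ ξ' = 0 := by
  have hL := isJumpGenerator_dualGenerator (G := G) (σ := σ)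
  have h1 := isControl_dualGenerator_one (G := G) (σ := σ)
  set f : DualConfig G σ → ℝ := fun ζ => if ζ.total = ξ.total then 0 else 1
  have hf : ∀ ζ, |f ζ| ≤ 1 := fun ζ => by simp only [f]; split_ifs <;> simp
  have h2 := semigroup_of_harmonic hL h1 (dominated_one_of_abs_le hf)
    (fun ζ => dualGenerator_total (fun n => if n = ξ.total then 0 else 1) ζ) ht ξ
  have hsum := summable_semigroup hL h1 (dominated_one_of_abs_le hf) ht ξ
  have h3 : f ξ = 0 := by simp [f]
  rw [h3, semigroup] at h2
  have h4 := (hsum.hasSum_iff.2 h2)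
  rw [hasSum_zero_iff_of_nonneg] at h4
  · have h5 := congrFun h4 ξ'
    simp only [f, h, if_false, mul_one, Pi.zero_apply] at h5
    exact ((ENNReal.toReal_eq_zero_iff _).1 h5).resolve_right (transitionProb_ne_top hL h1 ht _ _)
  · intro ζ
    simp only [f]
    split_ifs <;> simp

theorem dual_semigroup_eq_sum {t : ℝ} (ht : 0 ≤ t) (f : DualConfig G σ → ℝ) (ξ : DualConfig G σ) :
    semigroup (dualGenerator G σ) t f ξ = ∑ ξ' ∈ sector G σ ξ.total,
      (transitionProb (dualGenerator G σ) t ξ ξ').toReal * f ξ' := by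
  rw [semigroup, tsum_eq_sum]
  intro ζ hζ
  rw [mem_sector] at hζ
  simp [dual_transitionProb_eq_zero ht hζ]

theorem dual_sum_transitionProb {t : ℝ} (ht : 0 ≤ t) (ξ : DualConfig G σ) :
    ∑ ξ' ∈ sector G σ ξ.total, transitionProb (dualGenerator G σ) t ξ ξ' = 1 := by
  rw [← tsum_transitionProb isJumpGenerator_dualGenerator isControl_dualGenerator_one ht ξ,
    tsum_eq_sum]
  intro ζ hζ
  rw [mem_sector] at hζ
  exact dual_transitionProb_eq_zero ht hζ

theorem dominated_of_bound {ψ : DualConfig G σ → ℝ} {f : DualConfig G σ → ℝ}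
    (h : ∀ ξ ξ' : DualConfig G σ, ξ.total = ξ'.total → |f ξ| ≤ ψ ξ') : Dominated ψ f :=
  ⟨1, one_pos, fun ξ => by rw [one_mul]; exact h ξ ξ rfl⟩

theorem dual_backward (f : DualConfig G σ → ℝ) :
    BackwardSolution (dualGenerator G σ) fun t => semigroup (dualGenerator G σ) t f := by
  obtain ⟨ψ, hψ, h⟩ := exists_isControl_dual f
  exact backwardSolution_semigroup isJumpGenerator_dualGenerator hψ (dominated_of_bound h)

/-- In the dual process every function is integrable, so that the Markov property holds for all
functions. -/
theorem dual_semigroup_add (f : DualConfig G σ → ℝ) {s t : ℝ} (hs : 0 ≤ s) (ht : 0 ≤ t)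
    (ξ : DualConfig G σ) : semigroup (dualGenerator G σ) (t + s) f ξ =
      semigroup (dualGenerator G σ) t (semigroup (dualGenerator G σ) s f) ξ := by
  obtain ⟨ψ, hψ, h⟩ := exists_isControl_dual f
  exact semigroup_add isJumpGenerator_dualGenerator hψ (dominated_of_bound h) hs ht ξ

theorem dual_abs_semigroup_le (f : DualConfig G σ → ℝ) {t : ℝ} (ht : 0 ≤ t) (ξ : DualConfig G σ) :
    |semigroup (dualGenerator G σ) t f ξ| ≤ ∑ ξ' ∈ sector G σ ξ.total, |f ξ'| := by
  rw [dual_semigroup_eq_sum ht]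
  refine (Finset.abs_sum_le_sum_abs _ _).trans (Finset.sum_le_sum fun ζ _ => ?_)
  rw [abs_mul, ENNReal.abs_toReal]
  refine mul_le_of_le_one_left (abs_nonneg _) (ENNReal.toReal_le_of_le_ofReal zero_le_one ?_)
  simpa using transitionProb_le_one isJumpGenerator_dualGenerator isControl_dualGenerator_one ht ξ ζ

theorem dual_generator_semigroup (f : DualConfig G σ → ℝ) {t : ℝ} (ht : 0 ≤ t)
    (ξ : DualConfig G σ) : semigroup (dualGenerator G σ) t (dualGenerator G σ f) ξ =
      dualGenerator G σ (semigroup (dualGenerator G σ) t f) ξ := by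
  have hL := isJumpGenerator_dualGenerator (G := G) (σ := σ)
  choose F a hF using hL.linear_form
  set b : DualConfig G σ → ℝ := fun ζ => ∑ ζ' ∈ F ζ, |a ζ ζ'| * ∑ ξ' ∈ sector G σ ζ'.total, |f ξ'|
  obtain ⟨ψ, hψ, h⟩ := exists_isControl_dual fun ζ => |f ζ| + b ζ
  have hb0 : ∀ ζ, 0 ≤ b ζ := fun ζ => Finset.sum_nonneg fun _ _ =>
    mul_nonneg (abs_nonneg _) (Finset.sum_nonneg fun _ _ => abs_nonneg _)
  have hle : ∀ ζ, |f ζ| + b ζ ≤ ψ ζ := fun ζ => (le_abs_self _).trans (h ζ ζ rfl)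
  refine generator_semigroup hL hψ ⟨1, one_pos, fun ζ => ?_⟩ (fun T => ⟨1, one_pos, ?_⟩) ht ξ
  · linarith [hb0 ζ, hle ζ]
  · intro s hs ζ
    dsimp only
    rw [hF, one_mul]
    refine (Finset.abs_sum_le_sum_abs _ _).trans
      (le_trans ?_ ((le_add_of_nonneg_left (abs_nonneg (f ζ))).trans (hle ζ)))
    refine Finset.sum_le_sum fun ζ' _ => ?_
    rw [abs_mul]
    gcongr
    exact dual_abs_semigroup_le f hs.1 ζ'

/-- Duality of the semigroups. -/
theorem semigroup_duality (hL : θL ∈ scaleRange σ) (hR : θR ∈ scaleRange σ) (ξ : DualConfig G σ)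
    (η : Config G σ) {t : ℝ} (ht : 0 ≤ t) :
    semigroup (generator G σ θL θR) t (orthogonalDuality θL θR θ ξ) η =
      semigroup (dualGenerator G σ) t (fun ζ => orthogonalDuality θL θR θ ζ η) ξ := by
  have hgen := isJumpGenerator_generator (G := G) hL hR
  set p : ℝ → DualConfig G σ → ℝ := fun t ζ => (transitionProb (dualGenerator G σ) t ξ ζ).toReal
  set v : ℝ → Config G σ → ℝ := fun t η =>
    semigroup (dualGenerator G σ) t (fun ζ => orthogonalDuality θL θR θ ζ η) ξ with hv
  have hvsum : ∀ t, 0 ≤ t → v t = fun η => ∑ ζ ∈ sector G σ ξ.total,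
      p t ζ * orthogonalDuality θL θR θ ζ η := fun t ht => by
    ext η; exact dual_semigroup_eq_sum ht _ ξ
  have hsol : BackwardSolution (generator G σ θL θR) v := by
    refine ⟨fun η => (dual_backward _).cont ξ, fun η t ht => ?_⟩
    refine ((dual_backward fun ζ => orthogonalDuality θL θR θ ζ η).deriv ξ t ht).congr_deriv ?_
    rw [← dual_generator_semigroup _ ht.le, dual_semigroup_eq_sum ht.le, hvsum t ht.le,
      hgen.map_sum]
    refine Finset.sum_congr rfl fun ζ _ => ?_
    rw [generator_duality]
  have hdom : LocallyDominated (fun η : Config G σ => η.height ^ ξ.total) v := by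
    intro T
    choose C hC h using fun ζ : DualConfig G σ =>
      abs_orthogonalDuality_le (θL := θL) (θR := θR) (θ := θ) ζ
    have hC0 : 0 ≤ ∑ ζ ∈ sector G σ ξ.total, C ζ := Finset.sum_nonneg fun ζ _ => (hC ζ).le
    refine ⟨∑ ζ ∈ sector G σ ξ.total, C ζ + 1, by positivity, fun t ht η => ?_⟩
    refine (dual_abs_semigroup_le _ ht.1 ξ).trans ?_
    have h0 : 0 ≤ η.height ^ ξ.total := pow_nonneg (zero_le_one.trans η.one_le_height) _
    calc _ ≤ ∑ ζ ∈ sector G σ ξ.total, C ζ * η.height ^ ξ.total := by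
          refine Finset.sum_le_sum fun ζ hζ => ?_
          rw [← mem_sector.1 hζ]
          exact h ζ η
      _ ≤ _ := by rw [← Finset.sum_mul]; nlinarith
  have h := semigroup_unique hgen (isControl_height hL hR ξ.total) hsol hdom ht η
  have h0 : v 0 = orthogonalDuality θL θR θ ξ := by
    ext η; exact semigroup_zero _ _ _
  rwa [h0] at h

end Duality


/-! ## The product measures -/

section Marginals

variable {σ : SignType} {θ : ℝ}

theorem marginal_nonneg (hθ : θ ∈ scaleRange σ) (a n : ℕ) : 0 ≤ marginal σ a θ n := by
  have h0 := scaleRange_nonneg hθ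
  have h1 := one_add_mul_nonneg hθ
  rcases σ with _ | _ | _
  · simp only [marginal]; positivity
  · simp only [SignType.neg_eq_neg_one, SignType.coe_neg_one] at h1
    have : 0 ≤ 1 - θ := by linarith
    simp only [marginal]; positivity
  · simp only [marginal]; positivity

theorem marginal_eq_zero (h : σ = -1) {a n : ℕ} (han : a < n) : marginal σ a θ n = 0 := by
  subst h
  change ((a.choose n : ℝ) * θ ^ n * (1 - θ) ^ (a - n)) = 0
  rw [Nat.choose_eq_zero_of_lt han]; simp

theorem hasSum_marginal (hθ : θ ∈ scaleRange σ) {a : ℕ} (ha : σ ≠ -1 → 0 < a) :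
    HasSum (marginal σ a θ) 1 := by
  have h0 := scaleRange_nonneg hθ
  rcases σ with _ | _ | _
  · have h := (NormedSpace.expSeries_div_hasSum_exp ((a * θ : ℝ))).mul_left
      (Real.exp (-(a * θ)))
    rw [← Real.exp_eq_exp_ℝ, ← Real.exp_add, neg_add_cancel, Real.exp_zero] at h
    refine h.congr_fun fun n => ?_
    simp only [marginal]; ring
  · have h : ∑ n ∈ Finset.range (a + 1), marginal SignType.neg a θ n = 1 := by
      have := add_pow θ (1 - θ) a
      rw [add_sub_cancel, one_pow] at this
      rw [this]
      refine Finset.sum_congr rfl fun n _ => ?_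
      simp only [marginal]; ring
    rw [← h]
    refine hasSum_sum_of_ne_finset_zero fun n hn => marginal_eq_zero rfl ?_
    simpa [Nat.lt_succ_iff] using hn
  · obtain ⟨b, rfl⟩ : ∃ b, a = b + 1 := ⟨a - 1, by have := ha (by decide); omega⟩
    have h1 : (0 : ℝ) < 1 + θ := by linarith
    have hr : ‖θ / (1 + θ)‖ < 1 := by
      rw [Real.norm_of_nonneg (by positivity), div_lt_one h1]; linarith
    have h := (hasSum_choose_mul_geometric_of_norm_lt_one b hr).mul_right ((1 / (1 + θ)) ^ (b + 1))
    have h2 : 1 - θ / (1 + θ) = 1 / (1 + θ) := by field_simp; ring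
    rw [h2, one_div_mul_cancel (by positivity)] at h
    refine h.congr_fun fun n => ?_
    simp only [marginal]
    rw [show b + 1 + n - 1 = b + n by omega, Nat.add_comm n b, Nat.choose_symm_add]

/-- The parameter of the size-biased marginal. -/
def shiftParam (σ : SignType) (a l : ℕ) : ℕ :=
  match σ with
  | .neg => a - l
  | .zero => a
  | .pos => a + l

theorem gammaRatio_mul_factorial (b l : ℕ) :
    gammaRatio ((b + 1 : ℕ) : ℝ) l * (b.factorial : ℝ) = ((b + l).factorial : ℝ) := by
  induction l with
  | zero => simp [gammaRatio]
  | succ l ih =>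
    rw [gammaRatio_succ, ← add_assoc, Nat.factorial_succ]
    push_cast at ih ⊢
    rw [← ih]; ring

theorem marginal_mul_falling (hθ : θ ∈ scaleRange σ) {a : ℕ} (ha : 0 < a) (n l : ℕ) :
    marginal σ a θ (n + l) * falling (n + l) l =
      θ ^ l * siteWeight σ a l * marginal σ (shiftParam σ a l) θ n := by
  have h0 := scaleRange_nonneg hθ
  have hfall : falling (n + l) l * (n.factorial : ℝ) = ((n + l).factorial : ℝ) := by
    have := Nat.factorial_mul_descFactorial (Nat.le_add_left l n)
    rw [Nat.add_sub_cancel] at this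
    rw [falling, ← this]; push_cast; ring
  have hn : (n.factorial : ℝ) ≠ 0 := by positivity
  rcases σ with _ | _ | _
  · simp only [marginal, siteWeight, shiftParam]
    rw [← hfall]
    have hf : falling (n + l) l ≠ 0 := falling_ne_zero (Nat.le_add_left _ _)
    field_simp
    ring
  · simp only [marginal, siteWeight, shiftParam]
    have h1 : (a.choose (n + l) : ℝ) * falling (n + l) l = falling a l * ((a - l).choose n) := by
      have := Nat.choose_mul (n := a) (Nat.le_add_left l n)
      rw [Nat.add_sub_cancel] at this
      rw [falling, falling, Nat.descFactorial_eq_factorial_mul_choose,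
        Nat.descFactorial_eq_factorial_mul_choose]
      have h2 : (a.choose (n + l) : ℝ) * (n + l).choose l = a.choose l * (a - l).choose n := by
        exact_mod_cast this
      push_cast
      linear_combination (l.factorial : ℝ) * h2
    rw [show a - (n + l) = a - l - n by omega, pow_add]
    linear_combination (θ ^ n * θ ^ l * (1 - θ) ^ (a - l - n)) * h1
  · obtain ⟨b, rfl⟩ : ∃ b, a = b + 1 := ⟨a - 1, by omega⟩
    simp only [marginal, siteWeight, shiftParam]
    have h1 : (((b + (n + l)).choose (n + l) : ℕ) : ℝ) * b.factorial * (n + l).factorial =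
        (b + (n + l)).factorial := by
      exact_mod_cast Nat.add_choose_mul_factorial_mul_factorial b (n + l)
    have h2 : (((b + l + n).choose n : ℕ) : ℝ) * (b + l).factorial * n.factorial =
        (b + l + n).factorial := by
      exact_mod_cast Nat.add_choose_mul_factorial_mul_factorial (b + l) n
    have h3 := gammaRatio_mul_factorial b l
    have h4 : (((b + (n + l)).choose (n + l) : ℕ) : ℝ) * falling (n + l) l =
        gammaRatio ((b + 1 : ℕ) : ℝ) l * ((b + l + n).choose n : ℕ) := by
      have hb : (b.factorial : ℝ) ≠ 0 := by positivity
      rw [← hfall] at h1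
      rw [← h3, show b + l + n = b + (n + l) by ring, ← h1] at h2
      refine mul_right_cancel₀ (mul_ne_zero hb hn) ?_
      rw [show b + l + n = b + (n + l) by ring]
      linear_combination -h2
    rw [show b + 1 + (n + l) - 1 = b + (n + l) by omega,
      show b + 1 + l + n - 1 = b + l + n by omega, pow_add _ n l, pow_add _ (b + 1) l,
      div_pow _ _ l, one_div_pow (1 + θ) l]
    have h1θ : (1 + θ) ≠ 0 := by positivity
    linear_combination ((θ / (1 + θ)) ^ n * (θ ^ l / (1 + θ) ^ l) * (1 / (1 + θ)) ^ (b + 1)) * h4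

/-- The factorial moments of the marginals. -/
theorem hasSum_marginal_mul_falling (hθ : θ ∈ scaleRange σ) {a : ℕ} (ha : 0 < a) (l : ℕ) :
    HasSum (fun n => marginal σ a θ n * falling n l) (θ ^ l * siteWeight σ a l) := by
  have h := (hasSum_marginal hθ (a := shiftParam σ a l) ?_).mul_left (θ ^ l * siteWeight σ a l)
  · simp_rw [← marginal_mul_falling hθ ha, mul_one] at h
    rw [hasSum_nat_add_iff (f := fun n => marginal σ a θ n * falling n l) l,
      Finset.sum_eq_zero, add_zero] at h
    · exact h
    · intro n hn
      rw [falling, Nat.descFactorial_eq_zero_iff_lt.2 (Finset.mem_range.1 hn)]; simp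
  · intro hσ
    rcases σ with _ | _ | _
    · exact ha
    · exact absurd rfl hσ
    · exact Nat.add_pos_left ha l

theorem hasSum_marginal_mul_dOrthogonal (hθ : θ ∈ scaleRange σ) {a : ℕ} (ha : 0 < a) {k : ℕ}
    (hk : σ = -1 → k ≤ a) :
    HasSum (fun n => marginal σ a θ n * dOrthogonal σ a θ k n) (if k = 0 then 1 else 0) := by
  have h : ∀ l ∈ Finset.range (k + 1), HasSum (fun n => (k.choose l : ℝ) * (-θ) ^ (k - l) *
      (1 / siteWeight σ a l) * (marginal σ a θ n * falling n l))
      ((k.choose l : ℝ) * (-θ) ^ (k - l) * θ ^ l) := by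
    intro l hl
    have hw : siteWeight σ a l ≠ 0 := siteWeight_ne_zero ha fun h =>
      (Nat.lt_succ_iff.1 (Finset.mem_range.1 hl)).trans (hk h)
    have h1 := (hasSum_marginal_mul_falling hθ ha l).mul_left
      ((k.choose l : ℝ) * (-θ) ^ (k - l) * (1 / siteWeight σ a l))
    have e : (k.choose l : ℝ) * (-θ) ^ (k - l) * (1 / siteWeight σ a l) *
        (θ ^ l * siteWeight σ a l) =
        (k.choose l : ℝ) * (-θ) ^ (k - l) * θ ^ l := by field_simp
    rwa [e] at h1
  have hs := hasSum_sum h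
  have hval : ∑ l ∈ Finset.range (k + 1), (k.choose l : ℝ) * (-θ) ^ (k - l) * θ ^ l =
      if k = 0 then 1 else 0 := by
    have := add_pow θ (-θ) k
    rw [add_neg_cancel, zero_pow_eq] at this
    rw [this]
    exact Finset.sum_congr rfl fun _ _ => by ring
  rw [hval] at hs
  refine hs.congr_fun fun n => ?_
  rw [dOrthogonal_eq ha, binomialShift, Finset.mul_sum]
  refine Finset.sum_congr rfl fun l _ => ?_
  rw [dClassical]
  ring

theorem one_add_pow_le (n k : ℕ) :
    (1 + (n : ℝ)) ^ k ≤ 2 ^ k * falling n k + (2 * k + 1) ^ k := by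
  have h0 : 0 ≤ falling n k := by rw [falling]; positivity
  rcases le_or_gt n (2 * k) with h | h
  · have : (n : ℝ) ≤ 2 * k := by exact_mod_cast h
    calc (1 + (n : ℝ)) ^ k ≤ (2 * k + 1) ^ k :=
          pow_le_pow_left₀ (by positivity) (by linarith) k
      _ ≤ _ := le_add_of_nonneg_left (by positivity)
  · have h1 : ((n + 1 - k : ℕ) : ℝ) ^ k ≤ falling n k := by
      rw [falling]; exact_mod_cast Nat.pow_sub_le_descFactorial n k
    have h2 : (1 + (n : ℝ)) ≤ 2 * ((n + 1 - k : ℕ) : ℝ) := by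
      have : 1 + n ≤ 2 * (n + 1 - k) := by omega
      exact_mod_cast this
    calc (1 + (n : ℝ)) ^ k ≤ (2 * ((n + 1 - k : ℕ) : ℝ)) ^ k := by gcongr
      _ ≤ 2 ^ k * falling n k := by rw [mul_pow]; gcongr
      _ ≤ _ := le_add_of_nonneg_right (by positivity)

theorem summable_marginal_mul_pow (hθ : θ ∈ scaleRange σ) {a : ℕ} (ha : 0 < a) (k : ℕ) :
    Summable fun n : ℕ => marginal σ a θ n * (1 + n) ^ k := by
  have h1 := (hasSum_marginal_mul_falling hθ ha k).summable.mul_left (2 ^ k)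
  have h2 := (hasSum_marginal hθ fun _ => ha).summable.mul_right ((2 * (k : ℝ) + 1) ^ k)
  refine Summable.of_nonneg_of_le (fun n => mul_nonneg (marginal_nonneg hθ a n) (by positivity))
    (fun n => ?_) (h1.add h2)
  have := mul_le_mul_of_nonneg_left (one_add_pow_le n k) (marginal_nonneg hθ a n)
  linarith

end Marginals

section ProductMeasure

theorem hasSum_mul_prod {α β : Type*} {f : α → ℝ} {g : β → ℝ} {a b : ℝ} (hf : HasSum f a)
    (hg : HasSum g b) : HasSum (fun p : α × β => f p.1 * g p.2) (a * b) :=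
  hf.mul hg (summable_mul_of_summable_norm hf.summable.norm hg.summable.norm)

theorem hasSum_pi_prod {N : ℕ} {g : Fin N → ℕ → ℝ} {s : Fin N → ℝ} (h : ∀ x, HasSum (g x) (s x)) :
    HasSum (fun η : Fin N → ℕ => ∏ x, g x (η x)) (∏ x, s x) := by
  induction N with
  | zero =>
    simp only [Finset.univ_eq_empty, Finset.prod_empty]
    exact hasSum_unique _
  | succ N ih =>
    have h1 := ih fun x => h x.succ
    have h2 := hasSum_mul_prod (h 0) h1
    let e : ℕ × (Fin N → ℕ) ≃ (Fin (N + 1) → ℕ) :=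
      { toFun := fun p => Fin.cons (α := fun _ => ℕ) p.1 p.2
        invFun := fun η => (η 0, fun x => η x.succ)
        left_inv := fun p => by simp
        right_inv := fun η => Fin.cons_self_tail η }
    rw [Fin.prod_univ_succ, ← e.hasSum_iff]
    have he : ((fun η : Fin (N + 1) → ℕ => ∏ x, g x (η x)) ∘ e) =
        fun p : ℕ × (Fin N → ℕ) => g 0 p.1 * ∏ x : Fin N, g x.succ (p.2 x) := by
      ext p
      rw [Function.comp_apply, Fin.prod_univ_succ]
      rfl
    rw [he]
    exact h2

theorem one_add_sum_le_prod {ι : Type*} (s : Finset ι) {f : ι → ℝ} (hf : ∀ i, 0 ≤ f i) :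
    1 + ∑ i ∈ s, f i ≤ ∏ i ∈ s, (1 + f i) := by
  classical
  induction s using Finset.induction_on with
  | empty => simp
  | insert a s ha ih =>
    rw [Finset.sum_insert ha, Finset.prod_insert ha]
    have := Finset.sum_nonneg fun i (_ : i ∈ s) => hf i
    nlinarith [hf a, mul_nonneg (hf a) this, mul_le_mul_of_nonneg_left ih (hf a)]

variable {N : ℕ} {G : Geometry N} {σ : SignType} {θL θR θ b : ℝ}

theorem hasSum_config_prod {g : Fin N → ℕ → ℝ} {s : Fin N → ℝ} (h : ∀ x, HasSum (g x) (s x))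
    (h0 : σ = -1 → ∀ x n, G.α x < n → g x n = 0) :
    HasSum (fun η : Config G σ => ∏ x, g x (η.1 x)) (∏ x, s x) := by
  refine (hasSum_subtype_iff_of_support_subset
    (s := {η : Fin N → ℕ | σ = -1 → ∀ x, η x ≤ G.α x}) ?_).2 (hasSum_pi_prod h)
  intro η hη hσ x
  by_contra! hx
  exact hη (Finset.prod_eq_zero (Finset.mem_univ x) (h0 hσ x _ hx))

theorem productMeasure_toReal (hθ : θ ∈ scaleRange σ) (η : Config G σ) :
    (productMeasure G σ θ η).toReal = ∏ x, marginal σ (G.α x) θ (η.1 x) :=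
  ENNReal.toReal_ofReal (Finset.prod_nonneg fun _ _ => marginal_nonneg hθ _ _)

theorem tsum_productMeasure (hθ : θ ∈ scaleRange σ) :
    ∑' η : Config G σ, productMeasure G σ θ η = 1 := by
  have h := hasSum_config_prod (G := G) (σ := σ)
    (fun x => hasSum_marginal hθ fun _ => G.α_pos x) fun hσ x n hn => marginal_eq_zero hσ hn
  simp only [Finset.prod_const_one] at h
  simp_rw [productMeasure]
  rw [← ENNReal.ofReal_tsum_of_nonneg
    (fun η => Finset.prod_nonneg fun _ _ => marginal_nonneg hθ _ _) h.summable, h.tsum_eq]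
  simp

theorem summable_productMeasure_mul_height (hθ : θ ∈ scaleRange σ) (k : ℕ) :
    Summable fun η : Config G σ => (productMeasure G σ θ η).toReal * η.height ^ k := by
  have h := (hasSum_config_prod (G := G) (σ := σ)
    (fun x => (summable_marginal_mul_pow hθ (G.α_pos x) k).hasSum)
    fun hσ x n hn => by rw [marginal_eq_zero hσ hn, zero_mul]).summable
  refine Summable.of_nonneg_of_le (fun η => mul_nonneg ENNReal.toReal_nonneg
    (pow_nonneg (zero_le_one.trans η.one_le_height) k)) (fun η => ?_) h
  rw [productMeasure_toReal hθ, Finset.prod_mul_distrib, Finset.prod_pow]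
  have h1 : 0 ≤ ∏ x, marginal σ (G.α x) θ (η.1 x) :=
    Finset.prod_nonneg fun _ _ => marginal_nonneg hθ _ _
  have h2 := zero_le_one.trans η.one_le_height
  gcongr
  rw [Config.height, Config.size]
  push_cast
  exact one_add_sum_le_prod _ fun _ => Nat.cast_nonneg _

/-- The weight `(1-b)^ξ(L) (-b)^ξ(R)` of an absorbed dual configuration. -/
def absorbedWeight (b : ℝ) (ξ : DualConfig G σ) : ℝ :=
  if ξ.1.size = 0 then (1 - b) ^ ξ.2.1 * (-b) ^ ξ.2.2 else 0

theorem hasSum_productMeasure_orthogonalDuality (hθ : θ ∈ scaleRange σ)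
    (hb : θ = θR + b * (θL - θR)) (ξ : DualConfig G σ) :
    HasSum (fun η => (productMeasure G σ θ η).toReal * orthogonalDuality θL θR θ ξ η)
      ((θL - θR) ^ ξ.total * absorbedWeight b ξ) := by
  have h := ((hasSum_config_prod (G := G) (σ := σ)
    (fun x => hasSum_marginal_mul_dOrthogonal hθ (G.α_pos x) fun hσ => ξ.1.2 hσ x)
    fun hσ x n hn => by rw [marginal_eq_zero hσ hn, zero_mul]).mul_left
      ((θL - θ) ^ ξ.2.1 * (θR - θ) ^ ξ.2.2))
  have hval : (θL - θ) ^ ξ.2.1 * (θR - θ) ^ ξ.2.2 * ∏ x, (if ξ.1.1 x = 0 then (1 : ℝ) else 0) =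
      (θL - θR) ^ ξ.total * absorbedWeight b ξ := by
    rw [absorbedWeight]
    split_ifs with h0
    · have h1 : ∀ x, ξ.1.1 x = 0 := fun x => by
        have := ξ.1.apply_le_size x; omega
      rw [DualConfig.total_eq, h0, show θL - θ = (θL - θR) * (1 - b) by rw [hb]; ring,
        show θR - θ = (θL - θR) * (-b) by rw [hb]; ring]
      simp only [h1, if_true, Finset.prod_const_one]
      rw [mul_pow, mul_pow, pow_add, pow_add]
      ring
    · obtain ⟨x, hx⟩ : ∃ x, ξ.1.1 x ≠ 0 := by
        by_contra! h
        exact h0 (Finset.sum_eq_zero fun x _ => h x)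
      rw [Finset.prod_eq_zero (Finset.mem_univ x) (by simp [hx])]
      simp
  rw [hval] at h
  refine h.congr_fun fun η => ?_
  rw [productMeasure_toReal hθ, orthogonalDuality, Finset.prod_mul_distrib]
  ring

theorem phi_integrand_zero (ξ : DualConfig G σ) :
    (if ξ.2.1 = ξ.total then (1 : ℝ) else 0) = absorbedWeight 0 ξ := by
  rw [absorbedWeight, DualConfig.total_eq]
  by_cases h0 : ξ.1.size = 0
  · by_cases h1 : ξ.2.2 = 0
    · simp [h0, h1]
    · simp [h0, h1]
  · rw [if_neg h0, if_neg (by omega)]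

theorem phi_integrand (hb : b ≠ 0) (ξ : DualConfig G σ) :
    (-b) ^ ξ.total * (((b - 1) / b) ^ ξ.2.1 * (if ξ.2.1 + ξ.2.2 = ξ.total then 1 else 0)) =
      absorbedWeight b ξ := by
  rw [absorbedWeight, DualConfig.total_eq]
  by_cases h0 : ξ.1.size = 0
  · rw [h0, add_zero, if_pos rfl, if_pos rfl, mul_one, pow_add, mul_right_comm, ← mul_pow]
    congr 2
    field_simp
    ring
  · rw [if_neg h0, if_neg (by omega)]
    simp

theorem phiTime_eq {t : ℝ} (ht : 0 ≤ t) (ξ : DualConfig G σ) :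
    phiTime G σ t b ξ = ∑ ξ' ∈ sector G σ ξ.total,
      (transitionProb (dualGenerator G σ) t ξ ξ').toReal * absorbedWeight b ξ' := by
  rw [phiTime]
  split_ifs with hb
  · subst hb
    refine (dual_semigroup_eq_sum ht (fun ξ' => if ξ'.2.1 = ξ.total then 1 else 0) ξ).trans ?_
    refine Finset.sum_congr rfl fun ξ' hξ' => ?_
    rw [← phi_integrand_zero, mem_sector.1 hξ']
  · rw [← semigroup.eq_def (dualGenerator G σ) t (fun ξ' => ((b - 1) / b) ^ ξ'.2.1 *
      (if ξ'.2.1 + ξ'.2.2 = ξ.total then 1 else 0)) ξ, dual_semigroup_eq_sum ht, Finset.mul_sum]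
    refine Finset.sum_congr rfl fun ξ' hξ' => ?_
    rw [← phi_integrand hb, mem_sector.1 hξ']
    ring

/-- If the duality functions are integrable for the initial law, their expectations at time `t` are
expectations of the dual process. -/
theorem hasExpectation_duality (hL : θL ∈ scaleRange σ) (hR : θR ∈ scaleRange σ)
    {μ : Config G σ → ℝ≥0∞} (hμ : ∑' η, μ η ≠ ⊤)
    (hmom : ∀ k : ℕ, Summable fun η => (μ η).toReal * η.height ^ k)
    {m : DualConfig G σ → ℝ}
    (hm : ∀ ξ, HasSum (fun η => (μ η).toReal * orthogonalDuality θL θR θ ξ η) (m ξ))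
    {t : ℝ} (ht : 0 ≤ t) (ξ : DualConfig G σ) :
    HasExpectation (lawAt (generator G σ θL θR) μ t) (orthogonalDuality θL θR θ ξ)
      (∑ ξ' ∈ sector G σ ξ.total,
        (transitionProb (dualGenerator G σ) t ξ ξ').toReal * m ξ') := by
  have h := hasExpectation_lawAt (isJumpGenerator_generator hL hR) (isControl_generator_one hL hR)
    (isControl_height hL hR ξ.total) (abs_orthogonalDuality_le (θL := θL) (θR := θR) (θ := θ) ξ)
    hμ (hmom ξ.total) ht
  convert h using 1
  symm
  have h1 : HasSum (fun η => ∑ ξ' ∈ sector G σ ξ.total,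
      (transitionProb (dualGenerator G σ) t ξ ξ').toReal *
        ((μ η).toReal * orthogonalDuality θL θR θ ξ' η)) (∑ ξ' ∈ sector G σ ξ.total,
        (transitionProb (dualGenerator G σ) t ξ ξ').toReal * m ξ') :=
    hasSum_sum fun ξ' _ => (hm ξ').mul_left _
  rw [← h1.tsum_eq]
  refine tsum_congr fun η => ?_
  rw [semigroup_duality hL hR ξ η ht, dual_semigroup_eq_sum ht, Finset.mul_sum]
  exact Finset.sum_congr rfl fun _ _ => by ring

theorem hasExpectation_productMeasure (hL : θL ∈ scaleRange σ) (hR : θR ∈ scaleRange σ)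
    (hb : θ = θR + b * (θL - θR)) (hθ : θ ∈ scaleRange σ) {t : ℝ} (ht : 0 ≤ t)
    (ξ : DualConfig G σ) :
    HasExpectation (lawAt (generator G σ θL θR) (productMeasure G σ θ) t)
      (orthogonalDuality θL θR θ ξ) ((θL - θR) ^ ξ.total * phiTime G σ t b ξ) := by
  have h := hasExpectation_duality (G := G) hL hR (by simp [tsum_productMeasure hθ])
    (summable_productMeasure_mul_height hθ)
    (hasSum_productMeasure_orthogonalDuality (θL := θL) (θR := θR) hθ hb) ht ξ
  convert h using 1
  rw [phiTime_eq ht, Finset.mul_sum]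
  refine Finset.sum_congr rfl fun ξ' hξ' => ?_
  rw [mem_sector.1 hξ']
  ring

end ProductMeasure


/-! ## Reachability -/

section Reachability

variable {N : ℕ} {G : Geometry N} {σ : SignType}

/-- A jump from `x` to `z` has positive rate. -/
def Jumps {S : Type*} [DecidableEq S] (L : (S → ℝ) → S → ℝ) (x z : S) : Prop :=
  x ≠ z ∧ 0 < rateMatrix L x z

theorem Jumps.of_le {S : Type*} [DecidableEq S] {L : (S → ℝ) → S → ℝ} {x z : S}
    (hne : x ≠ z) {r : ℝ}
    (hr : 0 < r) (h : ∀ f : S → ℝ, (∀ y, 0 ≤ f y) → f x = 0 → r * f z ≤ L f x) : Jumps L x z := by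
  refine ⟨hne, ?_⟩
  have := h (Pi.single z 1) (fun y => by rw [Pi.single_apply]; split_ifs <;> simp) (by simp [hne])
  rw [Pi.single_eq_same, mul_one] at this
  exact hr.trans_le this

theorem bulkGenerator_nonneg {f : Config G σ → ℝ} (hf : ∀ ζ, 0 ≤ f ζ) {η : Config G σ}
    (h0 : f η = 0) : 0 ≤ bulkGenerator f η := by
  rw [bulkGenerator_eq_sum]
  refine Finset.sum_nonneg fun x _ => Finset.sum_nonneg fun y _ => ?_
  rw [h0, sub_zero]
  exact mul_nonneg (G.ω_nonneg x y) (mul_nonneg (mul_nonneg (Nat.cast_nonneg _)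
    (site_rate_nonneg η y)) (hf _))

theorem le_bulkGenerator {f : Config G σ → ℝ} (hf : ∀ ζ, 0 ≤ f ζ) {η : Config G σ}
    (h0 : f η = 0) (x y : Fin N) :
    G.ω x y * ((η.1 x : ℝ) * ((G.α y : ℝ) + (σ : ℝ) * η.1 y)) * f (η.hop x y) ≤
      bulkGenerator f η := by
  rw [bulkGenerator_eq_sum]
  have hnn : ∀ x y, 0 ≤ G.ω x y * (((η.1 x : ℝ) * ((G.α y : ℝ) + (σ : ℝ) * η.1 y)) *
      (f (η.hop x y) - f η)) := fun x y => by
    rw [h0, sub_zero]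
    exact mul_nonneg (G.ω_nonneg x y) (mul_nonneg (mul_nonneg (Nat.cast_nonneg _)
      (site_rate_nonneg η y)) (hf _))
  refine le_trans ?_ (Finset.single_le_sum (fun x _ => Finset.sum_nonneg fun y _ => hnn x y)
    (Finset.mem_univ x))
  refine le_trans (le_of_eq ?_) (Finset.single_le_sum (fun y _ => hnn x y) (Finset.mem_univ y))
  rw [h0]; ring

theorem le_reservoirGenerator {a θ : ℝ} (ha : 0 < a) (h : θ ∈ scaleRange σ) {f : Config G σ → ℝ}
    (hf : ∀ ζ, 0 ≤ f ζ) {η : Config G σ} (h0 : f η = 0) (x : Fin N) :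
    (η.1 x : ℝ) * (a + (σ : ℝ) * a * θ) * f (η.remove x) ≤ reservoirGenerator x a θ f η ∧
      a * θ * ((G.α x : ℝ) + (σ : ℝ) * η.1 x) * f (η.add x) ≤ reservoirGenerator x a θ f η ∧
      0 ≤ reservoirGenerator x a θ f η := by
  have h1 := mul_nonneg (remove_rate_nonneg ha h η x) (hf (η.remove x))
  have h2 := mul_nonneg (add_rate_nonneg ha h η x) (hf (η.add x))
  rw [reservoirGenerator, h0, sub_zero, sub_zero]
  exact ⟨by linarith, by linarith, by linarith⟩

/-- A hop with positive rate. -/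
def BulkStep (η η' : Config G σ) : Prop :=
  ∃ x y, x ≠ y ∧ 0 < G.ω x y ∧ 0 < (η.1 x : ℝ) * ((G.α y : ℝ) + (σ : ℝ) * η.1 y) ∧ η' = η.hop x y

theorem BulkStep.ne {η η' : Config G σ} (h : BulkStep η η') : η ≠ η' := by
  obtain ⟨x, y, hxy, -, hr, rfl⟩ := h
  intro he
  have := congrFun (congrArg Subtype.val he) y
  rw [η.hop_coe hr.ne'] at this
  simp [hxy.symm] at this

theorem BulkStep.size_eq {η η' : Config G σ} (h : BulkStep η η') : η'.size = η.size := by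
  obtain ⟨x, y, hxy, -, hr, rfl⟩ := h
  exact η.size_hop hr.ne'

theorem size_eq_of_reflTransGen {η η' : Config G σ} (h : Relation.ReflTransGen BulkStep η η') :
    η'.size = η.size := by
  induction h with
  | refl => rfl
  | tail _ h ih => rw [h.size_eq, ih]

theorem conductance_pos {x y : Fin N} (h : (SimpleGraph.fromRel fun x y => G.ω x y ≠ 0).Adj x y) :
    x ≠ y ∧ 0 < G.ω x y := by
  rw [SimpleGraph.fromRel_adj] at h
  refine ⟨h.1, lt_of_le_of_ne (G.ω_nonneg x y) (Ne.symm ?_)⟩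
  rcases h.2 with h | h
  · exact h
  · rwa [G.ω_symm]

/-- Particles can be moved to any site. -/
theorem exists_path_particle {x s : Fin N}
    (p : (SimpleGraph.fromRel fun x y => G.ω x y ≠ 0).Walk x s) (η : Config G σ) (hx : 0 < η.1 x) :
    ∃ η', Relation.ReflTransGen BulkStep η η' ∧ 0 < η'.1 s := by
  induction p generalizing η with
  | nil => exact ⟨η, .refl, hx⟩
  | @cons x y s hadj p ih =>
    obtain ⟨hxy, hω⟩ := conductance_pos hadj
    by_cases hy : 0 < η.1 y
    · exact ih η hy
    · have hy0 : η.1 y = 0 := by omega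
      have hr : 0 < (η.1 x : ℝ) * ((G.α y : ℝ) + (σ : ℝ) * η.1 y) := by
        rw [hy0, Nat.cast_zero, mul_zero, add_zero]
        exact mul_pos (by exact_mod_cast hx) (by exact_mod_cast G.α_pos y)
      obtain ⟨η', h1, h2⟩ := ih (η.hop x y) (by rw [η.hop_coe hr.ne']; simp)
      exact ⟨η', .head ⟨x, y, hxy, hω, hr, rfl⟩ h1, h2⟩

/-- In the exclusion process, holes can be moved to any site. -/
theorem exists_path_hole (hσ : σ = -1) {x s : Fin N}
    (p : (SimpleGraph.fromRel fun x y => G.ω x y ≠ 0).Walk x s) (η : Config G σ)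
    (hx : η.1 x < G.α x) :
    ∃ η', Relation.ReflTransGen BulkStep η η' ∧ η'.1 s < G.α s := by
  induction p generalizing η with
  | nil => exact ⟨η, .refl, hx⟩
  | @cons x y s hadj p ih =>
    obtain ⟨hxy, hω⟩ := conductance_pos hadj
    by_cases hy : η.1 y < G.α y
    · exact ih η hy
    · have hy0 : η.1 y = G.α y := le_antisymm (η.2 hσ y) (not_lt.1 hy)
      have hr : 0 < (η.1 y : ℝ) * ((G.α x : ℝ) + (σ : ℝ) * η.1 x) := by
        rw [hy0]
        refine mul_pos (by exact_mod_cast G.α_pos y) ?_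
        have : (η.1 x : ℝ) < G.α x := by exact_mod_cast hx
        subst hσ
        rw [SignType.coe_neg_one]; linarith
      obtain ⟨η', h1, h2⟩ := ih (η.hop y x) (by
        have := G.α_pos y
        rw [η.hop_coe hr.ne', hy0.symm]
        simp [hxy.symm]
        omega)
      exact ⟨η', .head ⟨y, x, hxy.symm, by rwa [G.ω_symm], hr, rfl⟩ h1, h2⟩

theorem nonempty_walk (G : Geometry N) (x y : Fin N) :
    Nonempty ((SimpleGraph.fromRel fun x y => G.ω x y ≠ 0).Walk x y) :=
  G.connected.preconnected x y

theorem exists_pos_of_size_ne_zero {η : Config G σ} (h : η.size ≠ 0) : ∃ x, 0 < η.1 x := by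
  by_contra! h'
  exact h (Finset.sum_eq_zero fun x _ => Nat.le_zero.1 (h' x))

theorem BulkStep.jumps_dual {η η' : Config G σ} (h : BulkStep η η') (c : ℕ × ℕ) :
    Jumps (dualGenerator G σ) (η, c) (η', c) := by
  have hne := h.ne
  obtain ⟨x, y, hxy, hω, hr, rfl⟩ := h
  refine Jumps.of_le (fun h => hne (congrArg Prod.fst h)) (mul_pos hω hr) fun f hf h0 => ?_
  have hb := le_bulkGenerator (f := fun ζ => f (ζ, c)) (fun _ => hf _) h0 x y
  have hl : 0 ≤ G.ωL * G.αL * η.1 G.first * f (η.remove G.first, (c.1 + 1, c.2)) :=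
    mul_nonneg (mul_nonneg (mul_nonneg G.ωL_nonneg G.αL_pos.le) (Nat.cast_nonneg _)) (hf _)
  have hr : 0 ≤ G.ωR * G.αR * η.1 G.last * f (η.remove G.last, (c.1, c.2 + 1)) :=
    mul_nonneg (mul_nonneg (mul_nonneg G.ωR_nonneg G.αR_pos.le) (Nat.cast_nonneg _)) (hf _)
  rw [dualGenerator, h0, sub_zero, sub_zero]
  linarith

theorem BulkStep.jumps {θL θR : ℝ} (hL : θL ∈ scaleRange σ) (hR : θR ∈ scaleRange σ)
    {η η' : Config G σ} (h : BulkStep η η') : Jumps (generator G σ θL θR) η η' := by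
  have hne := h.ne
  obtain ⟨x, y, hxy, hω, hr, rfl⟩ := h
  refine Jumps.of_le hne (mul_pos hω hr) fun f hf h0 => ?_
  have hb := le_bulkGenerator hf h0 x y
  have hl := mul_nonneg G.ωL_nonneg (le_reservoirGenerator G.αL_pos hL hf h0 G.first).2.2
  have hr := mul_nonneg G.ωR_nonneg (le_reservoirGenerator G.αR_pos hR hf h0 G.last).2.2
  rw [generator]
  linarith

theorem Config.remove_ne (η : Config G σ) {x : Fin N} (hx : 0 < η.1 x) : η ≠ η.remove x := by
  intro h
  have := η.size_remove hx.ne'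
  rw [← h] at this
  omega

theorem Config.add_ne (η : Config G σ) {x : Fin N} (h : (G.α x : ℝ) + (σ : ℝ) * η.1 x ≠ 0) :
    η ≠ η.add x := by
  intro h'
  have := η.size_add h
  rw [← h'] at this
  omega

/-- One of the reservoirs is connected to the bulk. -/
theorem exists_reservoir {θL θR : ℝ} (hL : θL ∈ scaleRange σ) (hR : θR ∈ scaleRange σ)
    (hω : 0 < max G.ωL G.ωR) : ∃ (s : Fin N) (θ r : ℝ), θ ∈ scaleRange σ ∧ 0 < r ∧
      (∀ η : Config G σ, ∀ f : Config G σ → ℝ, (∀ ζ, 0 ≤ f ζ) → f η = 0 →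
        r * ((η.1 s : ℝ) * (1 + (σ : ℝ) * θ)) * f (η.remove s) ≤ generator G σ θL θR f η ∧
        r * (θ * ((G.α s : ℝ) + (σ : ℝ) * η.1 s)) * f (η.add s) ≤ generator G σ θL θR f η) ∧
      (∀ ξ : DualConfig G σ, 0 < ξ.1.1 s → ∃ ξ' : DualConfig G σ,
        Jumps (dualGenerator G σ) ξ ξ' ∧ ξ'.1.size + 1 = ξ.1.size) := by
  have hdual : ∀ (ξ : DualConfig G σ) (f : DualConfig G σ → ℝ), (∀ ζ, 0 ≤ f ζ) → f ξ = 0 →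
      G.ωL * G.αL * ξ.1.1 G.first * f (ξ.1.remove G.first, (ξ.2.1 + 1, ξ.2.2)) ≤
        dualGenerator G σ f ξ ∧
      G.ωR * G.αR * ξ.1.1 G.last * f (ξ.1.remove G.last, (ξ.2.1, ξ.2.2 + 1)) ≤
        dualGenerator G σ f ξ := by
    intro ξ f hf h0
    have hb := bulkGenerator_nonneg (f := fun ζ => f (ζ, ξ.2)) (fun _ => hf _) h0
    have hl : 0 ≤ G.ωL * G.αL * ξ.1.1 G.first * f (ξ.1.remove G.first, (ξ.2.1 + 1, ξ.2.2)) :=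
      mul_nonneg (mul_nonneg (mul_nonneg G.ωL_nonneg G.αL_pos.le) (Nat.cast_nonneg _)) (hf _)
    have hr : 0 ≤ G.ωR * G.αR * ξ.1.1 G.last * f (ξ.1.remove G.last, (ξ.2.1, ξ.2.2 + 1)) :=
      mul_nonneg (mul_nonneg (mul_nonneg G.ωR_nonneg G.αR_pos.le) (Nat.cast_nonneg _)) (hf _)
    rw [dualGenerator, h0, sub_zero, sub_zero]
    exact ⟨by linarith, by linarith⟩
  have hgen : ∀ (η : Config G σ) (f : Config G σ → ℝ), (∀ ζ, 0 ≤ f ζ) → f η = 0 →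
      G.ωL * reservoirGenerator G.first G.αL θL f η ≤ generator G σ θL θR f η ∧
      G.ωR * reservoirGenerator G.last G.αR θR f η ≤ generator G σ θL θR f η := by
    intro η f hf h0
    have hb := bulkGenerator_nonneg hf h0
    have hl := mul_nonneg G.ωL_nonneg (le_reservoirGenerator G.αL_pos hL hf h0 G.first).2.2
    have hr := mul_nonneg G.ωR_nonneg (le_reservoirGenerator G.αR_pos hR hf h0 G.last).2.2
    rw [generator]
    exact ⟨by linarith, by linarith⟩
  rcases lt_max_iff.1 hω with hω | hω
  · refine ⟨G.first, θL, G.ωL * G.αL, hL, mul_pos hω G.αL_pos, fun η f hf h0 => ?_, fun ξ hξ => ?_⟩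
    · obtain ⟨h1, h2, -⟩ := le_reservoirGenerator G.αL_pos hL hf h0 G.first
      have h1' := mul_le_mul_of_nonneg_left h1 hω.le
      have h2' := mul_le_mul_of_nonneg_left h2 hω.le
      exact ⟨by linarith [(hgen η f hf h0).1], by linarith [(hgen η f hf h0).1]⟩
    · exact ⟨_, Jumps.of_le (fun h => ξ.1.remove_ne hξ (congrArg Prod.fst h))
        (mul_pos (mul_pos hω G.αL_pos) (by exact_mod_cast hξ))
        fun f hf h0 => (hdual ξ f hf h0).1, ξ.1.size_remove hξ.ne'⟩
  · refine ⟨G.last, θR, G.ωR * G.αR, hR, mul_pos hω G.αR_pos, fun η f hf h0 => ?_, fun ξ hξ => ?_⟩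
    · obtain ⟨h1, h2, -⟩ := le_reservoirGenerator G.αR_pos hR hf h0 G.last
      have h1' := mul_le_mul_of_nonneg_left h1 hω.le
      have h2' := mul_le_mul_of_nonneg_left h2 hω.le
      exact ⟨by linarith [(hgen η f hf h0).2], by linarith [(hgen η f hf h0).2]⟩
    · exact ⟨_, Jumps.of_le (fun h => ξ.1.remove_ne hξ (congrArg Prod.fst h))
        (mul_pos (mul_pos hω G.αR_pos) (by exact_mod_cast hξ))
        fun f hf h0 => (hdual ξ f hf h0).2, ξ.1.size_remove hξ.ne'⟩

theorem zero_mem_scaleRange (σ : SignType) : (0 : ℝ) ∈ scaleRange σ := by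
  rw [scaleRange]; split_ifs <;> simp

/-- The dual process can be absorbed. -/
theorem exists_dual_path (hω : 0 < max G.ωL G.ωR) (ξ : DualConfig G σ) :
    ∃ ξ' : DualConfig G σ, Relation.ReflTransGen (Jumps (dualGenerator G σ)) ξ ξ' ∧
      ξ'.1.size = 0 := by
  obtain ⟨s, -, -, -, -, -, hs⟩ :=
    exists_reservoir (G := G) (zero_mem_scaleRange σ) (zero_mem_scaleRange σ) hω
  induction hn : ξ.1.size generalizing ξ with
  | zero => exact ⟨ξ, .refl, hn⟩
  | succ n ih =>
    obtain ⟨x, hx⟩ := exists_pos_of_size_ne_zero (η := ξ.1) (by omega)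
    obtain ⟨p⟩ := nonempty_walk G x s
    obtain ⟨η', hη', hpos⟩ := exists_path_particle p ξ.1 hx
    obtain ⟨ξ', hj, hsize⟩ := hs (η', ξ.2) hpos
    obtain ⟨ξ'', hp, h0⟩ := ih ξ' (by
      have := size_eq_of_reflTransGen hη'
      dsimp only at hsize
      omega)
    refine ⟨ξ'', Relation.ReflTransGen.trans ?_ (.head hj hp), h0⟩
    exact Relation.ReflTransGen.lift (fun ζ : Config G σ => ((ζ, ξ.2) : DualConfig G σ))
      (fun _ _ (h : BulkStep _ _) => h.jumps_dual ξ.2) _ _ hη'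

theorem reach_of_bulk_path {θL θR : ℝ} (hL : θL ∈ scaleRange σ) (hR : θR ∈ scaleRange σ)
    {η η' : Config G σ} (h : Relation.ReflTransGen BulkStep η η') :
    Relation.ReflTransGen (Jumps (generator G σ θL θR)) η η' :=
  Relation.ReflTransGen.mono (fun _ _ (h : BulkStep _ _) => h.jumps hL hR) _ _ h

/-- Some configuration is reached from everywhere. -/
theorem exists_reachable {θL θR : ℝ} (hL : θL ∈ scaleRange σ) (hR : θR ∈ scaleRange σ)
    (hω : 0 < max G.ωL G.ωR) : ∃ o : Config G σ, ∀ η,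
      Relation.ReflTransGen (Jumps (generator G σ θL θR)) η o := by
  obtain ⟨s, θ, r, hθ, hr, hs, -⟩ := exists_reservoir (G := G) hL hR hω
  rcases (one_add_mul_nonneg hθ).lt_or_eq with hpos | hzero
  · refine ⟨⟨0, fun _ _ => zero_le⟩, fun η => ?_⟩
    induction hn : η.size generalizing η with
    | zero =>
      have : η = ⟨0, fun _ _ => zero_le⟩ := Subtype.ext (funext fun x => by
        have := η.apply_le_size x
        rw [hn] at this
        exact Nat.le_zero.1 this)
      rw [← this]
    | succ n ih =>
      obtain ⟨x, hx⟩ := exists_pos_of_size_ne_zero (η := η) (by omega)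
      obtain ⟨p⟩ := nonempty_walk G x s
      obtain ⟨η', hη', hpos'⟩ := exists_path_particle p η hx
      have hj : Jumps (generator G σ θL θR) η' (η'.remove s) :=
        Jumps.of_le (η'.remove_ne hpos') (mul_pos hr (mul_pos (by exact_mod_cast hpos') hpos))
          fun f hf h0 => (hs η' f hf h0).1
      refine (reach_of_bulk_path hL hR hη').trans (.head hj (ih _ ?_))
      have h1 := size_eq_of_reflTransGen hη'
      have h2 := η'.size_remove hpos'.ne'
      omega
  · have hσ : σ = -1 := by
      rcases σ with _ | _ | _
      · simp at hzero
      · rfl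
      · have := scaleRange_nonneg hθ
        simp only [SignType.pos_eq_one, SignType.coe_one] at hzero
        linarith
    have hθ1 : θ = 1 := by
      subst hσ
      rw [SignType.coe_neg_one] at hzero; linarith
    refine ⟨⟨G.α, fun _ _ => le_rfl⟩, fun η => ?_⟩
    have hle : η.size ≤ ∑ x, G.α x := Finset.sum_le_sum fun x _ => η.2 hσ x
    induction hn : ∑ x, G.α x - η.size generalizing η with
    | zero =>
      have heq : ∑ x, η.1 x = ∑ x, G.α x := le_antisymm hle (by rw [Config.size] at hn; omega)
      have : η = ⟨G.α, fun _ _ => le_rfl⟩ := Subtype.ext (funext fun x =>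
        (Finset.sum_eq_sum_iff_of_le fun x _ => η.2 hσ x).1 heq x (Finset.mem_univ x))
      rw [← this]
    | succ n ih =>
      obtain ⟨x, hx⟩ : ∃ x, η.1 x < G.α x := by
        by_contra! h
        have : ∑ x, G.α x ≤ η.size := Finset.sum_le_sum fun x _ => h x
        omega
      obtain ⟨p⟩ := nonempty_walk G x s
      obtain ⟨η', hη', hlt⟩ := exists_path_hole hσ p η hx
      have hpos' : 0 < (G.α s : ℝ) + (σ : ℝ) * η'.1 s := by
        have : (η'.1 s : ℝ) < G.α s := by exact_mod_cast hlt
        have hσ' : (σ : ℝ) = -1 := by rw [hσ, SignType.coe_neg_one]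
        rw [hσ']; linarith
      have hj : Jumps (generator G σ θL θR) η' (η'.add s) :=
        Jumps.of_le (η'.add_ne hpos'.ne') (mul_pos hr (mul_pos (by rw [hθ1]; exact one_pos) hpos'))
          fun f hf h0 => (hs η' f hf h0).2
      have h1 := size_eq_of_reflTransGen hη'
      have h2 := η'.size_add hpos'.ne'
      exact (reach_of_bulk_path hL hR hη').trans (.head hj (ih _
        (Finset.sum_le_sum fun x _ => (η'.add s).2 hσ x) (by omega)))

end Reachability

/-! ## Absorption of the dual process -/

section Absorption

variable {N : ℕ} {G : Geometry N} {σ : SignType}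

theorem dual_absorbed {ξ : DualConfig G σ} (h : ξ.1.size = 0) {t : ℝ} (ht : 0 ≤ t)
    (ζ : DualConfig G σ) :
    transitionProb (dualGenerator G σ) t ξ ζ = if ζ = ξ then 1 else 0 := by
  have h0 : ∀ x, ξ.1.1 x = 0 := fun x => by have := ξ.1.apply_le_size x; omega
  have hL : ∀ f, dualGenerator G σ f ξ = 0 := fun f => by
    rw [dualGenerator, bulkGenerator_eq_sum]
    simp [h0]
  have hone := tsum_transitionProb isJumpGenerator_dualGenerator
    (isControl_dualGenerator_one (G := G) (σ := σ)) ht ξ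
  have hself : 1 ≤ transitionProb (dualGenerator G σ) t ξ ξ := by
    have h1 : expect (dualGenerator G σ) (Pi.single ξ 1) t ξ =
        transitionProb (dualGenerator G σ) t ξ ξ := by
      rw [expect, tsum_eq_single ξ]
      · simp
      · intro z hz; simp [hz]
    rw [← h1, expect_eq, rateMatrix, hL]
    simp
  have hle : ∀ ζ, (Pi.single ξ 1 : DualConfig G σ → ℝ≥0∞) ζ ≤
      transitionProb (dualGenerator G σ) t ξ ζ := fun ζ => by
    rw [Pi.single_apply]
    split_ifs with h
    · rw [h]; exact hself
    · exact zero_le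
  have := eq_of_le_of_tsum_eq hle (by rw [hone]; simp) (by rw [hone, tsum_pi_single])
  rw [← congrFun this ζ, Pi.single_apply]

/-- Indicator of the dual configurations that are not yet absorbed. -/
def alive (ξ : DualConfig G σ) : ℝ := if ξ.1.size = 0 then 0 else 1

theorem alive_nonneg (ξ : DualConfig G σ) : 0 ≤ alive ξ := by rw [alive]; split_ifs <;> simp

theorem alive_le_one (ξ : DualConfig G σ) : alive ξ ≤ 1 := by rw [alive]; split_ifs <;> simp

theorem dual_semigroup_mono {f g : DualConfig G σ → ℝ} {ξ : DualConfig G σ}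
    (h : ∀ ζ : DualConfig G σ, ζ.total = ξ.total → f ζ ≤ g ζ) {t : ℝ} (ht : 0 ≤ t) :
    semigroup (dualGenerator G σ) t f ξ ≤ semigroup (dualGenerator G σ) t g ξ := by
  rw [dual_semigroup_eq_sum ht, dual_semigroup_eq_sum ht]
  exact Finset.sum_le_sum fun ζ hζ =>
    mul_le_mul_of_nonneg_left (h ζ (mem_sector.1 hζ)) ENNReal.toReal_nonneg

theorem dual_sum_toReal {t : ℝ} (ht : 0 ≤ t) (ξ : DualConfig G σ) :
    ∑ ξ' ∈ sector G σ ξ.total, (transitionProb (dualGenerator G σ) t ξ ξ').toReal = 1 := by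
  rw [← ENNReal.toReal_sum fun ζ _ => transitionProb_ne_top isJumpGenerator_dualGenerator
    isControl_dualGenerator_one ht ξ ζ, dual_sum_transitionProb ht]
  simp

theorem semigroup_alive_of_absorbed {ξ : DualConfig G σ} (h : ξ.1.size = 0) {t : ℝ} (ht : 0 ≤ t) :
    semigroup (dualGenerator G σ) t alive ξ = 0 := by
  rw [dual_semigroup_eq_sum ht]
  refine Finset.sum_eq_zero fun ζ _ => ?_
  rw [dual_absorbed h ht]
  split_ifs with hζ
  · rw [hζ, alive, if_pos h]; simp
  · simp

theorem semigroup_alive_nonneg (ξ : DualConfig G σ) {t : ℝ} (ht : 0 ≤ t) :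
    0 ≤ semigroup (dualGenerator G σ) t alive ξ := by
  rw [dual_semigroup_eq_sum ht]
  exact Finset.sum_nonneg fun ζ _ => mul_nonneg ENNReal.toReal_nonneg (alive_nonneg ζ)

theorem semigroup_alive_le (ξ : DualConfig G σ) {t : ℝ} (ht : 0 ≤ t) :
    semigroup (dualGenerator G σ) t alive ξ ≤ alive ξ := by
  by_cases h : ξ.1.size = 0
  · rw [semigroup_alive_of_absorbed h ht]; exact alive_nonneg ξ
  · rw [alive, if_neg h, ← dual_sum_toReal ht ξ, dual_semigroup_eq_sum ht]
    exact Finset.sum_le_sum fun ζ _ => mul_le_of_le_one_right ENNReal.toReal_nonneg (alive_le_one ζ)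

theorem semigroup_alive_antitone (ξ : DualConfig G σ) {s t : ℝ} (hs : 0 ≤ s) (hst : s ≤ t) :
    semigroup (dualGenerator G σ) t alive ξ ≤ semigroup (dualGenerator G σ) s alive ξ := by
  have h := dual_semigroup_add (alive (G := G) (σ := σ)) (sub_nonneg.2 hst) hs ξ
  rw [add_sub_cancel] at h
  rw [h]
  exact dual_semigroup_mono (fun ζ _ => semigroup_alive_le ζ (sub_nonneg.2 hst)) hs

theorem semigroup_alive_lt_one (hω : 0 < max G.ωL G.ωR) (ξ : DualConfig G σ) :
    semigroup (dualGenerator G σ) 1 alive ξ < 1 := by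
  obtain ⟨ξ', hp, h0⟩ := exists_dual_path hω ξ
  have hpos := transitionProb_pos_of_reflTransGen hp 1 one_pos
  have htot : ξ'.total = ξ.total := by
    by_contra h
    exact hpos.ne' (dual_transitionProb_eq_zero zero_le_one h)
  have hne := transitionProb_ne_top isJumpGenerator_dualGenerator
    (isControl_dualGenerator_one (G := G) (σ := σ)) zero_le_one ξ ξ'
  rw [dual_semigroup_eq_sum zero_le_one]
  refine lt_of_lt_of_eq ?_ (dual_sum_toReal zero_le_one ξ)
  refine Finset.sum_lt_sum
    (fun ζ _ => mul_le_of_le_one_right ENNReal.toReal_nonneg (alive_le_one ζ))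
    ⟨ξ', mem_sector.2 htot, ?_⟩
  rw [alive, if_pos h0, mul_zero]
  exact ENNReal.toReal_pos hpos.ne' hne

/-- The dual process is eventually absorbed. -/
theorem tendsto_semigroup_alive (hω : 0 < max G.ωL G.ωR) (ξ : DualConfig G σ) :
    Tendsto (fun t => semigroup (dualGenerator G σ) t alive ξ) atTop (𝓝 0) := by
  obtain ⟨r, hr0, hr1, hr⟩ : ∃ r : ℝ, 0 ≤ r ∧ r < 1 ∧ ∀ ζ : DualConfig G σ, ζ.total = ξ.total →
      semigroup (dualGenerator G σ) 1 alive ζ ≤ r * alive ζ := by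
    obtain ⟨ζ₀, hζ₀, hmax⟩ := (sector G σ ξ.total).exists_max_image
      (fun ζ => semigroup (dualGenerator G σ) 1 alive ζ) ⟨ξ, mem_sector.2 rfl⟩
    refine ⟨semigroup (dualGenerator G σ) 1 alive ζ₀, semigroup_alive_nonneg _ zero_le_one,
      semigroup_alive_lt_one hω ζ₀, fun ζ hζ => ?_⟩
    by_cases h : ζ.1.size = 0
    · rw [semigroup_alive_of_absorbed h zero_le_one, alive, if_pos h, mul_zero]
    · rw [alive, if_neg h, mul_one]
      exact hmax ζ (mem_sector.2 hζ)
  have hn : ∀ n : ℕ, semigroup (dualGenerator G σ) n alive ξ ≤ r ^ n := by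
    intro n
    induction n with
    | zero => rw [Nat.cast_zero, semigroup_zero, pow_zero]; exact alive_le_one ξ
    | succ n ih =>
      have hn0 : (0 : ℝ) ≤ n := Nat.cast_nonneg n
      rw [Nat.cast_succ, dual_semigroup_add _ zero_le_one hn0]
      refine (dual_semigroup_mono hr hn0).trans ?_
      have : semigroup (dualGenerator G σ) n (fun ζ => r * alive ζ) ξ =
          r * semigroup (dualGenerator G σ) n alive ξ := by
        rw [semigroup, semigroup, ← tsum_mul_left]
        exact tsum_congr fun _ => by ring
      rw [this, pow_succ']
      gcongr
  have hlim : Tendsto (fun t : ℝ => r ^ ⌊t⌋₊) atTop (𝓝 0) :=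
    (tendsto_pow_atTop_nhds_zero_of_lt_one hr0 hr1).comp tendsto_nat_floor_atTop
  refine tendsto_of_tendsto_of_tendsto_of_le_of_le' tendsto_const_nhds hlim ?_ ?_
  · filter_upwards [eventually_ge_atTop 0] with t ht using semigroup_alive_nonneg ξ ht
  · filter_upwards [eventually_ge_atTop 0] with t ht
    exact (semigroup_alive_antitone ξ (Nat.cast_nonneg _) (Nat.floor_le ht)).trans (hn _)

theorem tendsto_dual_of_alive (hω : 0 < max G.ωL G.ωR) (ξ : DualConfig G σ) {ξ' : DualConfig G σ}
    (h : ξ'.1.size ≠ 0) :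
    Tendsto (fun t => transitionProb (dualGenerator G σ) t ξ ξ') atTop (𝓝 0) := by
  have h1 := ENNReal.tendsto_ofReal (tendsto_semigroup_alive hω ξ)
  rw [ENNReal.ofReal_zero] at h1
  refine tendsto_of_tendsto_of_tendsto_of_le_of_le' tendsto_const_nhds h1
    (Eventually.of_forall fun _ => zero_le) ?_
  filter_upwards [eventually_ge_atTop 0] with t ht
  by_cases htot : ξ'.total = ξ.total
  · rw [← ENNReal.ofReal_toReal (transitionProb_ne_top isJumpGenerator_dualGenerator
      isControl_dualGenerator_one ht ξ ξ')]
    refine ENNReal.ofReal_le_ofReal ?_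
    rw [dual_semigroup_eq_sum ht]
    refine le_trans (le_of_eq ?_) (Finset.single_le_sum (fun ζ _ =>
      mul_nonneg ENNReal.toReal_nonneg (alive_nonneg ζ)) (mem_sector.2 htot))
    rw [alive, if_neg h, mul_one]
  · rw [dual_transitionProb_eq_zero ht htot]; exact zero_le

theorem exists_tendsto_dual_of_absorbed (ξ : DualConfig G σ) {ξ' : DualConfig G σ}
    (h : ξ'.1.size = 0) :
    ∃ l, Tendsto (fun t => transitionProb (dualGenerator G σ) t ξ ξ') atTop (𝓝 l) := by
  have hmono : Monotone fun t : ℝ => transitionProb (dualGenerator G σ) (max t 0) ξ ξ' := by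
    intro s t hst
    have h1 : max s 0 ≤ max t 0 := max_le_max_right 0 hst
    have h2 := transitionProb_add isJumpGenerator_dualGenerator
      (isControl_dualGenerator_one (G := G) (σ := σ)) (sub_nonneg.2 h1) (le_max_right s 0) ξ ξ'
    rw [add_sub_cancel] at h2
    dsimp only
    rw [h2]
    refine le_trans (le_of_eq ?_) (ENNReal.le_tsum ξ')
    rw [dual_absorbed h (sub_nonneg.2 h1), if_pos rfl, mul_one]
  refine ⟨_, (tendsto_atTop_iSup hmono).congr' ?_⟩
  filter_upwards [eventually_ge_atTop 0] with t ht
  rw [max_eq_left ht]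

theorem tendsto_dualLimit (hω : 0 < max G.ωL G.ωR) (ξ ξ' : DualConfig G σ) :
    Tendsto (fun t => transitionProb (dualGenerator G σ) t ξ ξ') atTop
      (𝓝 (dualLimit G σ ξ ξ')) := by
  obtain ⟨l, hl⟩ : ∃ l, Tendsto (fun t => transitionProb (dualGenerator G σ) t ξ ξ') atTop (𝓝 l) := by
    by_cases h : ξ'.1.size = 0
    · exact exists_tendsto_dual_of_absorbed ξ h
    · exact ⟨0, tendsto_dual_of_alive hω ξ h⟩
  rwa [dualLimit, hl.limUnder_eq]

theorem dualLimit_of_alive (hω : 0 < max G.ωL G.ωR) (ξ : DualConfig G σ) {ξ' : DualConfig G σ}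
    (h : ξ'.1.size ≠ 0) : dualLimit G σ ξ ξ' = 0 :=
  tendsto_nhds_unique (tendsto_dualLimit hω ξ ξ') (tendsto_dual_of_alive hω ξ h)

theorem dualLimit_of_total_ne (hω : 0 < max G.ωL G.ωR) {ξ ξ' : DualConfig G σ}
    (h : ξ'.total ≠ ξ.total) : dualLimit G σ ξ ξ' = 0 := by
  refine tendsto_nhds_unique (tendsto_dualLimit hω ξ ξ') (tendsto_const_nhds.congr' ?_)
  filter_upwards [eventually_ge_atTop 0] with t ht
  exact (dual_transitionProb_eq_zero ht h).symm

theorem tsum_dualLimit_mul (hω : 0 < max G.ωL G.ωR) (ξ : DualConfig G σ) (f : DualConfig G σ → ℝ) :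
    ∑' ξ', (dualLimit G σ ξ ξ').toReal * f ξ' =
      ∑ ξ' ∈ sector G σ ξ.total, (dualLimit G σ ξ ξ').toReal * f ξ' :=
  tsum_eq_sum fun ζ hζ => by
    rw [mem_sector] at hζ
    simp [dualLimit_of_total_ne hω hζ]

theorem tsum_dualLimit (hω : 0 < max G.ωL G.ωR) (ξ : DualConfig G σ) :
    ∑' ξ', dualLimit G σ ξ ξ' = 1 := by
  rw [tsum_eq_sum (s := sector G σ ξ.total) fun ζ hζ => by
    rw [mem_sector] at hζ
    exact dualLimit_of_total_ne hω hζ]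
  refine tendsto_nhds_unique (tendsto_finsetSum _ fun ξ' _ => tendsto_dualLimit hω ξ ξ')
    (tendsto_const_nhds.congr' ?_)
  filter_upwards [eventually_ge_atTop 0] with t ht
  exact (dual_sum_transitionProb ht ξ).symm

theorem dualLimit_ne_top (hω : 0 < max G.ωL G.ωR) (ξ ξ' : DualConfig G σ) :
    dualLimit G σ ξ ξ' ≠ ⊤ :=
  ENNReal.ne_top_of_tsum_ne_top (by rw [tsum_dualLimit hω ξ]; simp) ξ'

theorem phiInfinity_eq (hω : 0 < max G.ωL G.ωR) (b : ℝ) (ξ : DualConfig G σ) :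
    phiInfinity G σ b ξ = ∑ ξ' ∈ sector G σ ξ.total,
      (dualLimit G σ ξ ξ').toReal * absorbedWeight b ξ' := by
  rw [phiInfinity]
  split_ifs with hb
  · subst hb
    rw [tsum_dualLimit_mul hω]
    refine Finset.sum_congr rfl fun ξ' hξ' => ?_
    rw [← phi_integrand_zero, mem_sector.1 hξ']
  · rw [tsum_dualLimit_mul hω, Finset.mul_sum]
    refine Finset.sum_congr rfl fun ξ' hξ' => ?_
    by_cases h : ξ'.1.size = 0
    · rw [← phi_integrand hb, mem_sector.1 hξ', if_pos]
      · ring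
      · have := mem_sector.1 hξ'
        rw [DualConfig.total_eq, h, add_zero] at this
        exact this
    · rw [dualLimit_of_alive hω ξ h]; simp

end Absorption


/-! ## The stationary measure -/

section Stationary

variable {N : ℕ} {G : Geometry N} {σ : SignType} {θL θR θ b : ℝ}

theorem orthogonalDuality_single (x : Fin N) (k : ℕ)
    (h : σ = -1 → ∀ y, (Pi.single x k : Fin N → ℕ) y ≤ G.α y)
    (η : Config G σ) :
    orthogonalDuality θL θR 0 ((⟨Pi.single x k, h⟩, (0, 0)) : DualConfig G σ) η =
      dClassical σ (G.α x) k (η.1 x) := by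
  rw [orthogonalDuality, Finset.prod_eq_single x]
  · simp [dOrthogonal]
  · intro y _ hy
    dsimp only
    rw [Pi.single_eq_of_ne hy, dOrthogonal_zero_left (G.α_pos y)]
  · simp

/-- Powers of the height are dominated by classical duality functions. -/
theorem height_pow_le_duality (θL θR : ℝ) (k : ℕ) :
    ∃ (A : ℝ) (c : Fin N → ℝ) (ξ : Fin N → DualConfig G σ), ∀ η : Config G σ,
      η.height ^ k ≤ A + ∑ x, c x * orthogonalDuality θL θR 0 (ξ x) η := by
  by_cases hσ : σ = -1
  · refine ⟨(1 + ((∑ x, G.α x : ℕ) : ℝ)) ^ k, fun _ => 0,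
      fun _ => (⟨0, fun _ _ => zero_le⟩, (0, 0)), fun η => ?_⟩
    have hle : (η.size : ℝ) ≤ ((∑ x, G.α x : ℕ) : ℝ) :=
      Nat.cast_le.2 (Finset.sum_le_sum fun x _ => η.2 hσ x)
    simp only [zero_mul, Finset.sum_const_zero, add_zero]
    exact pow_le_pow_left₀ (zero_le_one.trans η.one_le_height) (by rw [Config.height]; linarith) k
  · have hN : (0 : ℝ) < (N : ℝ) ^ k := pow_pos (by exact_mod_cast G.hN) k
    refine ⟨(N : ℝ) ^ k * ∑ _x : Fin N, (2 * ((k + 1 : ℕ) : ℝ) + 1) ^ (k + 1),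
      fun x => (N : ℝ) ^ k * (2 ^ (k + 1) * siteWeight σ (G.α x) (k + 1)),
      fun x => (⟨Pi.single x (k + 1), fun h => absurd h hσ⟩, (0, 0)), fun η => ?_⟩
    have h1 := η.one_le_height
    have hheight : η.height ≤ ∑ x, (1 + (η.1 x : ℝ)) := by
      have : (1 : ℝ) ≤ N := by exact_mod_cast G.hN
      rw [Finset.sum_add_distrib, Config.height, Config.size]
      simp only [Finset.sum_const, Finset.card_univ, Fintype.card_fin, nsmul_eq_mul, mul_one]
      push_cast
      linarith
    calc η.height ^ k ≤ η.height ^ (k + 1) := pow_le_pow_right₀ h1 k.le_succ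
      _ ≤ (∑ x, (1 + (η.1 x : ℝ))) ^ (k + 1) := pow_le_pow_left₀ (zero_le_one.trans h1) hheight _
      _ ≤ (N : ℝ) ^ k * ∑ x, (1 + (η.1 x : ℝ)) ^ (k + 1) := by
        have := pow_sum_div_card_le_sum_pow (s := Finset.univ) (f := fun x => 1 + (η.1 x : ℝ))
          (fun x _ => by positivity) k
        rwa [Finset.card_univ, Fintype.card_fin, div_le_iff₀' hN] at this
      _ ≤ (N : ℝ) ^ k * ∑ x, (2 ^ (k + 1) * falling (η.1 x) (k + 1) +
            (2 * ((k + 1 : ℕ) : ℝ) + 1) ^ (k + 1)) :=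
        mul_le_mul_of_nonneg_left (Finset.sum_le_sum fun x _ => one_add_pow_le _ _) hN.le
      _ = _ := by
        rw [Finset.sum_add_distrib, mul_add, add_comm, Finset.mul_sum (f := fun x =>
          2 ^ (k + 1) * falling (η.1 x) (k + 1))]
        congr 1
        refine Finset.sum_congr rfl fun x _ => ?_
        have hw := siteWeight_ne_zero (l := k + 1) (G.α_pos x) fun h => absurd h hσ
        rw [orthogonalDuality_single, dClassical]
        field_simp

/-- The moments of the process are bounded uniformly in time. -/
theorem exists_moment_bound (hL : θL ∈ scaleRange σ) (hR : θR ∈ scaleRange σ) (k : ℕ)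
    (η₀ : Config G σ) : ∃ B : ℝ, ∀ t, 0 ≤ t →
      expect (generator G σ θL θR) (fun η => ENNReal.ofReal (η.height ^ k)) t η₀ ≤
        ENNReal.ofReal B := by
  have hgen := isJumpGenerator_generator (G := G) hL hR
  have hone := isControl_generator_one (G := G) hL hR
  obtain ⟨A, c, ξ, h⟩ := height_pow_le_duality (G := G) (σ := σ) θL θR k
  have hpos : ∀ η : Config G σ, 0 ≤ η.height ^ k := fun η =>
    pow_nonneg (zero_le_one.trans η.one_le_height) k
  refine ⟨A + ∑ x, |c x| * ∑ ζ ∈ sector G σ (ξ x).total, |orthogonalDuality θL θR 0 ζ η₀|,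
    fun t ht => ?_⟩
  have hfin : expect (generator G σ θL θR) (fun η => ENNReal.ofReal (η.height ^ k)) t η₀ ≠ ⊤ := by
    obtain ⟨e, -, he⟩ := expect_bound hgen (isControl_height hL hR k)
      (f := fun η => η.height ^ k) one_pos (fun η => by rw [abs_of_nonneg (hpos η), one_mul])
    have := he t ht η₀
    simp only [abs_of_nonneg (hpos _)] at this
    exact ne_top_of_le_ne_top ENNReal.ofReal_ne_top this
  rw [← ENNReal.ofReal_toReal hfin, ← semigroup_eq_toReal_expect hpos hfin]
  refine ENNReal.ofReal_le_ofReal ?_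
  have hmass : HasSum (fun η => (transitionProb (generator G σ θL θR) t η₀ η).toReal) 1 := by
    have h1 := tsum_transitionProb hgen hone ht η₀
    have h2 := (ENNReal.summable_toReal (by rw [h1]; simp)).hasSum
    rwa [← ENNReal.tsum_toReal_eq fun η => ENNReal.ne_top_of_tsum_ne_top (by rw [h1]; simp) η,
      h1, ENNReal.toReal_one] at h2
  have hD : ∀ x, HasSum (fun η => (transitionProb (generator G σ θL θR) t η₀ η).toReal *
      orthogonalDuality θL θR 0 (ξ x) η)
      (semigroup (dualGenerator G σ) t (fun ζ => orthogonalDuality θL θR 0 ζ η₀) (ξ x)) := fun x => by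
    rw [← semigroup_duality hL hR (ξ x) η₀ ht]
    exact (summable_semigroup hgen (isControl_height hL hR _)
      (abs_orthogonalDuality_le (ξ x)) ht η₀).hasSum
  have hsum := (hmass.mul_left A).add
    (hasSum_sum fun x (_ : x ∈ Finset.univ) => (hD x).mul_left (c x))
  have hheight : Summable fun η => (transitionProb (generator G σ θL θR) t η₀ η).toReal *
      η.height ^ k :=
    summable_semigroup hgen (isControl_height hL hR k)
      ⟨1, one_pos, fun η => by rw [abs_of_nonneg (hpos η), one_mul]⟩ ht η₀
  refine (hasSum_le (fun η => ?_) hheight.hasSum hsum).trans ?_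
  · refine (mul_le_mul_of_nonneg_left (h η) ENNReal.toReal_nonneg).trans (le_of_eq ?_)
    rw [mul_add, Finset.mul_sum, mul_comm A]
    congr 1
    exact Finset.sum_congr rfl fun x _ => by ring
  · rw [mul_one]
    refine add_le_add le_rfl (Finset.sum_le_sum fun x _ => (le_abs_self _).trans ?_)
    rw [abs_mul]
    exact mul_le_mul_of_nonneg_left (dual_abs_semigroup_le _ ht _) (abs_nonneg _)

theorem orthogonalDuality_of_size_eq_zero (hb : θ = θR + b * (θL - θR)) {ξ : DualConfig G σ}
    (h : ξ.1.size = 0) (η : Config G σ) :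
    orthogonalDuality θL θR θ ξ η = (θL - θR) ^ ξ.total * absorbedWeight b ξ := by
  have h0 : ∀ x, ξ.1.1 x = 0 := fun x => by have := ξ.1.apply_le_size x; omega
  rw [orthogonalDuality, absorbedWeight, if_pos h, DualConfig.total_eq, h, add_zero, pow_add,
    Finset.prod_eq_one fun x _ => by rw [h0, dOrthogonal_zero_left (G.α_pos x)],
    show θL - θ = (θL - θR) * (1 - b) by rw [hb]; ring,
    show θR - θ = (θL - θR) * (-b) by rw [hb]; ring, mul_pow, mul_pow]
  ring

/-- A stationary measure with finite moments integrates the orthogonal duality functions to the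
absorption functionals of the dual process. -/
theorem hasExpectation_stationary (hL : θL ∈ scaleRange σ) (hR : θR ∈ scaleRange σ)
    (hb : θ = θR + b * (θL - θR)) (hω : 0 < max G.ωL G.ωR) {μ : PMF (Config G σ)}
    (hμ : IsStationary (generator G σ θL θR) μ)
    (hmom : ∀ k : ℕ, Summable fun η => (μ η).toReal * η.height ^ k) (ξ : DualConfig G σ) :
    HasExpectation μ (orthogonalDuality θL θR θ ξ)
      ((θL - θR) ^ ξ.total * phiInfinity G σ b ξ) := by
  set m : DualConfig G σ → ℝ := fun ξ => ∑' η, (μ η).toReal * orthogonalDuality θL θR θ ξ η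
  have hm : ∀ ξ, HasSum (fun η => (μ η).toReal * orthogonalDuality θL θR θ ξ η) (m ξ) := by
    intro ξ
    obtain ⟨C, hC, h⟩ := abs_orthogonalDuality_le (G := G) (θL := θL) (θR := θR) (θ := θ) ξ
    refine (Summable.of_norm_bounded ((hmom ξ.total).mul_left C) fun η => ?_).hasSum
    rw [Real.norm_eq_abs, abs_mul, ENNReal.abs_toReal, mul_left_comm]
    exact mul_le_mul_of_nonneg_left (h η) ENNReal.toReal_nonneg
  have hmass : HasSum (fun η => (μ η).toReal) 1 := by
    have h2 := (ENNReal.summable_toReal μ.tsum_coe_ne_top).hasSum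
    rwa [← ENNReal.tsum_toReal_eq fun η => μ.apply_ne_top η, μ.tsum_coe, ENNReal.toReal_one] at h2
  have hm0 : ∀ ξ : DualConfig G σ, ξ.1.size = 0 →
      m ξ = (θL - θR) ^ ξ.total * absorbedWeight b ξ := fun ξ h => by
    refine (hm ξ).unique ?_
    simp only [orthogonalDuality_of_size_eq_zero hb h]
    simpa using hmass.mul_right ((θL - θR) ^ ξ.total * absorbedWeight b ξ)
  have hstat : ∀ t, 0 ≤ t → m ξ = ∑ ξ' ∈ sector G σ ξ.total,
      (transitionProb (dualGenerator G σ) t ξ ξ').toReal * m ξ' := fun t ht => by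
    have h := hasExpectation_duality hL hR μ.tsum_coe_ne_top hmom hm ht ξ
    rw [funext (hμ t ht)] at h
    exact (hm ξ).unique h
  have hlim : m ξ = ∑ ξ' ∈ sector G σ ξ.total, (dualLimit G σ ξ ξ').toReal * m ξ' := by
    refine tendsto_nhds_unique (tendsto_const_nhds.congr' ?_) (tendsto_finsetSum _ fun ξ' _ =>
      ((ENNReal.tendsto_toReal (dualLimit_ne_top hω ξ ξ')).comp
        (tendsto_dualLimit hω ξ ξ')).mul_const (m ξ'))
    filter_upwards [eventually_ge_atTop 0] with t ht using hstat t ht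
  suffices hval : (θL - θR) ^ ξ.total * phiInfinity G σ b ξ = m ξ by
    rw [hval]; exact hm ξ
  rw [hlim, phiInfinity_eq hω, Finset.mul_sum]
  refine Finset.sum_congr rfl fun ξ' hξ' => ?_
  by_cases h0 : ξ'.1.size = 0
  · rw [hm0 ξ' h0, mem_sector.1 hξ']; ring
  · rw [dualLimit_of_alive hω ξ h0]; simp

theorem exists_stationary (hL : θL ∈ scaleRange σ) (hR : θR ∈ scaleRange σ)
    (hb : θ = θR + b * (θL - θR)) (hω : 0 < max G.ωL G.ωR) :
    ∃ μ : PMF (Config G σ), IsStationary (generator G σ θL θR) μ ∧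
      (∀ μ' : PMF (Config G σ), IsStationary (generator G σ θL θR) μ' → μ' = μ) ∧
      ∀ ξ : DualConfig G σ, HasExpectation μ (orthogonalDuality θL θR θ ξ)
        ((θL - θR) ^ ξ.total * phiInfinity G σ b ξ) := by
  obtain ⟨o, ho⟩ := exists_reachable (G := G) hL hR hω
  choose B hB using fun k : ℕ => exists_moment_bound (G := G) hL hR k o
  obtain ⟨μ, hμ, huniq, hmom⟩ := exists_unique_stationary (isJumpGenerator_generator hL hR)
    (isControl_generator_one hL hR)
    (fun η => transitionProb_pos_of_reflTransGen (ho η) 1 one_pos) o (h := Config.height)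
    finite_height_le (B := B 1) fun k => by simpa using hB 1 k (Nat.cast_nonneg k)
  refine ⟨μ, hμ, huniq, hasExpectation_stationary hL hR hb hω hμ fun k => ?_⟩
  have h := hmom (fun η => η.height ^ k) (ENNReal.ofReal (B k)) fun n => hB k n (Nat.cast_nonneg n)
  have := ENNReal.summable_toReal (ne_top_of_le_ne_top ENNReal.ofReal_ne_top h)
  refine this.congr fun η => ?_
  rw [ENNReal.toReal_mul, ENNReal.toReal_ofReal (pow_nonneg (zero_le_one.trans η.one_le_height) k)]

end Stationary

end BoundaryDriven

end

theorem mainTheorem8 {N : ℕ} (G : BoundaryDriven.Geometry N) (σ : SignType) (θL θR b θ : ℝ)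
    (hθL : θL ∈ BoundaryDriven.scaleRange σ) (hθR : θR ∈ BoundaryDriven.scaleRange σ)
    (hθ : θ = θR + b * (θL - θR)) (hθmem : θ ∈ BoundaryDriven.scaleRange σ) :
    (∀ t : ℝ, 0 ≤ t → ∀ ξ : BoundaryDriven.DualConfig G σ,
      BoundaryDriven.HasExpectation
        (BoundaryDriven.lawAt (BoundaryDriven.generator G σ θL θR)
          (BoundaryDriven.productMeasure G σ θ) t)
        (BoundaryDriven.orthogonalDuality θL θR θ ξ)
        ((θL - θR) ^ ξ.total * BoundaryDriven.phiTime G σ t b ξ)) ∧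
    (0 < max G.ωL G.ωR →
      (∀ ξ : BoundaryDriven.DualConfig G σ,
        (∀ ξ' : BoundaryDriven.DualConfig G σ,
          Filter.Tendsto
            (fun t : ℝ => BoundaryDriven.transitionProb (BoundaryDriven.dualGenerator G σ) t ξ ξ')
            Filter.atTop (nhds (BoundaryDriven.dualLimit G σ ξ ξ'))) ∧
        ∑' ξ' : BoundaryDriven.DualConfig G σ, BoundaryDriven.dualLimit G σ ξ ξ' = 1) ∧
      ∃ μ : PMF (BoundaryDriven.Config G σ),
        BoundaryDriven.IsStationary (BoundaryDriven.generator G σ θL θR) μ ∧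
        (∀ μ' : PMF (BoundaryDriven.Config G σ),
          BoundaryDriven.IsStationary (BoundaryDriven.generator G σ θL θR) μ' → μ' = μ) ∧
        ∀ ξ : BoundaryDriven.DualConfig G σ,
          BoundaryDriven.HasExpectation μ (BoundaryDriven.orthogonalDuality θL θR θ ξ)
            ((θL - θR) ^ ξ.total * BoundaryDriven.phiInfinity G σ b ξ)) :=
  ⟨fun _ ht ξ => BoundaryDriven.hasExpectation_productMeasure hθL hθR hθ hθmem ht ξ, fun hω =>
    ⟨fun ξ => ⟨BoundaryDriven.tendsto_dualLimit hω ξ, BoundaryDriven.tsum_dualLimit hω ξ⟩,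
      BoundaryDriven.exists_stationary hθL hθR hθ hω⟩⟩
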